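/- **Setting.** Let $R>0$, let $\Omega=\{x\in\mathbb R^2:|x|<R\}$, and let $n=n(r)$ be a radial optical index such that $n\in\mathcal C^\infty([0,R])$, $n(r)>1$ for $0\le r\le R$, and $n(r)=1$ for $r>R$. Put $n_i=\lim_{r\nearrow R}\partial_r^i n(r)$ and $$\breve\kappa=R\Bigl(\frac1R+\frac{n_1}{n_0}\Bigr),\qquad \breve\mu=R^2\Bigl(\frac2{R^2}-\frac{n_2}{n_0}\Bigr).$$ For a sequence, $a_m=\mathcal O(m^{-\infty})$ means that for all $N\in\mathbb N$ there is $C_N$ with $|a_m|\le C_N m^{-N}$ for all $m\ge1$. For $p\in\{\pm1\}$ let $\mathrm H^2_p(\mathbb R^2,\Omega)$ be the set of complex $u\in \mathrm L^2(\mathbb R^2)$ with $u|_\Omega\in \mathrm H^2(\Omega)$, $u|_{\mathbb R^2\setminus\overline\Omega}\in \mathrm H^2(\mathbb R^2\setminus\overline\Omega)$, $[u]_{\partial\Omega}=0$ and $[n^{p-1}\partial_\nu u]_{\partial\Omega}=0$, where $[\cdot]$ is the jump of traces. Say that a sequence $(k(m),u(m))_{m\ge1}$ *satisfies the quasi-pair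 estimate* if $u(m)\in \mathrm H^2_p(\mathbb R^2,\Omega)$ for all $m\ge1$ and $$\bigl\|-\operatorname{div}(n^{p-1}\nabla u(m))-k(m)^2n^{p+1}u(m)\bigr\|_{\mathrm L^2(\mathbb R^2)}=\mathcal O(m^{-\infty}).$$ A *family of resonance quasi-pairs* consists of real numbers $k(m)$ and functions $u(m)$, $m\ge1$, such that (1) $\|u(m)\|_{\mathrm L^2(\mathbb R^2)}=1$; (2) $(k(m),u(m))$ satisfies the quasi-pair estimate; (3) there is $\mathfrak X\in\mathcal C_0^\infty(\mathbb R^2)$, $0\le\mathfrak X\le1$, with $\|\mathfrak Xu(m)\|_{\mathrm L^2(\mathbb R^2)}\ge\frac12$ for all $m\ge1$ and such that $(k(m),\mathfrak Xu(m))$ satisfies the quasi-pair estimate; (4) there are $\beta>0$ and $\mathrm K\in\mathcal C^\infty([0,1])$ with $k(m)/m=\mathrm K(m^{-\beta})$ for all $m\ge1$. It is *of whispering gallery type* if moreover, for every $\mathfrak X\in\mathcal C_0^\infty(\mathbb R^2)$ with $0\le\mathfrak X\le1$ that is $\equiv1$ in a neighborhood of $\partial\Omega$, one has $\|\mathfrak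 Xu(m)\|_{\mathrm L^2(\mathbb R^2)}\ge\frac12$ for $m$ large enough, and $(k(m),\mathfrak Xu(m))$ satisfies the quasi-pair estimate. $\Psi_\ell$ denotes the $\mathrm L^2(\mathbb R)$-normalized Gauss–Hermite function $\Psi_\ell(z)=(2^\ell\ell!\sqrt\pi)^{-1/2}H_\ell(z)e^{-z^2/2}$. For a closed half-line $I$, $\mathcal S(I)$ is the space of functions smooth on $I$ whose derivatives are all rapidly decreasing. **Theorem 5.1.** Assume that $\breve\kappa=0$ and $\breve\mu>0$. Then for each $p\in\{\pm1\}$ and each $j\in\mathbb N=\{0,1,2,\dots\}$ there is a family $(\underline k(m),\underline u(m))_{m\ge1}$ of resonance quasi-pairs of whispering gallery type with the following properties. (i) Property (4) holds with $\beta=\frac12$, and there are coefficients $\mathrm K^\ell$ ($\ell\in\mathbb N$) and constants $C_N$ such that for all $N\in\mathbb N$ and $m\ge1$ $$\Bigl|\frac{\underline k(m)}m-\sum_{\ell=0}^{N-1}\mathrm K^\ell m^{-\ell/2}\Bigr|\le C_Nm^{-N/2},$$ where $$\mathrm K^0=\frac1{Rn_0},\qquad \mathrm K^1=0,\qquad \mathrm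 K^2=\frac1{Rn_0}\Bigl(2j+\frac32\Bigr)\sqrt{\breve\mu},\qquad \mathrm K^3=\frac1{Rn_0}\,\mathrm k^3\,\breve\mu^{3/4},$$ $$\mathrm k^3=\Psi_{2j+1}'(0)^2\Bigl[\frac{-n_0^p}{\sqrt{n_0^2-1}}+\frac{4j+3}{9\breve\mu^{3/2}}\Bigl(6+\frac{R^3n_3}{n_0}-6\breve\mu\Bigr)\Bigr].$$ (In particular the coefficients of degree $2$ are distinct for distinct $j$.) (ii) There are a function $\mathfrak X\in\mathcal C_0^\infty((0,\infty))$ with $\mathfrak X\equiv1$ near $R$, real functions $\Phi\in\mathcal C^\infty([0,1],\mathcal S((-\infty,0]))$ and $\Psi\in\mathcal C^\infty([0,1],\mathcal S([0,\infty)))$, and normalization factors $a_m>0$, such that in polar coordinates, for all $m\ge1$ and $r\ne R$, $$\underline u(m;r,\theta)=a_m\,\mathfrak X(r)\bigl(\mathbf 1_{r<R}\,\Phi(m^{-1/2},\sigma)+\mathbf 1_{r>R}\,\Psi(m^{-1/2},\rho)\bigr)e^{im\theta},\qquad \sigma=m^{1/2}\Bigl(\frac rR-1\Bigr),\quad \rho=m\Bigl(\frac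 rR-1\Bigr).$$ The first terms of the profiles are, with $A=-n_0^p\,\breve\mu^{1/4}\,\Psi_{2j+1}'(0)/\sqrt{n_0^2-1}$, for all $\sigma\le0\le\rho$, $$\Phi(0,\sigma)=\varphi_0(\sigma):=\Psi_{2j+1}(\breve\mu^{1/4}\sigma),\qquad \Psi(0,\rho)=0,$$ $$\partial_t\Phi(0,\sigma)=\varphi_1(\sigma)=\frac{A}{\Psi_0(0)}\Psi_0(\breve\mu^{1/4}\sigma)+\widetilde\varphi_1(\sigma),\qquad \partial_t\Psi(0,\rho)=A\exp\Bigl(-\frac{\sqrt{n_0^2-1}}{n_0}\rho\Bigr),$$ where $\widetilde\varphi_1(0)=0$, $\int_{-\infty}^0\widetilde\varphi_1\varphi_0\,d\sigma=0$, and on $(-\infty,0)$ $$-\varphi_1''+\bigl(\breve\mu\sigma^2-(4j+3)\sqrt{\breve\mu}\bigr)\varphi_1=2\breve\mu^{3/4}\mathrm k^3\varphi_0+2\sigma\varphi_0''+(2-p)\varphi_0'+\Bigl(2-\breve\mu+\frac{R^3n_3}{3n_0}\Bigr)\sigma^3\varphi_0 .$$ -/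

import Mathlib

open MeasureTheory Set Filter Topology
open scoped ContDiff ENNReal

noncomputable section

namespace WGM

/-- The Euclidean plane. -/
abbrev Plane : Type := EuclideanSpace ℝ (Fin 2)

/-- The point with polar coordinates `(r, θ)`. -/
def polarPoint (r θ : ℝ) : Plane := !₂[r * Real.cos θ, r * Real.sin θ]

/-- The cavity: the open disk of radius `R` centred at the origin. -/
def cavity (R : ℝ) : Set Plane := {x | ‖x‖ < R}

/-- The exterior of the closed disk of radius `R`. -/
def exterior (R : ℝ) : Set Plane := {x | R < ‖x‖}

/-- The interface: the circle of radius `R`. -/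
def interface (R : ℝ) : Set Plane := {x | ‖x‖ = R}

/-! ### The optical index -/

/-- Standing assumption on the radial optical index `n`: it is smooth on `[0, R]` up to both
end points, `> 1` there, and equal to `1` for `r > R`. -/
structure IsOpticalIndex (n : ℝ → ℝ) (R : ℝ) : Prop where
  smooth : ContDiffOn ℝ ∞ n (Icc 0 R)
  one_lt : ∀ r ∈ Icc 0 R, 1 < n r
  eq_one : ∀ r, R < r → n r = 1

/-- `nCoeff n R i` is the `i`-th derivative of `n` at `R` from inside the cavity. -/
def nCoeff (n : ℝ → ℝ) (R : ℝ) (i : ℕ) : ℝ := iteratedDerivWithin i n (Icc 0 R) R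

/-- The effective adimensional curvature `κ = R (1/R + n₁/n₀)`. -/
def effCurvature (n : ℝ → ℝ) (R : ℝ) : ℝ := R * (1 / R + nCoeff n R 1 / nCoeff n R 0)

/-- The adimensional hessian `μ = R² (2/R² - n₂/n₀)`. -/
def effHessian (n : ℝ → ℝ) (R : ℝ) : ℝ :=
  R ^ 2 * (2 / R ^ 2 - nCoeff n R 2 / nCoeff n R 0)

/-! ### Sobolev spaces through weak derivatives -/

/-- `φ` is a (real valued) test function on the open set `U`. -/
def IsTestFunction (U : Set Plane) (φ : Plane → ℝ) : Prop :=
  ContDiff ℝ ∞ φ ∧ HasCompactSupport φ ∧ tsupport φ ⊆ U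

/-- The `i`-th partial derivative of a smooth function. -/
def partialDeriv (i : Fin 2) (φ : Plane → ℝ) (x : Plane) : ℝ :=
  fderiv ℝ φ x (EuclideanSpace.single i (1 : ℝ))

/-- `G` is the weak gradient of `u` on the open set `U`. -/
structure HasWeakGradient (U : Set Plane) (u : Plane → ℂ) (G : Fin 2 → Plane → ℂ) : Prop where
  loc : LocallyIntegrableOn u U
  loc_grad : ∀ i, LocallyIntegrableOn (G i) U
  parts : ∀ i, ∀ φ : Plane → ℝ, IsTestFunction U φ →
    ∫ x, partialDeriv i φ x • u x = - ∫ x, φ x • G i x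

/-- `u ∈ H¹(U)`. -/
def MemH1 (U : Set Plane) (u : Plane → ℂ) : Prop :=
  MemLp u 2 (volume.restrict U) ∧
    ∃ G : Fin 2 → Plane → ℂ, HasWeakGradient U u G ∧ ∀ i, MemLp (G i) 2 (volume.restrict U)

/-- `u ∈ H²(U)`. -/
def MemH2 (U : Set Plane) (u : Plane → ℂ) : Prop :=
  MemLp u 2 (volume.restrict U) ∧
    ∃ G : Fin 2 → Plane → ℂ, HasWeakGradient U u G ∧ ∀ i, MemH1 U (G i)

/-- `v` has the trace `θ ↦ g θ` on the circle of radius `R`, from the side selected by the filter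
`l` on the radii (`𝓝[<] R`: from inside, `𝓝[>] R`: from outside): the restrictions of `v` to the
concentric circles of almost every radius `r` tend to `g` in `L²` as `r → R`. The restriction to
almost every radius makes the notion independent of the representative of `v`. -/
def HasTrace (l : Filter ℝ) (v : Plane → ℂ) (g : ℝ → ℂ) : Prop :=
  MemLp g 2 (volume.restrict (Ioc 0 (2 * Real.pi))) ∧
    Tendsto (fun r : ℝ =>
        eLpNorm (fun θ => v (polarPoint r θ) - g θ) 2 (volume.restrict (Ioc 0 (2 * Real.pi))))
      (l ⊓ ae volume) (𝓝 0)

/-- `n^{p-1} ∂_ν u`, the radial component of `n^{p-1} G`, where `G` is the gradient of `u`. -/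
def radialFlux (n : ℝ → ℝ) (p : ℤ) (G : Fin 2 → Plane → ℂ) (x : Plane) : ℂ :=
  ((n ‖x‖) ^ (p - 1) : ℝ) • ∑ i, (x i / ‖x‖ : ℝ) • G i x

/-- The domain `H²_p(ℝ², Ω)`: functions of `L²(ℝ²)` that are `H²` inside and outside the cavity
and such that `[u] = 0` and `[n^{p-1} ∂_ν u] = 0` across the interface. -/
def MemDomain (n : ℝ → ℝ) (p : ℤ) (R : ℝ) (u : Plane → ℂ) : Prop :=
  MemLp u 2 volume ∧ MemH2 (cavity R) u ∧ MemH2 (exterior R) u ∧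
    (∃ g, HasTrace (𝓝[<] R) u g ∧ HasTrace (𝓝[>] R) u g) ∧
    ∃ G : Fin 2 → Plane → ℂ, HasWeakGradient (cavity R) u G ∧ HasWeakGradient (exterior R) u G ∧
      ∃ g, HasTrace (𝓝[<] R) (radialFlux n p G) g ∧ HasTrace (𝓝[>] R) (radialFlux n p G) g

/-! ### Families of resonance quasi-pairs -/

/-- `f = - div (n^{p-1} ∇u) - k² n^{p+1} u` (weakly) on both sides of the interface. For `u` in the
domain `MemDomain n p R` this is the same as the identity on the whole plane. -/
def IsHelmholtzResidual (n : ℝ → ℝ) (p : ℤ) (R k : ℝ) (u f : Plane → ℂ) : Prop :=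
  ∃ G : Fin 2 → Plane → ℂ, HasWeakGradient (interface R)ᶜ u G ∧
    LocallyIntegrableOn f (interface R)ᶜ ∧
    ∀ φ : Plane → ℝ, IsTestFunction (interface R)ᶜ φ →
      (∫ x, ∑ i, ((n ‖x‖) ^ (p - 1) * partialDeriv i φ x : ℝ) • G i x)
        - (∫ x, (k ^ 2 * (n ‖x‖) ^ (p + 1) * φ x : ℝ) • u x) = ∫ x, φ x • f x

/-- `a_m = O(m^{-∞})`. -/
def IsRapidlySmall (a : ℕ → ℝ) : Prop :=
  ∀ N : ℕ, ∃ C : ℝ, ∀ m : ℕ, 1 ≤ m → |a m| ≤ C * (m : ℝ) ^ (-(N : ℤ))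

/-- The functions `u m` belong to the domain, and the `L²(ℝ²)` norms of
`- div (n^{p-1} ∇ u_m) - k_m² n^{p+1} u_m` are `O(m^{-∞})`. -/
def QuasiPairEstimate (n : ℝ → ℝ) (p : ℤ) (R : ℝ) (k : ℕ → ℝ) (u : ℕ → Plane → ℂ) : Prop :=
  (∀ m : ℕ, 1 ≤ m → MemDomain n p R (u m)) ∧
    ∃ f : ℕ → Plane → ℂ,
      (∀ m : ℕ, 1 ≤ m → MemLp (f m) 2 volume ∧ IsHelmholtzResidual n p R (k m) (u m) (f m)) ∧
      IsRapidlySmall fun m => (eLpNorm (f m) 2 volume).toReal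

/-- Smooth compactly supported cut-off functions on the plane with values in `[0, 1]`. -/
def IsCutoff (X : Plane → ℝ) : Prop :=
  ContDiff ℝ ∞ X ∧ HasCompactSupport X ∧ ∀ x, X x ∈ Icc (0 : ℝ) 1

/-- `k m / m = K (m^{-β})` for all `m ≥ 1`, with a function `K` smooth on `[0, 1]`. -/
def IsRegularInM (k : ℕ → ℝ) (β : ℝ) : Prop :=
  ∃ K : ℝ → ℝ, ContDiffOn ℝ ∞ K (Icc 0 1) ∧
    ∀ m : ℕ, 1 ≤ m → k m / m = K ((m : ℝ) ^ (-β))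

/-- Families of resonance quasi-pairs `(k m, u m)`, `m ≥ 1`. -/
structure IsQuasiPairFamily (n : ℝ → ℝ) (p : ℤ) (R : ℝ) (k : ℕ → ℝ) (u : ℕ → Plane → ℂ) :
    Prop where
  normalized : ∀ m : ℕ, 1 ≤ m → eLpNorm (u m) 2 volume = 1
  estimate : QuasiPairEstimate n p R k u
  localized : ∃ X : Plane → ℝ, IsCutoff X ∧
    (∀ m : ℕ, 1 ≤ m → 1 / 2 ≤ eLpNorm (fun x => X x • u m x) 2 volume) ∧
    QuasiPairEstimate n p R k fun m x => X x • u m x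
  regular : ∃ β : ℝ, 0 < β ∧ IsRegularInM k β

/-- Families of whispering gallery type: every cut-off function that is `1` in a neighbourhood of
the interface can be used in the localization property, for `m` large enough. -/
structure IsWhisperingGalleryFamily (n : ℝ → ℝ) (p : ℤ) (R : ℝ) (k : ℕ → ℝ) (u : ℕ → Plane → ℂ) :
    Prop extends IsQuasiPairFamily n p R k u where
  gallery : ∀ X : Plane → ℝ, IsCutoff X → (∀ᶠ x in 𝓝ˢ (interface R), X x = 1) →
    (∃ M : ℕ, ∀ m : ℕ, M ≤ m → 1 / 2 ≤ eLpNorm (fun x => X x • u m x) 2 volume) ∧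
    QuasiPairEstimate n p R k fun m x => X x • u m x

/-! ### Profiles -/

/-- `F ∈ C^∞([0, 1], 𝓢(I))` for a closed half-line `I`: `(t, s) ↦ F (t, s)` is smooth on
`[0, 1] × I` and all its derivatives decrease in `s` faster than any power, uniformly in `t`. -/
def IsSchwartzFamily (I : Set ℝ) (F : ℝ × ℝ → ℝ) : Prop :=
  ContDiffOn ℝ ∞ F (Icc 0 1 ×ˢ I) ∧
    ∀ a d : ℕ, ∃ C : ℝ, ∀ z ∈ Icc (0 : ℝ) 1 ×ˢ I,
      |z.2| ^ a * ‖iteratedFDerivWithin ℝ d F (Icc 0 1 ×ˢ I) z‖ ≤ C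

/-- The Gauss-Hermite functions, normalized in `L²(ℝ)`:
`Ψ_ℓ(z) = (2^ℓ ℓ! √π)^{-1/2} H_ℓ(z) e^{-z²/2}` with the physicists' Hermite polynomials
`H_ℓ(z) = 2^{ℓ/2} He_ℓ(√2 z)`, where `He_ℓ` is `Polynomial.hermite ℓ`. -/
def gaussHermite (l : ℕ) (z : ℝ) : ℝ :=
  (Real.sqrt (l.factorial * Real.sqrt Real.pi))⁻¹ *
    Polynomial.aeval (Real.sqrt 2 * z) (Polynomial.hermite l) * Real.exp (-z ^ 2 / 2)

/-- The leading interior profile `φ₀(σ) = Ψ_{2j+1}(μ^{1/4} σ)`. -/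
def leadingProfile (n : ℝ → ℝ) (R : ℝ) (j : ℕ) (σ : ℝ) : ℝ :=
  gaussHermite (2 * j + 1) (effHessian n R ^ (1 / 4 : ℝ) * σ)

/-- The amplitude `A = - n₀^p μ^{1/4} Ψ_{2j+1}'(0) / √(n₀² - 1)` of the exterior profile. -/
def exteriorAmplitude (n : ℝ → ℝ) (p : ℤ) (R : ℝ) (j : ℕ) : ℝ :=
  -(nCoeff n R 0 ^ p * effHessian n R ^ (1 / 4 : ℝ) * deriv (gaussHermite (2 * j + 1)) 0) /
    Real.sqrt (nCoeff n R 0 ^ 2 - 1)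

/-- The coefficient `k³` of `(√μ / m)^{3/2}` in the expansion of `(R n₀ / m) k(m)`:
`Ψ_{2j+1}'(0)² [- n₀^p / √(n₀² - 1) + (4j+3) / (9 μ^{3/2}) (6 + R³ n₃ / n₀ - 6 μ)]`. -/
def thirdCoeff (n : ℝ → ℝ) (p : ℤ) (R : ℝ) (j : ℕ) : ℝ :=
  deriv (gaussHermite (2 * j + 1)) 0 ^ 2 *
    (-(nCoeff n R 0 ^ p) / Real.sqrt (nCoeff n R 0 ^ 2 - 1) +
      (4 * j + 3) / (9 * effHessian n R ^ (3 / 2 : ℝ)) *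
        (6 + R ^ 3 * nCoeff n R 3 / nCoeff n R 0 - 6 * effHessian n R))

/-- `φ₁` is the second interior profile: `φ₁ = A Ψ₀(μ^{1/4} σ) / Ψ₀(0) + φ̃₁`, where `φ̃₁` vanishes
at `0`, is orthogonal to `φ₀` on `(-∞, 0)`, and is such that
`- φ₁'' + (μ σ² - (4j+3) √μ) φ₁ = 2 μ^{3/4} k³ φ₀ + 2 σ φ₀'' + (2 - p) φ₀'
  + (2 - μ + R³ n₃ / (3 n₀)) σ³ φ₀` on `(-∞, 0)`. -/
structure IsSecondProfile (n : ℝ → ℝ) (p : ℤ) (R : ℝ) (j : ℕ) (φ₁ : ℝ → ℝ) : Prop where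
  boundary : φ₁ 0 = exteriorAmplitude n p R j
  equation : ∀ σ : ℝ, σ < 0 →
    -iteratedDeriv 2 φ₁ σ
        + (effHessian n R * σ ^ 2 - (4 * j + 3) * Real.sqrt (effHessian n R)) * φ₁ σ
      = 2 * effHessian n R ^ (3 / 4 : ℝ) * thirdCoeff n p R j * leadingProfile n R j σ
        + 2 * σ * iteratedDeriv 2 (leadingProfile n R j) σ
        + (2 - p) * deriv (leadingProfile n R j) σ
        + (2 - effHessian n R + R ^ 3 * nCoeff n R 3 / (3 * nCoeff n R 0)) * σ ^ 3
            * leadingProfile n R j σ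
  orthogonal : ∫ σ in Iio (0 : ℝ),
    (φ₁ σ - exteriorAmplitude n p R j / gaussHermite 0 0
        * gaussHermite 0 (effHessian n R ^ (1 / 4 : ℝ) * σ)) * leadingProfile n R j σ = 0

end WGM

end

open WGM

/-! Put t = m^{-1/2}. After separation of e^{imθ}, the interior equation is written in x = (1 -
r/R)/t = -σ and the exterior one in ρ = (r/R - 1)/t², both on [0, ∞), with k² = m²(1 + t² e(t))/(R²
n₀²). The interior effective potential becomes T(tx)/t², where 1 + T = (n₀R/(n(r) r))². Zero
effective curvature means that r n(r) is critical at R, so T(y) starts with μy². At t = 0 the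
interior operator is therefore the oscillator -g'' + μx²g, and the exterior one is -ψ'' + (1 -
n₀⁻²)ψ, whose solutions decay because n₀ > 1.

The two radial scales differ by a factor t, so continuity of the flux reads ∂_ρΨ = -n₀^{p-1} t ∂_xG
at 0. At leading order the exterior profile has zero Neumann datum and vanishes. The interior
profile then satisfies a Dirichlet condition, which selects the odd Hermite functions and the
energies (4j+3)√μ.

Higher orders are solved one at a time (`exists_profiles`). The exterior problem has Neumann data
known from the previous order; its value at 0 is the Dirichlet datum of the interior problem, and
the new energy coefficient is what makes that datum attainable. The solvability condition is Green's
formula on the half-line. At order one it reduces to the moments ∫xg² and ∫x³g², which give the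
coefficient k³ (`second_energy`). Schwartz solutions exist because the operators factor into
first-order ones (`exists_solution_oscillator`, `exists_solution_exponential`).

Borel summation turns the formal series into functions smooth in t. The transmission conditions then
hold only up to flat errors, which are removed exactly (`IsProfile.exists_transmission`), and the
residuals of both equations are O(t^∞) (`interiorResidual_rapid`, `exteriorResidual_rapid`).

In the plane, the quasi-mode is the glued profile times a cut-off equal to 1 near the circle. The
commutator with the cut-off lives at a fixed distance from the circle, where the rapid decay of the
profiles is worth any power of t (`quasiMode_helmholtz_bound`). The L² norm before normalization is
bounded below by a multiple of t (`eLpNorm_quasiMode_lower`), so normalization costs only a power of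
m. Any further admissible cut-off merely replaces the first one, which gives the whispering gallery
property. Expanding the square root in k yields the coefficients K^ℓ. -/

open scoped SchwartzMap

namespace WGM

/-! ### Schwartz functions on a half-line -/

/-- Differentiation of Schwartz functions. -/
noncomputable def sD : 𝓢(ℝ, ℝ) →L[ℝ] 𝓢(ℝ, ℝ) := SchwartzMap.derivCLM ℝ ℝ

/-- Multiplication of a Schwartz function by the coordinate. -/
noncomputable def sX : 𝓢(ℝ, ℝ) →L[ℝ] 𝓢(ℝ, ℝ) := SchwartzMap.smulLeftCLM ℝ (fun x : ℝ => x)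

theorem sD_apply (f : 𝓢(ℝ, ℝ)) (x : ℝ) : sD f x = deriv f x := rfl

theorem sX_apply (f : 𝓢(ℝ, ℝ)) (x : ℝ) : sX f x = x * f x := by
  simp [sX, SchwartzMap.smulLeftCLM_apply_apply (Function.HasTemperateGrowth.id' (E := ℝ))]

theorem hasDerivAt_sD (f : 𝓢(ℝ, ℝ)) (x : ℝ) : HasDerivAt f (sD f x) x := f.hasDerivAt x

theorem sX_pow_apply (f : 𝓢(ℝ, ℝ)) (l : ℕ) (x : ℝ) : (sX ^ l) f x = x ^ l * f x := by
  induction l with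
  | zero => simp
  | succ l ih =>
    rw [pow_succ', mul_apply_eq_comp, sX_apply, ih]; ring

theorem sD_congr {f : 𝓢(ℝ, ℝ)} {g g' : ℝ → ℝ} {a : ℝ} (h : ∀ x > a, f x = g x)
    (hg : ∀ x > a, HasDerivAt g (g' x) x) : ∀ x > a, sD f x = g' x := by
  intro x hx
  have : (f : ℝ → ℝ) =ᶠ[𝓝 x] g := by
    filter_upwards [lt_mem_nhds hx] with y hy using h y hy
  rw [sD_apply, this.deriv_eq, (hg x hx).deriv]

/-- A smooth step vanishing left of -2 and equal to 1 right of -1 removes whatever f does on the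
left. Half-line equations are imposed on x > -1 throughout: this is an open set containing [0, ∞),
so they can be differentiated at 0. -/
theorem exists_schwartz_of_decay (f : ℝ → ℝ) (hf : ContDiff ℝ ∞ f)
    (hdec : ∀ a d : ℕ, ∃ C, ∀ x : ℝ, 0 ≤ x → |x| ^ a * |iteratedDeriv d f x| ≤ C) :
    ∃ g : 𝓢(ℝ, ℝ), ∀ x > -1, g x = f x := by
  set χ : ℝ → ℝ := fun x => Real.smoothTransition (x + 2) with hχ
  have hχs : ContDiff ℝ ∞ χ :=
    Real.smoothTransition.contDiff.comp (contDiff_id.add contDiff_const)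
  have hχ1 : ∀ x, -1 ≤ x → χ x = 1 := fun x hx =>
    Real.smoothTransition.one_of_one_le (by linarith)
  have hχ0 : ∀ x, x ≤ -2 → χ x = 0 := fun x hx =>
    Real.smoothTransition.zero_of_nonpos (by linarith)
  have hgs : ContDiff ℝ ∞ (fun x => χ x * f x) := hχs.mul hf
  refine ⟨⟨fun x => χ x * f x, hgs, fun a d => ?_⟩, fun x hx => ?_⟩
  · obtain ⟨C, hC⟩ := hdec a d
    have hcont : Continuous fun x => |x| ^ a * |iteratedDeriv d (fun x => χ x * f x) x| :=
      (continuous_abs.pow a).mul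
        (hgs.continuous_iteratedDeriv d (by exact_mod_cast le_top)).abs
    obtain ⟨C', hC'⟩ := (isCompact_Icc (a := (-2 : ℝ)) (b := 0)).bddAbove_image hcont.continuousOn
    refine ⟨max C (max C' 0), fun x => ?_⟩
    rw [norm_iteratedFDeriv_eq_norm_iteratedDeriv, Real.norm_eq_abs, Real.norm_eq_abs]
    rcases lt_or_ge x (-2) with h | h
    · have : (fun x => χ x * f x) =ᶠ[𝓝 x] fun _ => 0 := by
        filter_upwards [gt_mem_nhds h] with y hy
        rw [hχ0 y hy.le, zero_mul]
      rw [(this.iteratedDeriv d).eq_of_nhds]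
      refine le_trans (le_of_eq ?_) ((le_max_right _ _).trans (le_max_right _ _))
      rcases d with _ | d <;> simp
    · rcases le_or_gt x 0 with h' | h'
      · exact (hC' ⟨x, ⟨h, h'⟩, rfl⟩).trans ((le_max_left _ _).trans (le_max_right _ _))
      · have : (fun x => χ x * f x) =ᶠ[𝓝 x] f := by
          filter_upwards [lt_mem_nhds h'] with y hy
          rw [hχ1 y (by linarith), one_mul]
        rw [(this.iteratedDeriv d).eq_of_nhds]
        exact (hC x h'.le).trans (le_max_left _ _)
  · change χ x * f x = f x
    rw [hχ1 x hx.le, one_mul]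

theorem schwartz_decay_iteratedDeriv (F : 𝓢(ℝ, ℝ)) (a d : ℕ) :
    ∃ C, ∀ x : ℝ, |x| ^ a * |iteratedDeriv d F x| ≤ C := by
  obtain ⟨C, -, hC⟩ := F.decay a d
  refine ⟨C, fun x => ?_⟩
  have := hC x
  rwa [norm_iteratedFDeriv_eq_norm_iteratedDeriv] at this

/-- A rapidly decreasing solution of `f' = (c₀ + c₁ x) f + F` is a Schwartz function. -/
theorem exists_schwartz_of_ode {f : ℝ → ℝ} {c₀ c₁ : ℝ} (F : 𝓢(ℝ, ℝ)) (hf : ContDiff ℝ ∞ f)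
    (hode : ∀ x, HasDerivAt f ((c₀ + c₁ * x) * f x + F x) x)
    (hdec : ∀ a : ℕ, ∃ C, ∀ x : ℝ, 0 ≤ x → |x| ^ a * |f x| ≤ C) :
    ∃ g : 𝓢(ℝ, ℝ), ∀ x > -1, g x = f x := by
  have hfd : ∀ d x, HasDerivAt (iteratedDeriv d f) (iteratedDeriv (d + 1) f x) x := fun d x => by
    rw [iteratedDeriv_succ]
    exact ((hf.differentiable_iteratedDeriv d (by exact_mod_cast ENat.natCast_lt_top d)) x).hasDerivAt
  have hFd : ∀ d x, HasDerivAt (iteratedDeriv d F) (iteratedDeriv (d + 1) F x) x := fun d x => by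
    rw [iteratedDeriv_succ]
    exact (((F.smooth ⊤).differentiable_iteratedDeriv d
      (by exact_mod_cast ENat.natCast_lt_top d)) x).hasDerivAt
  -- Leibniz' rule in the equation: the derivative of order d + 1 is controlled by those of orders d
  -- and d - 1 with a polynomial weight, so decay of f alone propagates to all derivatives. For d =
  -- 0 the term in d - 1 has coefficient 0.
  have key : ∀ d x, iteratedDeriv (d + 1) f x =
      (c₀ + c₁ * x) * iteratedDeriv d f x + d * c₁ * iteratedDeriv (d - 1) f x
        + iteratedDeriv d F x := by
    intro d
    induction d with
    | zero => intro x; simp [iteratedDeriv_one, (hode x).deriv]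
    | succ d ih =>
      intro x
      have h1 : HasDerivAt (fun x => (c₀ + c₁ * x) * iteratedDeriv d f x
          + d * c₁ * iteratedDeriv (d - 1) f x + iteratedDeriv d F x)
          ((c₁ * iteratedDeriv d f x + (c₀ + c₁ * x) * iteratedDeriv (d + 1) f x)
          + d * c₁ * iteratedDeriv d f x + iteratedDeriv (d + 1) F x) x := by
        refine HasDerivAt.add (HasDerivAt.add ?_ ?_) (hFd d x)
        · have hlin : HasDerivAt (fun x : ℝ => c₀ + c₁ * x) c₁ x := by
            simpa using ((hasDerivAt_id x).const_mul c₁).const_add c₀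
          exact hlin.mul (hfd d x)
        · rcases d with _ | d
          · simpa using hasDerivAt_const x (0 : ℝ)
          · simpa using (hfd d x).const_mul (((d + 1 : ℕ) : ℝ) * c₁)
      rw [iteratedDeriv_succ (n := d + 1),
        (h1.congr_of_eventuallyEq (Eventually.of_forall ih)).deriv]
      push_cast [Nat.add_sub_cancel]
      ring
  refine exists_schwartz_of_decay f hf fun a d => ?_
  induction d using Nat.strong_induction_on generalizing a with
  | _ d ih =>
    rcases d with _ | d
    · simpa using hdec a
    · obtain ⟨C1, h1⟩ := ih d (Nat.lt_succ_self d) a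
      obtain ⟨C2, h2⟩ := ih d (Nat.lt_succ_self d) (a + 1)
      obtain ⟨C3, h3⟩ := ih (d - 1) (by omega) a
      obtain ⟨C4, h4⟩ := schwartz_decay_iteratedDeriv F a d
      refine ⟨|c₀| * C1 + |c₁| * C2 + |d * c₁| * C3 + C4, fun x hx => ?_⟩
      rw [key]
      calc |x| ^ a * |(c₀ + c₁ * x) * iteratedDeriv d f x + d * c₁ * iteratedDeriv (d - 1) f x
              + iteratedDeriv d F x|
          ≤ |x| ^ a * (|c₀ * iteratedDeriv d f x| + |c₁ * x * iteratedDeriv d f x|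
              + |d * c₁ * iteratedDeriv (d - 1) f x| + |iteratedDeriv d F x|) := by
            gcongr
            rw [add_mul]
            exact (abs_add_le _ _).trans (add_le_add_left ((abs_add_le _ _).trans
              (add_le_add_left (abs_add_le _ _) _)) _)
        _ = |c₀| * (|x| ^ a * |iteratedDeriv d f x|)
              + |c₁| * (|x| ^ (a + 1) * |iteratedDeriv d f x|)
              + |d * c₁| * (|x| ^ a * |iteratedDeriv (d - 1) f x|)
              + |x| ^ a * |iteratedDeriv d F x| := by
            simp only [abs_mul]; ring
        _ ≤ _ := by
            gcongr
            · exact h1 x hx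
            · exact h2 x hx
            · exact h3 x hx
            · exact h4 x

theorem contDiff_of_hasDerivAt {f f' : ℝ → ℝ} (h : ∀ x, HasDerivAt f (f' x) x)
    (hf' : ContDiff ℝ ∞ f') : ContDiff ℝ ∞ f := by
  rw [contDiff_infty_iff_deriv]
  refine ⟨fun x => (h x).differentiableAt, ?_⟩
  rwa [show deriv f = f' from funext fun x => (h x).deriv]

theorem integral_continuous_hasDerivAt {f : ℝ → ℝ} (hf : Continuous f) (x : ℝ) :
    HasDerivAt (fun u => ∫ s in (0 : ℝ)..u, f s) (f x) x :=
  intervalIntegral.integral_hasDerivAt_right (hf.intervalIntegrable _ _)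
    hf.stronglyMeasurable.stronglyMeasurableAtFilter hf.continuousAt

theorem integrableOn_pow_mul_abs (F : 𝓢(ℝ, ℝ)) (a : ℕ) :
    IntegrableOn (fun s => |s| ^ a * |F s|) (Ioi 0) := by
  have := F.integrable_pow_mul volume a
  exact this.integrableOn

/-! ### First-order linear equations with decreasing solutions. -/

section FirstOrder

variable {c₀ c₁ : ℝ}

theorem hasDerivAt_weight (c₀ c₁ x : ℝ) :
    HasDerivAt (fun x : ℝ => c₀ * x + c₁ * x ^ 2 / 2) (c₀ + c₁ * x) x := by
  have := ((hasDerivAt_id x).const_mul c₀).add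
    ((((hasDerivAt_id x).pow 2).const_mul c₁).div_const 2)
  convert! this using 1
  simp; ring

theorem contDiff_weight (c₀ c₁ : ℝ) : ContDiff ℝ ∞ (fun x : ℝ => c₀ * x + c₁ * x ^ 2 / 2) := by
  fun_prop

theorem weight_mono (h₀ : 0 ≤ c₀) (h₁ : 0 ≤ c₁) {x s : ℝ} (hx : 0 ≤ x) (hs : x ≤ s) :
    c₀ * x + c₁ * x ^ 2 / 2 ≤ c₀ * s + c₁ * s ^ 2 / 2 := by
  have : x ^ 2 ≤ s ^ 2 := by gcongr
  nlinarith [mul_le_mul_of_nonneg_left hs h₀, mul_le_mul_of_nonneg_left this h₁]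

/-- Solvability of `- w' + (c₀ + c₁ x) w = F` in the Schwartz space of a half-line. -/
theorem exists_solution_lowering (h₀ : 0 ≤ c₀) (h₁ : 0 ≤ c₁) (F : 𝓢(ℝ, ℝ)) :
    ∃ w : 𝓢(ℝ, ℝ), ∀ x > -1, -sD w x + (c₀ + c₁ * x) * w x = F x := by
  set B : ℝ → ℝ := fun x => c₀ * x + c₁ * x ^ 2 / 2 with hB
  have hBs : ContDiff ℝ ∞ B := contDiff_weight c₀ c₁
  have hBc : Continuous B := hBs.continuous
  have hBd : ∀ x, HasDerivAt B (c₀ + c₁ * x) x := hasDerivAt_weight c₀ c₁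
  set q : ℝ → ℝ := fun s => Real.exp (-B s) * F s with hq
  have hqs : ContDiff ℝ ∞ q := (Real.contDiff_exp.comp hBs.neg).mul (F.smooth ⊤)
  have hqc : Continuous q := hqs.continuous
  have hB0 : ∀ s, 0 ≤ s → 0 ≤ B s := fun s hs => by
    have := weight_mono h₀ h₁ le_rfl hs
    simpa [hB] using this
  have hqint : IntegrableOn q (Ioi 0) := by
    refine Integrable.mono' (integrableOn_pow_mul_abs F 0) hqc.aestronglyMeasurable ?_
    filter_upwards [ae_restrict_mem measurableSet_Ioi] with s hs
    rw [hq, Real.norm_eq_abs, abs_mul, Real.abs_exp, pow_zero]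
    gcongr
    exact Real.exp_le_one_iff.2 (by linarith [hB0 s (le_of_lt hs)])
  set I := ∫ s in Ioi (0 : ℝ), q s with hI
  -- The constant I selects the solution e^{B(x)} ∫_x^∞ e^{-B} F among all those that differ by a
  -- multiple of e^B.
  set w : ℝ → ℝ := fun x => Real.exp (B x) * (I - ∫ s in (0 : ℝ)..x, q s) with hw
  have hwd : ∀ x, HasDerivAt w ((c₀ + c₁ * x) * w x + (-F) x) x := fun x => by
    have h1 : HasDerivAt w _ x :=
      (hBd x).exp.mul ((integral_continuous_hasDerivAt hqc x).const_sub I)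
    convert! h1 using 1
    have : Real.exp (B x) * Real.exp (-B x) = 1 := by rw [← Real.exp_add]; simp
    simp only [hq, hw, neg_apply]
    linear_combination (F x) * this
  have hws : ContDiff ℝ ∞ w :=
    (Real.contDiff_exp.comp hBs).mul
      (contDiff_const.sub (contDiff_of_hasDerivAt (integral_continuous_hasDerivAt hqc) hqs))
  have hdec : ∀ a : ℕ, ∃ C, ∀ x : ℝ, 0 ≤ x → |x| ^ a * |w x| ≤ C := by
    intro a
    refine ⟨∫ s in Ioi (0 : ℝ), |s| ^ a * |F s|, fun x hx => ?_⟩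
    have hsub : Ioi x ⊆ Ioi (0 : ℝ) := Ioi_subset_Ioi hx
    have h2 : I - ∫ s in (0 : ℝ)..x, q s = ∫ s in Ioi x, q s := by
      have := intervalIntegral.integral_interval_add_Ioi (f := q) (a := 0) (b := x)
        hqint (hqint.mono_set hsub)
      rw [hI]; linarith
    have h3 : w x = ∫ s in Ioi x, Real.exp (B x) * q s := by
      rw [hw]; simp only; rw [h2, integral_const_mul]
    rw [h3]
    -- For s ≥ x ≥ 0 the kernel e^{B(x)-B(s)} is at most 1 and x^a ≤ s^a, so the moments of F bound
    -- those of w.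
    calc |x| ^ a * |∫ s in Ioi x, Real.exp (B x) * q s|
        ≤ |x| ^ a * ∫ s in Ioi x, |Real.exp (B x) * q s| := by
          gcongr; exact abs_integral_le_integral_abs
      _ = ∫ s in Ioi x, |x| ^ a * |Real.exp (B x) * q s| := (integral_const_mul _ _).symm
      _ ≤ ∫ s in Ioi x, |s| ^ a * |F s| := by
          refine setIntegral_mono_on ?_ ((integrableOn_pow_mul_abs F a).mono_set hsub)
            measurableSet_Ioi fun s hs => ?_
          · exact ((((hqint.mono_set hsub).const_mul _).abs).const_mul _)
          · have hxs : x ≤ s := le_of_lt hs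
            have : |Real.exp (B x) * q s| ≤ |F s| := by
              rw [hq]; simp only
              rw [← mul_assoc, ← Real.exp_add, abs_mul, Real.abs_exp]
              have : Real.exp (B x + -B s) ≤ 1 :=
                Real.exp_le_one_iff.2 (by have : B x ≤ B s := weight_mono h₀ h₁ hx hxs; linarith)
              exact mul_le_of_le_one_left (abs_nonneg _) this
            gcongr
      _ ≤ ∫ s in Ioi (0 : ℝ), |s| ^ a * |F s| :=
          setIntegral_mono_set (integrableOn_pow_mul_abs F a)
            (Eventually.of_forall fun s => by positivity) hsub.eventuallyLE
  obtain ⟨g, hg⟩ := exists_schwartz_of_ode (-F) hws hwd hdec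
  refine ⟨g, fun x hx => ?_⟩
  rw [sD_congr hg (fun x _ => hwd x) x hx, hg x hx]
  simp

theorem pow_mul_exp_neg_le {ε : ℝ} (hε : 0 < ε) (a : ℕ) {y : ℝ} (hy : 0 ≤ y) :
    y ^ a * Real.exp (-(ε * y)) ≤ a.factorial / ε ^ a := by
  have h := Real.pow_div_factorial_le_exp (ε * y) (by positivity) a
  rw [Real.exp_neg, ← div_eq_mul_inv, div_le_div_iff₀ (Real.exp_pos _) (by positivity)]
  rw [div_le_iff₀ (by positivity), mul_pow] at h
  linarith

/-- Solvability of `G' + (c₀ + c₁ x) G = F`, `G 0 = G₀`, in the Schwartz space of a half-line. -/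
theorem exists_solution_raising (h₀ : 0 ≤ c₀) (h₁ : 0 ≤ c₁) (hc : 0 < c₀ + c₁) (F : 𝓢(ℝ, ℝ))
    (G₀ : ℝ) : ∃ G : 𝓢(ℝ, ℝ), (∀ x > -1, sD G x + (c₀ + c₁ * x) * G x = F x) ∧ G 0 = G₀ := by
  set B : ℝ → ℝ := fun x => c₀ * x + c₁ * x ^ 2 / 2 with hB
  have hBs : ContDiff ℝ ∞ B := contDiff_weight c₀ c₁
  have hBc : Continuous B := hBs.continuous
  have hBd : ∀ x, HasDerivAt B (c₀ + c₁ * x) x := hasDerivAt_weight c₀ c₁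
  set q : ℝ → ℝ := fun s => Real.exp (B s) * F s with hq
  have hqs : ContDiff ℝ ∞ q := (Real.contDiff_exp.comp hBs).mul (F.smooth ⊤)
  have hqc : Continuous q := hqs.continuous
  set w : ℝ → ℝ := fun x => Real.exp (-B x) * (G₀ + ∫ s in (0 : ℝ)..x, q s) with hw
  have hwd : ∀ x, HasDerivAt w ((-c₀ + -c₁ * x) * w x + F x) x := fun x => by
    have h1 : HasDerivAt w _ x :=
      (hBd x).neg.exp.mul ((integral_continuous_hasDerivAt hqc x).const_add G₀)
    convert! h1 using 1
    have : Real.exp (B x) * Real.exp (-B x) = 1 := by rw [← Real.exp_add]; simp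
    simp only [hq, hw, Pi.neg_apply]
    linear_combination -(F x) * this
  have hws : ContDiff ℝ ∞ w :=
    (Real.contDiff_exp.comp hBs.neg).mul
      (contDiff_const.add (contDiff_of_hasDerivAt (integral_continuous_hasDerivAt hqc) hqs))
  -- This number bounds the mean slope c₀ + c₁(x + s)/2 of the weight from below once x ≥ 1, also
  -- when one coefficient vanishes: the oscillator has c₀ = 0, the exterior equation c₁ = 0.
  set ε : ℝ := (c₀ + c₁) / 2 with hε
  have hεp : 0 < ε := by positivity
  -- the exponential gain away from the diagonal
  have hgain : ∀ x s : ℝ, 1 ≤ x → 0 ≤ s → s ≤ x → ε * (x - s) ≤ B x - B s := by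
    intro x s hx hs hsx
    have h1 : B x - B s = (x - s) * (c₀ + c₁ * (x + s) / 2) := by simp only [hB]; ring
    rw [h1, mul_comm]
    refine mul_le_mul_of_nonneg_left ?_ (by linarith)
    nlinarith
  have hdec : ∀ a : ℕ, ∃ C, ∀ x : ℝ, 0 ≤ x → |x| ^ a * |w x| ≤ C := by
    intro a
    set A : ℝ := a.factorial / ε ^ a with hA
    have hAp : 0 ≤ A := by positivity
    set H : ℝ → ℝ := fun s => 2 ^ a * (A * |F s| + |s| ^ a * |F s|) + |F s| with hH
    have hHint : IntegrableOn H (Ioi 0) := by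
      have h0 : IntegrableOn (fun s => |F s|) (Ioi 0) := by
        simpa using integrableOn_pow_mul_abs F 0
      exact (((h0.const_mul A).add (integrableOn_pow_mul_abs F a)).const_mul _).add h0
    refine ⟨(2 ^ a * A + 1 + 2 ^ a * 0 ^ a) * |G₀| + ∫ s in Ioi (0 : ℝ), H s, fun x hx => ?_⟩
    -- pointwise bound of the kernel
    have hker : ∀ s, 0 ≤ s → s ≤ x →
        x ^ a * Real.exp (B s - B x) ≤ 2 ^ a * (A + s ^ a) + 1 := by
      intro s hs hsx
      rcases le_or_gt x 1 with hx1 | hx1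
      · have e1 : x ^ a ≤ 1 := pow_le_one₀ hx hx1
        have e2 : Real.exp (B s - B x) ≤ 1 :=
          Real.exp_le_one_iff.2 (by have : B s ≤ B x := weight_mono h₀ h₁ hs hsx; linarith)
        have : x ^ a * Real.exp (B s - B x) ≤ 1 :=
          mul_le_one₀ e1 (Real.exp_pos _).le e2
        have : 0 ≤ 2 ^ a * (A + s ^ a) := by positivity
        linarith
      -- The weight x^a is shared between x - s, absorbed by the exponential, and s, absorbed by the
      -- decay of F.
      · have e1 : x ^ a ≤ 2 ^ a * ((x - s) ^ a + s ^ a) := by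
          have hmax : x ≤ 2 * max (x - s) s := by
            rcases le_total (x - s) s with h | h
            · rw [max_eq_right h]; linarith
            · rw [max_eq_left h]; linarith
          calc x ^ a ≤ (2 * max (x - s) s) ^ a := by gcongr
            _ = 2 ^ a * (max (x - s) s) ^ a := mul_pow _ _ _
            _ ≤ _ := by
              gcongr
              rcases le_total (x - s) s with h | h
              · rw [max_eq_right h]
                have : 0 ≤ (x - s) ^ a := pow_nonneg (by linarith) a
                linarith
              · rw [max_eq_left h]
                have : 0 ≤ s ^ a := pow_nonneg hs a
                linarith
        have e2 : Real.exp (B s - B x) ≤ Real.exp (-(ε * (x - s))) :=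
          Real.exp_le_exp.2 (by linarith [hgain x s hx1.le hs hsx])
        have e3 := pow_mul_exp_neg_le hεp a (y := x - s) (by linarith)
        have e4 : Real.exp (-(ε * (x - s))) ≤ 1 :=
          Real.exp_le_one_iff.2 (by nlinarith)
        have hsa : 0 ≤ s ^ a := pow_nonneg hs a
        calc x ^ a * Real.exp (B s - B x)
            ≤ (2 ^ a * ((x - s) ^ a + s ^ a)) * Real.exp (-(ε * (x - s))) :=
              mul_le_mul e1 e2 (Real.exp_pos _).le (by
                have : 0 ≤ (x - s) ^ a := pow_nonneg (by linarith) a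
                positivity)
          _ = 2 ^ a * ((x - s) ^ a * Real.exp (-(ε * (x - s)))
                + s ^ a * Real.exp (-(ε * (x - s)))) := by ring
          _ ≤ 2 ^ a * (A + s ^ a * 1) := by gcongr
          _ ≤ _ := by rw [mul_one]; linarith
    have hG : x ^ a * (Real.exp (-B x) * |G₀|) ≤ (2 ^ a * A + 1 + 2 ^ a * 0 ^ a) * |G₀| := by
      have := hker 0 le_rfl hx
      have hB00 : B 0 = 0 := by simp [hB]
      rw [hB00, zero_sub] at this
      rw [← mul_assoc]
      gcongr
      linarith
    have hint : x ^ a * (Real.exp (-B x) * |∫ s in (0 : ℝ)..x, q s|) ≤ ∫ s in Ioi (0 : ℝ), H s := by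
      calc x ^ a * (Real.exp (-B x) * |∫ s in (0 : ℝ)..x, q s|)
          ≤ x ^ a * (Real.exp (-B x) * ∫ s in (0 : ℝ)..x, |q s|) := by
            gcongr
            exact intervalIntegral.abs_integral_le_integral_abs hx
        _ = ∫ s in (0 : ℝ)..x, x ^ a * Real.exp (-B x) * |q s| := by
            rw [intervalIntegral.integral_const_mul, mul_assoc]
        _ = ∫ s in Ioc (0 : ℝ) x, x ^ a * Real.exp (-B x) * |q s| :=
            intervalIntegral.integral_of_le hx
        _ ≤ ∫ s in Ioc (0 : ℝ) x, H s := by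
            refine setIntegral_mono_on ?_ (hHint.mono_set Ioc_subset_Ioi_self)
              measurableSet_Ioc fun s hs => ?_
            · exact ((continuous_const.mul hqc.abs).integrableOn_Icc).mono_set Ioc_subset_Icc_self
            · have hk := hker s hs.1.le hs.2
              have e : x ^ a * Real.exp (-B x) * |q s| = x ^ a * Real.exp (B s - B x) * |F s| := by
                have e' : Real.exp (B s - B x) = Real.exp (B s) * Real.exp (-B x) := by
                  rw [sub_eq_add_neg]; exact Real.exp_add _ _
                rw [show q s = Real.exp (B s) * F s from rfl, abs_mul, Real.abs_exp, e']
                ring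
              rw [e]
              calc x ^ a * Real.exp (B s - B x) * |F s| ≤ (2 ^ a * (A + s ^ a) + 1) * |F s| := by
                    gcongr
                _ = H s := by
                    simp only [hH]; rw [abs_of_pos hs.1]; ring
        _ ≤ ∫ s in Ioi (0 : ℝ), H s :=
            setIntegral_mono_set hHint (Eventually.of_forall fun s => by positivity)
              Ioc_subset_Ioi_self.eventuallyLE
    calc |x| ^ a * |w x|
        ≤ x ^ a * (Real.exp (-B x) * (|G₀| + |∫ s in (0 : ℝ)..x, q s|)) := by
          rw [abs_of_nonneg hx, hw]
          simp only
          rw [abs_mul, Real.abs_exp]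
          gcongr
          exact abs_add_le _ _
      _ = x ^ a * (Real.exp (-B x) * |G₀|)
            + x ^ a * (Real.exp (-B x) * |∫ s in (0 : ℝ)..x, q s|) := by ring
      _ ≤ _ := add_le_add hG hint
  obtain ⟨g, hg⟩ := exists_schwartz_of_ode F hws hwd hdec
  refine ⟨g, fun x hx => ?_, ?_⟩
  · rw [sD_congr hg (fun x _ => hwd x) x hx, hg x hx]
    ring
  · rw [hg 0 (by norm_num)]
    simp [hw, hB]

end FirstOrder

theorem sD_sX (f : 𝓢(ℝ, ℝ)) (x : ℝ) : sD (sX f) x = f x + x * sD f x := by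
  have h : HasDerivAt (sX f) (1 * f x + x * sD f x) x := by
    have := (hasDerivAt_id x).mul (hasDerivAt_sD f x)
    convert! this using 1
    ext y; simp [sX_apply]
  rw [sD_apply, h.deriv, one_mul]

theorem sD_eqOn {f g : 𝓢(ℝ, ℝ)} {a : ℝ} (h : ∀ x > a, f x = g x) : ∀ x > a, sD f x = sD g x :=
  sD_congr h fun x _ => hasDerivAt_sD g x

/-- Solvability of the equation of the harmonic oscillator at any energy level in the Schwartz space
of a half-line (without boundary condition). -/
theorem exists_solution_oscillator {b : ℝ} (hb : 0 < b) (ν : ℕ) (F : 𝓢(ℝ, ℝ)) :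
    ∃ u : 𝓢(ℝ, ℝ), ∀ x > -1,
      -sD (sD u) x + (b ^ 2 * x ^ 2 - (2 * ν + 1) * b) * u x = F x := by
  induction ν generalizing F with
  | zero =>
    -- At the ground level the operator is the product (-d/dx + bx)(d/dx + bx), which is inverted
    -- factor by factor.
    obtain ⟨w, hw⟩ := exists_solution_lowering le_rfl hb.le F
    obtain ⟨u, hu, -⟩ := exists_solution_raising le_rfl hb.le (by linarith) w 0
    refine ⟨u, fun x hx => ?_⟩
    have h1 := sD_eqOn (f := sD u + b • sX u) (g := w) (a := -1)
      (fun y hy => by have := hu y hy; simp [sX_apply]; linarith) x hx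
    have h2 := hu x hx
    have h3 := hw x hx
    simp only [map_add, map_smul, add_apply, smul_apply, sD_sX, smul_eq_mul] at h1
    push_cast
    linear_combination h3 - h1 + b * x * h2
  | succ ν ih =>
    -- Let L = d/dx + bx and L* = -d/dx + bx. The operator of level ν + 1 is L*L - 2(ν+1)b and that
    -- of level ν is LL* - 2(ν+1)b. If v solves level ν with datum LF, then u = (L*v - F)/(2(ν+1)b)
    -- satisfies Lu = v, hence solves level ν + 1 with datum F.
    obtain ⟨v, hv⟩ := ih (sD F + b • sX F)
    have hc : (2 * (ν + 1) * b) ≠ 0 := by positivity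
    set u : 𝓢(ℝ, ℝ) := (2 * (ν + 1) * b)⁻¹ • (-sD v + b • sX v - F) with hu
    have hup : (2 * (ν + 1) * b) • u = -sD v + b • sX v - F := by
      rw [hu, smul_smul, mul_inv_cancel₀ hc, one_smul]
    have hval : ∀ x, 2 * (ν + 1) * b * u x = -sD v x + b * (x * v x) - F x := fun x => by
      have := congrArg (fun f : 𝓢(ℝ, ℝ) => f x) hup
      simpa [sX_apply] using this
    have hA : ∀ x > -1, sD u x + b * x * u x = v x := by
      intro x hx
      have e1 := congrArg (fun f : 𝓢(ℝ, ℝ) => sD f x) hup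
      simp only [map_add, map_smul, map_neg, map_sub, add_apply, smul_apply, neg_apply, sub_apply,
        sD_sX, smul_eq_mul] at e1
      have e2 := hv x hx
      simp only [add_apply, smul_apply, smul_eq_mul, sX_apply] at e2
      have e3 := hval x
      refine mul_left_cancel₀ hc ?_
      linear_combination e1 + b * x * e3 + e2
    refine ⟨u, fun x hx => ?_⟩
    have h1 := sD_eqOn (f := sD u + b • sX u) (g := v) (a := -1)
      (fun y hy => by have := hA y hy; simp [sX_apply]; linarith) x hx
    simp only [map_add, map_smul, add_apply, smul_apply, sD_sX, smul_eq_mul] at h1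
    have h2 := hA x hx
    have h3 := hval x
    push_cast
    linear_combination -h1 + b * x * h2 - h3

/-- Solvability of the constant coefficient exterior equation with Neumann condition. -/
theorem exists_solution_exponential {α : ℝ} (hα : 0 < α) (F : 𝓢(ℝ, ℝ)) (d : ℝ) :
    ∃ u : 𝓢(ℝ, ℝ), (∀ x > -1, -sD (sD u) x + α ^ 2 * u x = F x) ∧ sD u 0 = d := by
  obtain ⟨w, hw⟩ := exists_solution_lowering hα.le le_rfl F
  -- The relation u' + αu = w at 0 converts the Neumann datum d into the value (w(0) - d)/α.
  obtain ⟨u, hu, hu0⟩ := exists_solution_raising hα.le le_rfl (by linarith) w ((w 0 - d) / α)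
  refine ⟨u, fun x hx => ?_, ?_⟩
  · have h1 := sD_eqOn (f := sD u + α • u) (g := w) (a := -1)
      (fun y hy => by have := hu y hy; simp; linarith) x hx
    have h2 := hu x hx
    have h3 := hw x hx
    simp only [map_add, map_smul, add_apply, smul_apply, smul_eq_mul] at h1
    linear_combination h3 - h1 + α * h2
  · have h2 := hu 0 (by norm_num)
    have h3 : α * u 0 = w 0 - d := by rw [hu0]; field_simp
    linear_combination h2 - h3

/-! ### Borel summation in a space of Schwartz functions -/

/-- A smooth cut-off function equal to `1` on `[-1, 1]` and supported in `[-2, 2]`. -/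
noncomputable def unitBump : ContDiffBump (0 : ℝ) := ⟨1, 2, one_pos, one_lt_two⟩

theorem unitBump_eq_one {s : ℝ} (hs : |s| ≤ 1) : unitBump s = 1 :=
  unitBump.one_of_mem_closedBall (by simpa [unitBump] using hs)

theorem unitBump_eq_zero {s : ℝ} (hs : 2 ≤ |s|) : unitBump s = 0 :=
  unitBump.zero_of_le_dist (by simpa [unitBump] using hs)

theorem abs_unitBump_le (s : ℝ) : |unitBump s| ≤ 1 := by
  rw [abs_of_nonneg unitBump.nonneg]; exact unitBump.le_one

/-- The terms of the Borel sum. -/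
noncomputable def borelTerm (ε : ℝ) (k : ℕ) (f : ℝ → ℝ) (z : ℝ × ℝ) : ℝ :=
  unitBump (ε⁻¹ * z.1) * z.1 ^ k * f z.2

theorem contDiff_borelTerm (ε : ℝ) (k : ℕ) (f : 𝓢(ℝ, ℝ)) : ContDiff ℝ ∞ (borelTerm ε k f) := by
  refine ContDiff.mul (ContDiff.mul ?_ (contDiff_fst.pow k)) ((f.smooth ⊤).comp contDiff_snd)
  exact unitBump.contDiff.comp (contDiff_const.mul contDiff_fst)

theorem norm_iteratedFDeriv_comp_fst_le {h : ℝ → ℝ} (hh : ContDiff ℝ ∞ h) (i : ℕ) (z : ℝ × ℝ) :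
    ‖iteratedFDeriv ℝ i (fun z : ℝ × ℝ => h z.1) z‖ ≤ |iteratedDeriv i h z.1| := by
  have := ContinuousLinearMap.iteratedFDeriv_comp_right (ContinuousLinearMap.fst ℝ ℝ ℝ) hh z
    (i := i) (by exact_mod_cast le_top)
  change ‖iteratedFDeriv ℝ i (h ∘ (ContinuousLinearMap.fst ℝ ℝ ℝ)) z‖ ≤ _
  rw [this]
  refine (ContinuousMultilinearMap.norm_compContinuousLinearMap_le _ _).trans ?_
  rw [norm_iteratedFDeriv_eq_norm_iteratedDeriv, ← Real.norm_eq_abs]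
  refine mul_le_of_le_one_right (norm_nonneg _) ?_
  refine Finset.prod_le_one (fun _ _ => norm_nonneg _) fun _ _ => ?_
  exact ContinuousLinearMap.norm_fst_le ℝ ℝ ℝ

theorem norm_iteratedFDeriv_comp_snd_le {h : ℝ → ℝ} (hh : ContDiff ℝ ∞ h) (i : ℕ) (z : ℝ × ℝ) :
    ‖iteratedFDeriv ℝ i (fun z : ℝ × ℝ => h z.2) z‖ ≤ |iteratedDeriv i h z.2| := by
  have := ContinuousLinearMap.iteratedFDeriv_comp_right (ContinuousLinearMap.snd ℝ ℝ ℝ) hh z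
    (i := i) (by exact_mod_cast le_top)
  change ‖iteratedFDeriv ℝ i (h ∘ (ContinuousLinearMap.snd ℝ ℝ ℝ)) z‖ ≤ _
  rw [this]
  refine (ContinuousMultilinearMap.norm_compContinuousLinearMap_le _ _).trans ?_
  rw [norm_iteratedFDeriv_eq_norm_iteratedDeriv, ← Real.norm_eq_abs]
  refine mul_le_of_le_one_right (norm_nonneg _) ?_
  refine Finset.prod_le_one (fun _ _ => norm_nonneg _) fun _ _ => ?_
  exact ContinuousLinearMap.norm_snd_le ℝ ℝ ℝ

theorem norm_iteratedFDeriv_tensor_le {h f : ℝ → ℝ} (hh : ContDiff ℝ ∞ h) (hf : ContDiff ℝ ∞ f)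
    (d : ℕ) (z : ℝ × ℝ) :
    ‖iteratedFDeriv ℝ d (fun z : ℝ × ℝ => h z.1 * f z.2) z‖ ≤
      ∑ i ∈ Finset.range (d + 1),
        d.choose i * |iteratedDeriv i h z.1| * |iteratedDeriv (d - i) f z.2| := by
  refine (norm_iteratedFDeriv_mul_le (N := ∞) (hh.comp contDiff_fst) (hf.comp contDiff_snd) z
    (by exact_mod_cast le_top)).trans ?_
  gcongr with i hi
  · exact norm_iteratedFDeriv_comp_fst_le hh i z
  · exact norm_iteratedFDeriv_comp_snd_le hf _ z

/-- The dependence on t is ε^k η(t/ε) with η(s) = χ(s) s^k independent of ε. Each derivative in t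
costs a factor 1/ε, so d derivatives leave ε^{k-d}; the factor ε^d on the left avoids the
subtraction. -/
theorem exists_borelTerm_bound (f : 𝓢(ℝ, ℝ)) (a d k : ℕ) :
    ∃ M, 0 ≤ M ∧ ∀ ε : ℝ, 0 < ε → ε ≤ 1 → ∀ z : ℝ × ℝ,
      ε ^ d * (|z.2| ^ a * ‖iteratedFDeriv ℝ d (borelTerm ε k f) z‖) ≤ ε ^ k * M := by
  set η : ℝ → ℝ := fun s => unitBump s * s ^ k with hη
  have hηs : ContDiff ℝ ∞ η := unitBump.contDiff.mul (contDiff_id.pow k)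
  have hηc : HasCompactSupport η := unitBump.hasCompactSupport.mul_right
  have hS : ∀ i, ∃ S, ∀ s, |iteratedDeriv i η s| ≤ S := fun i => by
    have hc : HasCompactSupport (iteratedDeriv i η) := by
      have := hηc.iteratedFDeriv (𝕜 := ℝ) i
      refine this.mono' ?_
      refine subset_trans ?_ subset_closure
      intro x hx h0
      apply hx
      have h2 := norm_iteratedFDeriv_eq_norm_iteratedDeriv (𝕜 := ℝ) (n := i) (f := η) (x := x)
      rw [h0, norm_zero] at h2
      exact norm_eq_zero.1 h2.symm
    obtain ⟨S, hS⟩ := hc.exists_bound_of_continuous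
      (hηs.continuous_iteratedDeriv i (by exact_mod_cast le_top))
    exact ⟨S, hS⟩
  choose S hS using hS
  have hSnn : ∀ i, 0 ≤ S i := fun i => (abs_nonneg _).trans (hS i 0)
  have hD := fun i => schwartz_decay_iteratedDeriv f a i
  choose D hD using hD
  have hDnn : ∀ i, 0 ≤ D i := fun i => le_trans (by positivity) (hD i 0)
  refine ⟨∑ i ∈ Finset.range (d + 1), d.choose i * S i * D (d - i), ?_, fun ε hε hε1 z => ?_⟩
  · exact Finset.sum_nonneg fun i _ => by have := hSnn i; have := hDnn (d - i); positivity
  set h : ℝ → ℝ := fun t => ε ^ k * η (ε⁻¹ * t) with hh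
  have hhs : ContDiff ℝ ∞ h := contDiff_const.mul (hηs.comp (contDiff_const.mul contDiff_id))
  have hhd : ∀ i t, iteratedDeriv i h t = ε ^ k * (ε⁻¹ ^ i * iteratedDeriv i η (ε⁻¹ * t)) := by
    intro i t
    have e1 : iteratedDeriv i h t = ε ^ k * iteratedDeriv i (fun t => η (ε⁻¹ * t)) t := by
      rw [hh, iteratedDeriv_const_mul_field]
    rw [e1, iteratedDeriv_comp_const_mul (hηs.of_le (by exact_mod_cast le_top))]
  have hT : borelTerm ε k f = fun z : ℝ × ℝ => h z.1 * f z.2 := by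
    ext z
    simp only [borelTerm, hh, hη, mul_pow]
    have : ε ^ k * ε⁻¹ ^ k = 1 := by rw [← mul_pow, mul_inv_cancel₀ hε.ne', one_pow]
    linear_combination -(unitBump (ε⁻¹ * z.1) * z.1 ^ k * f z.2) * this
  rw [hT]
  calc ε ^ d * (|z.2| ^ a * ‖iteratedFDeriv ℝ d (fun z : ℝ × ℝ => h z.1 * f z.2) z‖)
      ≤ ε ^ d * (|z.2| ^ a * ∑ i ∈ Finset.range (d + 1),
          d.choose i * |iteratedDeriv i h z.1| * |iteratedDeriv (d - i) f z.2|) := by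
        gcongr
        exact norm_iteratedFDeriv_tensor_le hhs (f.smooth ⊤) d z
    _ = ∑ i ∈ Finset.range (d + 1), d.choose i * (ε ^ d * |iteratedDeriv i h z.1|)
          * (|z.2| ^ a * |iteratedDeriv (d - i) f z.2|) := by
        rw [Finset.mul_sum, Finset.mul_sum]
        exact Finset.sum_congr rfl fun i _ => by ring
    _ ≤ ∑ i ∈ Finset.range (d + 1), d.choose i * (ε ^ k * S i) * D (d - i) := by
        refine Finset.sum_le_sum fun i hi => ?_
        have hid : i ≤ d := Nat.lt_succ_iff.1 (Finset.mem_range.1 hi)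
        have e1 : ε ^ d * |iteratedDeriv i h z.1| ≤ ε ^ k * S i := by
          rw [hhd, abs_mul, abs_mul, abs_of_pos (pow_pos hε k),
            abs_of_pos (pow_pos (inv_pos.2 hε) i)]
          have e2 : ε ^ d * ε⁻¹ ^ i ≤ 1 := by
            rw [inv_pow, ← div_eq_mul_inv, div_le_one (by positivity)]
            exact pow_le_pow_of_le_one hε.le hε1 hid
          calc ε ^ d * (ε ^ k * (ε⁻¹ ^ i * |iteratedDeriv i η (ε⁻¹ * z.1)|))
              = ε ^ k * ((ε ^ d * ε⁻¹ ^ i) * |iteratedDeriv i η (ε⁻¹ * z.1)|) := by ring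
            _ ≤ ε ^ k * (1 * S i) := by
              gcongr
              exact hS i _
            _ = _ := by rw [one_mul]
        have := hSnn i
        gcongr
        exact hD _ _
    _ = ε ^ k * ∑ i ∈ Finset.range (d + 1), d.choose i * S i * D (d - i) := by
        rw [Finset.mul_sum]
        exact Finset.sum_congr rfl fun i _ => by ring

/-- Admissible scales for Borel summation. -/
structure BorelScale (φ : ℕ → 𝓢(ℝ, ℝ)) (δ : ℝ) (ε : ℕ → ℝ) : Prop where
  pos : ∀ k, 0 < ε k
  le_one : ∀ k, ε k ≤ 1
  zero : ε 0 = 1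
  bound : ∀ a d k, a ≤ k → d < k → ∀ z : ℝ × ℝ,
    |z.2| ^ a * ‖iteratedFDeriv ℝ d (borelTerm (ε k) k (φ k)) z‖ ≤ δ * (1 / 2) ^ k
  small : ∀ a i k, a ≤ k → i ≤ k → 0 < k → ∀ x : ℝ,
    ε k * 4 ^ k * (|x| ^ a * |(sD ^ i) (φ k) x|) ≤ 1

theorem schwartz_bound (f : 𝓢(ℝ, ℝ)) (a : ℕ) : ∃ C, 0 ≤ C ∧ ∀ x, |x| ^ a * |f x| ≤ C := by
  obtain ⟨C, hC⟩ := schwartz_decay_iteratedDeriv f a 0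
  simp only [iteratedDeriv_zero] at hC
  exact ⟨C, le_trans (by positivity) (hC 0), hC⟩

theorem exists_borelScale (φ : ℕ → 𝓢(ℝ, ℝ)) {δ : ℝ} (hδ : 0 < δ) : ∃ ε, BorelScale φ δ ε := by
  choose M hM0 hM using fun a d k => exists_borelTerm_bound (φ k) a d k
  choose C hC0 hC using fun a i k => schwartz_bound ((sD ^ i) (φ k)) a
  set MM : ℕ → ℝ := fun k => ∑ a ∈ Finset.range (k + 1), ∑ d ∈ Finset.range (k + 1), M a d k
  set CC : ℕ → ℝ := fun k => ∑ a ∈ Finset.range (k + 1), ∑ d ∈ Finset.range (k + 1), C a d k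
  have hMM0 : ∀ k, 0 ≤ MM k := fun k =>
    Finset.sum_nonneg fun a _ => Finset.sum_nonneg fun d _ => hM0 a d k
  have hCC0 : ∀ k, 0 ≤ CC k := fun k =>
    Finset.sum_nonneg fun a _ => Finset.sum_nonneg fun d _ => hC0 a d k
  have hMM : ∀ a d k, a ≤ k → d ≤ k → M a d k ≤ MM k := fun a d k ha hd =>
    (Finset.single_le_sum (f := fun d => M a d k) (fun d _ => hM0 a d k)
      (Finset.mem_range.2 (Nat.lt_succ_of_le hd))).trans
    (Finset.single_le_sum (f := fun a => ∑ d ∈ Finset.range (k + 1), M a d k)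
      (fun a _ => Finset.sum_nonneg fun d _ => hM0 a d k)
      (Finset.mem_range.2 (Nat.lt_succ_of_le ha)))
  have hCC : ∀ a d k, a ≤ k → d ≤ k → C a d k ≤ CC k := fun a d k ha hd =>
    (Finset.single_le_sum (f := fun d => C a d k) (fun d _ => hC0 a d k)
      (Finset.mem_range.2 (Nat.lt_succ_of_le hd))).trans
    (Finset.single_le_sum (f := fun a => ∑ d ∈ Finset.range (k + 1), C a d k)
      (fun a _ => Finset.sum_nonneg fun d _ => hC0 a d k)
      (Finset.mem_range.2 (Nat.lt_succ_of_le ha)))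
  -- The scale 1/Q(k) must be at most 1 and satisfy MM/Q ≤ δ 2^{-k} and 4^k CC/Q ≤ 1. The first
  -- product suffices because d < k leaves at least one power of the scale. The scale of index 0 is
  -- set to 1 so that the cut-off of the leading term is inactive for t in [0, 1].
  set Q : ℕ → ℝ := fun k => 1 + 2 ^ k * MM k / δ + 4 ^ k * CC k with hQ
  have hQ1 : ∀ k, 1 ≤ Q k := fun k => by
    have := hMM0 k; have := hCC0 k
    have : 0 ≤ 2 ^ k * MM k / δ + 4 ^ k * CC k := by positivity
    simp only [hQ]; linarith
  have hQp : ∀ k, 0 < Q k := fun k => lt_of_lt_of_le one_pos (hQ1 k)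
  refine ⟨fun k => if k = 0 then 1 else (Q k)⁻¹, ?_, ?_, ?_, ?_, ?_⟩
  · intro k
    by_cases h : k = 0
    · simp [h]
    · simp [h, hQp k]
  · intro k
    by_cases h : k = 0
    · simp [h]
    · simpa [h] using inv_le_one_of_one_le₀ (hQ1 k)
  · simp
  · intro a d k ha hd z
    have hk : k ≠ 0 := by omega
    simp only [hk, if_false]
    have hε : 0 < (Q k)⁻¹ := inv_pos.2 (hQp k)
    have hε1 : (Q k)⁻¹ ≤ 1 := inv_le_one_of_one_le₀ (hQ1 k)
    have h1 := hM a d k _ hε hε1 z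
    set Y := |z.2| ^ a * ‖iteratedFDeriv ℝ d (borelTerm (Q k)⁻¹ k (φ k)) z‖
    have h2 : (Q k)⁻¹ ^ k * M a d k ≤ (Q k)⁻¹ ^ d * ((Q k)⁻¹ * MM k) := by
      rw [← mul_assoc, ← pow_succ]
      refine mul_le_mul (pow_le_pow_of_le_one hε.le hε1 hd) (hMM a d k ha hd.le) (hM0 _ _ _)
        (by positivity)
    have h3 : Y ≤ (Q k)⁻¹ * MM k := le_of_mul_le_mul_left (h1.trans h2) (by positivity)
    refine h3.trans ?_
    rw [inv_mul_le_iff₀ (hQp k), one_div, inv_pow]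
    have : MM k = (2 ^ k * MM k / δ) * (δ * (2 ^ k)⁻¹) := by field_simp
    rw [this]
    refine mul_le_mul_of_nonneg_right ?_ (by positivity)
    have := hCC0 k
    have : 0 ≤ 4 ^ k * CC k := by positivity
    simp only [hQ]; linarith
  · intro a i k ha hi hk x
    have hk : k ≠ 0 := by omega
    simp only [hk, if_false]
    rw [mul_assoc, inv_mul_le_iff₀ (hQp k), mul_one]
    have h1 : 4 ^ k * (|x| ^ a * |(sD ^ i) (φ k) x|) ≤ 4 ^ k * CC k := by
      gcongr
      exact (hC a i k x).trans (hCC a i k ha hi)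
    have := hMM0 k
    have : 0 ≤ 2 ^ k * MM k / δ := by positivity
    simp only [hQ]; linarith

section Sum

variable {φ : ℕ → 𝓢(ℝ, ℝ)} {δ : ℝ} {ε : ℕ → ℝ}

/-- The `i`-th spatial derivative of the Borel sum. -/
noncomputable def borelSum (φ : ℕ → 𝓢(ℝ, ℝ)) (ε : ℕ → ℝ) (i : ℕ) (z : ℝ × ℝ) : ℝ :=
  ∑' k, borelTerm (ε k) k ((sD ^ i) (φ k)) z

/-- This yields both convergence (N = 0) and the remainder of order N. For k < N the difference
vanishes when t ≤ ε k, and otherwise t/ε k ≥ 1 supplies the missing powers of t. The finitely many k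
with N ≤ k < K are trivial. In the tail the term vanishes unless t < 2 ε k, where t^{k-N} ≤ 2^k ε k
is compensated by `BorelScale.small`. -/
theorem abs_borelTerm_sub_le (hε : BorelScale φ δ ε) (N a i : ℕ) : ∃ c : ℕ → ℝ, Summable c ∧
    (∀ k, 0 ≤ c k) ∧ ∀ t ∈ Icc (0 : ℝ) 1, ∀ x k,
      |x| ^ a * |borelTerm (ε k) k ((sD ^ i) (φ k)) (t, x)
        - if k < N then t ^ k * (sD ^ i) (φ k) x else 0| ≤ t ^ N * c k := by
  choose C hC0 hC using fun k => schwartz_bound ((sD ^ i) (φ k)) a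
  -- Beyond this threshold a ≤ k, i ≤ k and k - N ≥ 1 all hold.
  set K := N + 1 + a + i with hK
  refine ⟨fun k => if k < K then C k * (1 + ((ε k)⁻¹) ^ N) else (1 / 2) ^ k, ?_, ?_, ?_⟩
  · refine (summable_of_ne_finset_zero (s := Finset.range K)
      (f := fun k => (if k < K then C k * (1 + ((ε k)⁻¹) ^ N) else (1 / 2) ^ k) - (1 / 2) ^ k)
      ?_).add (summable_geometric_two) |>.congr fun k => ?_
    · intro k hk
      rw [Finset.mem_range] at hk
      simp [hk]
    · simp
  · intro k
    have := hC0 k; have := hε.pos k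
    simp only
    split_ifs <;> positivity
  · intro t ht x k
    have hεk := hε.pos k
    have ht0 := ht.1
    set F := (sD ^ i) (φ k) x
    have hb : borelTerm (ε k) k ((sD ^ i) (φ k)) (t, x) = unitBump ((ε k)⁻¹ * t) * t ^ k * F := rfl
    have hCk : |x| ^ a * |F| ≤ C k := hC k x
    have hxF : 0 ≤ |x| ^ a * |F| := by positivity
    rw [hb]
    beta_reduce
    by_cases hkK : k < K
    · rw [if_pos hkK]
      by_cases hkN : k < N
      · rw [if_pos hkN]
        have e1 : unitBump ((ε k)⁻¹ * t) * t ^ k * F - t ^ k * F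
            = (unitBump ((ε k)⁻¹ * t) - 1) * t ^ k * F := by ring
        have e2 : |(unitBump ((ε k)⁻¹ * t) - 1) * t ^ k| ≤ t ^ N * (1 + (ε k)⁻¹ ^ N) := by
          rcases le_or_gt t (ε k) with h | h
          · rw [unitBump_eq_one, sub_self, zero_mul, abs_zero]
            · positivity
            · rw [abs_of_nonneg (by positivity), inv_mul_le_iff₀ hεk]; linarith
          · rw [abs_mul, abs_of_nonneg (pow_nonneg ht0 k)]
            have e3 : |unitBump ((ε k)⁻¹ * t) - 1| ≤ 1 := by
              rw [abs_le]
              have := unitBump.nonneg (x := (ε k)⁻¹ * t)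
              have := unitBump.le_one (x := (ε k)⁻¹ * t)
              constructor <;> linarith
            have e4 : 1 ≤ (ε k)⁻¹ * t := by
              rw [le_inv_mul_iff₀ hεk]; linarith
            have e5 : t ^ k ≤ t ^ N * (ε k)⁻¹ ^ N := by
              rw [← mul_pow, mul_comm t]
              calc t ^ k ≤ ((ε k)⁻¹ * t) ^ k := by
                    gcongr
                    exact le_mul_of_one_le_left ht0 ((one_le_inv₀ hεk).2 (hε.le_one k))
                _ ≤ ((ε k)⁻¹ * t) ^ N := pow_le_pow_right₀ e4 hkN.le
            calc |unitBump ((ε k)⁻¹ * t) - 1| * t ^ k ≤ 1 * t ^ k := by gcongr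
              _ ≤ t ^ N * (ε k)⁻¹ ^ N := by rw [one_mul]; exact e5
              _ ≤ _ := by
                have : 0 ≤ t ^ N := by positivity
                rw [mul_add, mul_one]; linarith
        rw [e1, abs_mul]
        calc |x| ^ a * (|(unitBump ((ε k)⁻¹ * t) - 1) * t ^ k| * |F|)
            = |(unitBump ((ε k)⁻¹ * t) - 1) * t ^ k| * (|x| ^ a * |F|) := by ring
          _ ≤ (t ^ N * (1 + (ε k)⁻¹ ^ N)) * C k := mul_le_mul e2 hCk hxF (by positivity)
          _ = _ := by ring
      · rw [if_neg hkN, sub_zero, abs_mul, abs_mul, abs_of_nonneg (pow_nonneg ht0 k)]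
        push Not at hkN
        have e1 : |unitBump ((ε k)⁻¹ * t)| * t ^ k ≤ t ^ N * (1 + (ε k)⁻¹ ^ N) := by
          calc |unitBump ((ε k)⁻¹ * t)| * t ^ k ≤ 1 * t ^ N :=
                mul_le_mul (abs_unitBump_le _) (pow_le_pow_of_le_one ht0 ht.2 hkN)
                  (by positivity) one_pos.le
            _ ≤ _ := by
                have : 0 ≤ t ^ N * (ε k)⁻¹ ^ N := by positivity
                rw [mul_add, mul_one]; linarith
        calc |x| ^ a * (|unitBump ((ε k)⁻¹ * t)| * t ^ k * |F|)
            = (|unitBump ((ε k)⁻¹ * t)| * t ^ k) * (|x| ^ a * |F|) := by ring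
          _ ≤ (t ^ N * (1 + (ε k)⁻¹ ^ N)) * C k := mul_le_mul e1 hCk hxF (by positivity)
          _ = _ := by ring
    · have hkN : ¬ k < N := by omega
      rw [if_neg hkK, if_neg hkN, sub_zero]
      have e1 : |unitBump ((ε k)⁻¹ * t) * t ^ k| ≤ t ^ N * (2 ^ k * ε k) := by
        rcases le_or_gt (2 * ε k) t with h | h
        · rw [unitBump_eq_zero, zero_mul, abs_zero]
          · positivity
          · rw [abs_of_nonneg (by positivity), le_inv_mul_iff₀ hεk]; linarith
        · rw [abs_mul, abs_of_nonneg (pow_nonneg ht0 k)]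
          have e2 : t ^ k = t ^ N * t ^ (k - N) := by rw [← pow_add]; congr 1; omega
          have e3 : t ^ (k - N) ≤ 2 ^ k * ε k := by
            calc t ^ (k - N) ≤ (2 * ε k) ^ (k - N) := by gcongr
              _ = 2 ^ (k - N) * ε k ^ (k - N) := mul_pow _ _ _
              _ ≤ 2 ^ k * ε k ^ 1 :=
                mul_le_mul (pow_le_pow_right₀ one_le_two (by omega))
                  (pow_le_pow_of_le_one hεk.le (hε.le_one k) (by omega))
                  (pow_nonneg hεk.le _) (by positivity)
              _ = _ := by rw [pow_one]
          rw [e2]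
          calc |unitBump ((ε k)⁻¹ * t)| * (t ^ N * t ^ (k - N)) ≤ 1 * (t ^ N * (2 ^ k * ε k)) := by
                gcongr
                exact abs_unitBump_le _
            _ = _ := one_mul _
      have e2 := hε.small a i k (by omega) (by omega) (by omega) x
      rw [abs_mul]
      calc |x| ^ a * (|unitBump ((ε k)⁻¹ * t) * t ^ k| * |F|)
          = |unitBump ((ε k)⁻¹ * t) * t ^ k| * (|x| ^ a * |F|) := by ring
        _ ≤ (t ^ N * (2 ^ k * ε k)) * (|x| ^ a * |F|) := by gcongr
        _ = t ^ N * ((1 / 2) ^ k * (ε k * 4 ^ k * (|x| ^ a * |F|))) := by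
            have : (2 : ℝ) ^ k = (1 / 2) ^ k * 4 ^ k := by rw [← mul_pow]; norm_num
            rw [this]; ring
        _ ≤ t ^ N * ((1 / 2) ^ k * 1) := by gcongr
        _ = _ := by rw [mul_one]

theorem summable_borelTerm (hε : BorelScale φ δ ε) (i : ℕ) {t : ℝ} (ht : t ∈ Icc (0 : ℝ) 1)
    (x : ℝ) : Summable fun k => borelTerm (ε k) k ((sD ^ i) (φ k)) (t, x) := by
  obtain ⟨c, hc, -, hb⟩ := abs_borelTerm_sub_le hε 0 0 i
  refine Summable.of_norm_bounded hc fun k => ?_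
  simpa using hb t ht x k

theorem borelSum_asymp (hε : BorelScale φ δ ε) (i N a : ℕ) : ∃ C, ∀ t ∈ Icc (0 : ℝ) 1, ∀ x,
    |x| ^ a * |borelSum φ ε i (t, x) - ∑ k ∈ Finset.range N, t ^ k * (sD ^ i) (φ k) x|
      ≤ C * t ^ N := by
  obtain ⟨c, hc, -, hb⟩ := abs_borelTerm_sub_le hε N a i
  refine ⟨∑' k, c k, fun t ht x => ?_⟩
  have h1 : HasSum (fun k => if k < N then t ^ k * (sD ^ i) (φ k) x else 0)
      (∑ k ∈ Finset.range N, t ^ k * (sD ^ i) (φ k) x) := by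
    have : HasSum (fun k => if k < N then t ^ k * (sD ^ i) (φ k) x else 0)
        (∑ k ∈ Finset.range N, if k < N then t ^ k * (sD ^ i) (φ k) x else 0) :=
      hasSum_sum_of_ne_finset_zero (fun k hk => by
        rw [Finset.mem_range] at hk; simp [hk])
    convert! this using 1
    exact Finset.sum_congr rfl fun k hk => by simp [Finset.mem_range.1 hk]
  have h2 := ((summable_borelTerm hε i ht x).hasSum.sub h1).mul_left (|x| ^ a)
  have h3 : |x| ^ a * |borelSum φ ε i (t, x) - ∑ k ∈ Finset.range N, t ^ k * (sD ^ i) (φ k) x|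
      = ‖|x| ^ a * (borelSum φ ε i (t, x)
          - ∑ k ∈ Finset.range N, t ^ k * (sD ^ i) (φ k) x)‖ := by
    rw [norm_mul, Real.norm_eq_abs, Real.norm_eq_abs, abs_pow, abs_abs]
  rw [h3, mul_comm _ (t ^ N), ← tsum_mul_left]
  rw [show borelSum φ ε i (t, x) = ∑' k, borelTerm (ε k) k ((sD ^ i) (φ k)) (t, x) from rfl,
    ← h2.tsum_eq]
  refine tsum_of_norm_bounded (hc.mul_left _).hasSum fun k => ?_
  rw [norm_mul, Real.norm_eq_abs, Real.norm_eq_abs, abs_pow, abs_abs]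
  exact hb t ht x k

theorem borelSum_hasDerivAt (hε : BorelScale φ δ ε) (i : ℕ) {t : ℝ} (ht : t ∈ Icc (0 : ℝ) 1)
    (x : ℝ) : HasDerivAt (fun x => borelSum φ ε i (t, x)) (borelSum φ ε (i + 1) (t, x)) x := by
  obtain ⟨c, hc, -, hb⟩ := abs_borelTerm_sub_le hε 0 0 (i + 1)
  refine hasDerivAt_tsum (g := fun k x => borelTerm (ε k) k ((sD ^ i) (φ k)) (t, x))
    (g' := fun k x => borelTerm (ε k) k ((sD ^ (i + 1)) (φ k)) (t, x)) hc (fun k y => ?_)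
    (fun k y => ?_) (summable_borelTerm hε i ht 0) x
  · have := (hasDerivAt_sD ((sD ^ i) (φ k)) y).const_mul (unitBump ((ε k)⁻¹ * t) * t ^ k)
    rw [pow_succ', mul_apply_eq_comp]
    exact this
  · simpa using hb t ht y k

theorem exists_borelTerm_deriv_bound (hε : BorelScale φ δ ε) (a d k : ℕ) :
    ∃ C, 0 ≤ C ∧ ∀ z : ℝ × ℝ,
      |z.2| ^ a * ‖iteratedFDeriv ℝ d (borelTerm (ε k) k (φ k)) z‖ ≤ C := by
  obtain ⟨M, hM0, hM⟩ := exists_borelTerm_bound (φ k) a d k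
  have hp := hε.pos k
  refine ⟨(ε k ^ d)⁻¹ * (ε k ^ k * M), by positivity, fun z => ?_⟩
  rw [le_inv_mul_iff₀ (by positivity)]
  exact hM _ hp (hε.le_one k) z

theorem exists_borelTerm_summable_bound (hε : BorelScale φ δ ε) (a d : ℕ) :
    ∃ v : ℕ → ℝ, Summable v ∧ ∀ k z,
      |z.2| ^ a * ‖iteratedFDeriv ℝ d (borelTerm (ε k) k (φ k)) z‖ ≤ v k := by
  choose C hC0 hC using fun k => exists_borelTerm_deriv_bound hε a d k
  refine ⟨fun k => if k < a + d + 1 then C k else δ * (1 / 2) ^ k, ?_, fun k z => ?_⟩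
  · refine (summable_of_ne_finset_zero (s := Finset.range (a + d + 1))
      (f := fun k => (if k < a + d + 1 then C k else δ * (1 / 2) ^ k) - δ * (1 / 2) ^ k)
      ?_).add (summable_geometric_two.mul_left δ) |>.congr fun k => ?_
    · intro k hk
      rw [Finset.mem_range] at hk
      simp [hk]
    · simp
  · simp only
    split_ifs with h
    · exact hC k z
    · exact hε.bound a d k (by omega) (by omega) z

theorem contDiff_borelSum (hε : BorelScale φ δ ε) : ContDiff ℝ ∞ (borelSum φ ε 0) := by
  choose v hv hb using fun d => exists_borelTerm_summable_bound hε 0 d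
  have := contDiff_tsum (𝕜 := ℝ) (N := ⊤) (f := fun k => borelTerm (ε k) k (φ k)) (v := v)
    (fun k => by exact_mod_cast contDiff_borelTerm _ _ _) (fun d _ => hv d)
    (fun d k z _ => by simpa using hb d k z)
  exact_mod_cast this

theorem borelSum_decay (hε : BorelScale φ δ ε) (a d : ℕ) :
    ∃ C, ∀ z : ℝ × ℝ, |z.2| ^ a * ‖iteratedFDeriv ℝ d (borelSum φ ε 0) z‖ ≤ C := by
  choose v hv hb using fun d => exists_borelTerm_summable_bound hε 0 d
  obtain ⟨w, hw, hwb⟩ := exists_borelTerm_summable_bound hε a d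
  refine ⟨∑' k, w k, fun z => ?_⟩
  have e : iteratedFDeriv ℝ d (borelSum φ ε 0) z
      = ∑' k, iteratedFDeriv ℝ d (borelTerm (ε k) k (φ k)) z :=
    iteratedFDeriv_tsum_apply (𝕜 := ℝ) (N := ⊤) (f := fun k => borelTerm (ε k) k (φ k)) (v := v)
      (fun k => by exact_mod_cast contDiff_borelTerm _ _ _) (fun d _ => hv d)
      (fun d k z _ => by simpa using hb d k z) (by exact_mod_cast le_top) z
  have hs : Summable fun k => ‖iteratedFDeriv ℝ d (borelTerm (ε k) k (φ k)) z‖ :=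
    Summable.of_nonneg_of_le (fun _ => norm_nonneg _) (fun k => by simpa using hb d k z) (hv d)
  rw [e]
  calc |z.2| ^ a * ‖∑' k, iteratedFDeriv ℝ d (borelTerm (ε k) k (φ k)) z‖
      ≤ |z.2| ^ a * ∑' k, ‖iteratedFDeriv ℝ d (borelTerm (ε k) k (φ k)) z‖ := by
        gcongr
        exact norm_tsum_le_tsum_norm hs
    _ = ∑' k, |z.2| ^ a * ‖iteratedFDeriv ℝ d (borelTerm (ε k) k (φ k)) z‖ := tsum_mul_left.symm
    _ ≤ ∑' k, w k := (hs.mul_left _).tsum_le_tsum (fun k => hwb k z) hw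

/-- The bound holds on all of [0, 1], not just for small t, because ε 0 = 1 makes the leading term
exact. It is what keeps the energy positive and the mode nonzero for every m ≥ 1. -/
theorem borelSum_sub_zero_le (hε : BorelScale φ δ ε) {t : ℝ}
    (ht : t ∈ Icc (0 : ℝ) 1) (x : ℝ) : |borelSum φ ε 0 (t, x) - φ 0 x| ≤ δ := by
  have h1 := summable_borelTerm hε 0 ht x
  have h2 : borelSum φ ε 0 (t, x) - φ 0 x
      = ∑' k, borelTerm (ε (k + 1)) (k + 1) ((sD ^ 0) (φ (k + 1))) (t, x) := by
    rw [borelSum, h1.tsum_eq_zero_add]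
    have : borelTerm (ε 0) 0 ((sD ^ 0) (φ 0)) (t, x) = φ 0 x := by
      simp only [borelTerm, hε.zero, pow_zero, mul_one]
      rw [unitBump_eq_one (by rw [inv_one, one_mul, abs_of_nonneg ht.1]; exact ht.2)]
      simp
    rw [this, add_sub_cancel_left]
  rw [h2, ← Real.norm_eq_abs]
  have hg : HasSum (fun k : ℕ => δ * (1 / 2 : ℝ) ^ (k + 1)) (δ * 1) := by
    refine HasSum.mul_left δ ?_
    have := hasSum_geometric_two' (1 : ℝ)
    convert! this using 2
    rw [pow_succ]; simp; ring
  rw [mul_one] at hg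
  refine tsum_of_norm_bounded hg fun k => ?_
  have := hε.bound 0 0 (k + 1) (by omega) (by omega) (t, x)
  simpa using this

end Sum

/-! ### Asymptotic expansions -/

/-- `h` has the Taylor coefficients `c` at `0`, with uniform remainders on `[0, r]`. -/
def HasTaylor (h : ℝ → ℝ) (c : ℕ → ℝ) (r : ℝ) : Prop :=
  ∀ N : ℕ, ∃ C, ∀ y ∈ Icc (0 : ℝ) r, |h y - ∑ k ∈ Finset.range N, c k * y ^ k| ≤ C * y ^ N

theorem hasTaylor_of_contDiffOn {h : ℝ → ℝ} {r : ℝ} (hr : 0 ≤ r)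
    (hh : ContDiffOn ℝ ∞ h (Icc 0 r)) :
    HasTaylor h (fun k => iteratedDerivWithin k h (Icc 0 r) 0 / k.factorial) r := by
  intro N
  rcases N with _ | N
  · obtain ⟨C, hC⟩ := isCompact_Icc.exists_bound_of_continuousOn hh.continuousOn
    exact ⟨C, fun y hy => by simpa using hC y hy⟩
  · obtain ⟨C, hC⟩ := exists_taylor_mean_remainder_bound (n := N) hr
      (hh.of_le (by exact_mod_cast le_top))
    refine ⟨C, fun y hy => ?_⟩
    have := hC y hy
    rw [taylor_within_apply, Real.norm_eq_abs, sub_zero] at this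
    convert! this using 3
    refine Finset.sum_congr rfl fun k _ => ?_
    rw [smul_eq_mul]; ring

theorem coeff_eq_zero_of_bound {r C : ℝ} (hr : 0 < r) (N : ℕ) (e : ℕ → ℝ)
    (h : ∀ y ∈ Ioc (0 : ℝ) r, |∑ k ∈ Finset.range N, e k * y ^ k| ≤ C * y ^ N) :
    ∀ k < N, e k = 0 := by
  induction N generalizing e with
  | zero => intro k hk; omega
  | succ N ih =>
    have h0 : e 0 = 0 := by
      have t1 : Tendsto (fun y : ℝ => |∑ k ∈ Finset.range (N + 1), e k * y ^ k|) (𝓝[>] 0)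
          (𝓝 |∑ k ∈ Finset.range (N + 1), e k * (0 : ℝ) ^ k|) := by
        refine Tendsto.mono_left (Continuous.tendsto ?_ _) nhdsWithin_le_nhds
        fun_prop
      have t2 : Tendsto (fun y : ℝ => C * y ^ (N + 1)) (𝓝[>] 0) (𝓝 (C * (0 : ℝ) ^ (N + 1))) := by
        refine Tendsto.mono_left (Continuous.tendsto ?_ _) nhdsWithin_le_nhds
        fun_prop
      have := le_of_tendsto_of_tendsto t1 t2 (by
        filter_upwards [Ioc_mem_nhdsGT hr] with y hy using h y hy)
      rw [Finset.sum_range_succ'] at this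
      simpa using this
    have h1 := ih (fun k => e (k + 1)) fun y hy => by
      have h2 := h y hy
      rw [Finset.sum_range_succ', h0, zero_mul, add_zero] at h2
      have h3 : ∑ k ∈ Finset.range N, e (k + 1) * y ^ (k + 1)
          = y * ∑ k ∈ Finset.range N, e (k + 1) * y ^ k := by
        rw [Finset.mul_sum]; exact Finset.sum_congr rfl fun k _ => by ring
      rw [h3, abs_mul, abs_of_pos hy.1, pow_succ, ← mul_assoc, mul_comm] at h2
      exact le_of_mul_le_mul_right h2 hy.1
    intro k hk
    rcases k with _ | k
    · exact h0
    · exact h1 k (by omega)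

/-- Coefficients defined through iterated derivatives can thus be identified from any algebraic
expansion with a remainder of the right order. -/
theorem HasTaylor.unique {h : ℝ → ℝ} {c d : ℕ → ℝ} {r r' C : ℝ} (hr : 0 < r) (hr' : 0 < r')
    (hc : HasTaylor h c r) (N : ℕ)
    (hd : ∀ y ∈ Icc (0 : ℝ) r', |h y - ∑ k ∈ Finset.range N, d k * y ^ k| ≤ C * y ^ N) :
    ∀ k < N, c k = d k := by
  obtain ⟨C', hC'⟩ := hc N
  have := coeff_eq_zero_of_bound (C := C + C') (lt_min hr hr') N (fun k => c k - d k)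
    fun y hy => by
      have h1 := hd y ⟨hy.1.le, hy.2.trans (min_le_right _ _)⟩
      have h2 := hC' y ⟨hy.1.le, hy.2.trans (min_le_left _ _)⟩
      have e : ∑ k ∈ Finset.range N, (c k - d k) * y ^ k
          = (h y - ∑ k ∈ Finset.range N, d k * y ^ k)
            - (h y - ∑ k ∈ Finset.range N, c k * y ^ k) := by
        simp only [sub_mul, Finset.sum_sub_distrib]; ring
      rw [e, add_mul]
      exact (abs_sub _ _).trans (add_le_add h1 h2)
  intro k hk
  linarith [this k hk]

/-- Asymptotic expansions in powers of `t`, locally uniform in `x` with polynomial losses. -/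
def Asy (D : Set (ℝ × ℝ)) (f : ℝ → ℝ → ℝ) (c : ℕ → ℝ → ℝ) : Prop :=
  ∀ N : ℕ, ∃ C q, ∀ t x, (t, x) ∈ D →
    |f t x - ∑ k ∈ Finset.range N, t ^ k * c k x| ≤ C * t ^ N * (1 + x) ^ (q : ℕ)

/-- Asymptotic expansions in powers of `t` with rapidly decreasing remainders. -/
def AsyS (D : Set (ℝ × ℝ)) (f : ℝ → ℝ → ℝ) (c : ℕ → ℝ → ℝ) : Prop :=
  ∀ N q : ℕ, ∃ C, ∀ t x, (t, x) ∈ D →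
    (1 + x) ^ q * |f t x - ∑ k ∈ Finset.range N, t ^ k * c k x| ≤ C * t ^ N

/-- The Cauchy product of coefficient sequences. -/
def conv (c d : ℕ → ℝ → ℝ) (n : ℕ) (x : ℝ) : ℝ :=
  ∑ i ∈ Finset.range (n + 1), c (n - i) x * d i x

/-- The coefficients of `t f`. -/
def shiftCoeff (c : ℕ → ℝ → ℝ) : ℕ → ℝ → ℝ
  | 0 => fun _ => 0
  | n + 1 => c n

/-! ### Sums, products and quotients of expansions in powers of t. -/

section

variable {D : Set (ℝ × ℝ)} {f g : ℝ → ℝ → ℝ} {c d : ℕ → ℝ → ℝ}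

theorem AsyS.add (hf : AsyS D f c) (hg : AsyS D g d) (hD : ∀ t x, (t, x) ∈ D → 0 ≤ x) :
    AsyS D (fun t x => f t x + g t x) (fun n x => c n x + d n x) := by
  intro N q
  obtain ⟨C1, h1⟩ := hf N q
  obtain ⟨C2, h2⟩ := hg N q
  refine ⟨C1 + C2, fun t x hx => ?_⟩
  have hx0 := hD t x hx
  have e : f t x + g t x - ∑ k ∈ Finset.range N, t ^ k * (c k x + d k x)
      = (f t x - ∑ k ∈ Finset.range N, t ^ k * c k x)
        + (g t x - ∑ k ∈ Finset.range N, t ^ k * d k x) := by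
    simp only [mul_add, Finset.sum_add_distrib]; ring
  rw [e]
  calc _ ≤ (1 + x) ^ q * (|f t x - ∑ k ∈ Finset.range N, t ^ k * c k x|
        + |g t x - ∑ k ∈ Finset.range N, t ^ k * d k x|) := by
        gcongr; exact abs_add_le _ _
    _ ≤ (C1 + C2) * t ^ N := by
        rw [mul_add, add_mul]; exact add_le_add (h1 t x hx) (h2 t x hx)

theorem AsyS.neg (hf : AsyS D f c) : AsyS D (fun t x => -f t x) (fun n x => -c n x) := by
  intro N q
  obtain ⟨C1, h1⟩ := hf N q
  refine ⟨C1, fun t x hx => ?_⟩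
  have e : -f t x - ∑ k ∈ Finset.range N, t ^ k * -c k x
      = -(f t x - ∑ k ∈ Finset.range N, t ^ k * c k x) := by
    simp only [mul_neg, Finset.sum_neg_distrib]; ring
  rw [e, abs_neg]
  exact h1 t x hx

/-- Comparing the expansions of orders 0 and 1 bounds the leading coefficient polynomially. Together
with the expansion of (f - c₀)/t this allows inductions that peel off one coefficient at a time. -/
theorem Asy.shift_bound (hf : Asy D f c) (hD : ∀ t x, (t, x) ∈ D → 0 < t ∧ t ≤ 1 ∧ 0 ≤ x) :
    (∃ C q, 0 ≤ C ∧ ∀ t x, (t, x) ∈ D → |c 0 x| ≤ C * (1 + x) ^ (q : ℕ)) ∧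
    Asy D (fun t x => (f t x - c 0 x) / t) (fun n => c (n + 1)) := by
  constructor
  · obtain ⟨C0, q0, h0⟩ := hf 0
    obtain ⟨C1, q1, h1⟩ := hf 1
    refine ⟨|C0| + |C1|, q0 + q1, by positivity, fun t x hx => ?_⟩
    obtain ⟨ht, ht1, hx0⟩ := hD t x hx
    have h0 := h0 t x hx
    have h1 := h1 t x hx
    simp only [Finset.range_zero, Finset.sum_empty, sub_zero, pow_zero, mul_one,
      Finset.range_one, Finset.sum_singleton, one_mul, pow_one] at h0 h1
    have p0 : (1 + x) ^ q0 ≤ (1 + x) ^ (q0 + q1) :=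
      pow_le_pow_right₀ (by linarith) (by omega)
    have p1 : (1 + x) ^ q1 ≤ (1 + x) ^ (q0 + q1) :=
      pow_le_pow_right₀ (by linarith) (by omega)
    have hp : 0 ≤ (1 + x) ^ q0 := by positivity
    have hp1 : 0 ≤ (1 + x) ^ q1 := by positivity
    calc |c 0 x| = |f t x - (f t x - c 0 x)| := by rw [sub_sub_cancel]
      _ ≤ |f t x| + |f t x - c 0 x| := abs_sub _ _
      _ ≤ C0 * (1 + x) ^ q0 + C1 * t * (1 + x) ^ q1 := add_le_add h0 h1
      _ ≤ |C0| * (1 + x) ^ (q0 + q1) + |C1| * 1 * (1 + x) ^ (q0 + q1) := by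
          gcongr
          · exact le_abs_self _
          · exact le_abs_self _
      _ = _ := by ring
  · intro N
    obtain ⟨C, q, h⟩ := hf (N + 1)
    refine ⟨C, q, fun t x hx => ?_⟩
    obtain ⟨ht, ht1, hx0⟩ := hD t x hx
    have h := h t x hx
    rw [Finset.sum_range_succ'] at h
    have e : (f t x - c 0 x) / t - ∑ k ∈ Finset.range N, t ^ k * c (k + 1) x
        = (f t x - (∑ k ∈ Finset.range N, t ^ (k + 1) * c (k + 1) x + t ^ 0 * c 0 x)) / t := by
      have : ∑ k ∈ Finset.range N, t ^ (k + 1) * c (k + 1) x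
          = t * ∑ k ∈ Finset.range N, t ^ k * c (k + 1) x := by
        rw [Finset.mul_sum]; exact Finset.sum_congr rfl fun k _ => by ring
      rw [this]; field_simp; ring
    rw [e, abs_div, abs_of_pos ht, div_le_iff₀ ht]
    refine h.trans (le_of_eq ?_)
    ring

/-- The polynomial loss of one factor is absorbed by the arbitrary weight in the remainder of the
other. The induction on N rests on fg = c₀ g + t ((f - c₀)/t) g. -/
theorem Asy.mulS (hf : Asy D f c) (hg : AsyS D g d)
    (hD : ∀ t x, (t, x) ∈ D → 0 < t ∧ t ≤ 1 ∧ 0 ≤ x) :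
    AsyS D (fun t x => f t x * g t x) (conv c d) := by
  intro N
  induction N generalizing f c with
  | zero =>
    intro q
    obtain ⟨C, q', h⟩ := hf 0
    obtain ⟨C', h'⟩ := hg 0 (q + q')
    refine ⟨|C| * C', fun t x hx => ?_⟩
    obtain ⟨ht, ht1, hx0⟩ := hD t x hx
    have h := h t x hx
    have h' := h' t x hx
    simp only [Finset.range_zero, Finset.sum_empty, sub_zero, pow_zero, mul_one] at h h' ⊢
    rw [abs_mul]
    calc (1 + x) ^ q * (|f t x| * |g t x|)
        ≤ (1 + x) ^ q * ((|C| * (1 + x) ^ q') * |g t x|) := by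
          gcongr
          exact h.trans (mul_le_mul_of_nonneg_right (le_abs_self _) (by positivity))
      _ = |C| * ((1 + x) ^ (q + q') * |g t x|) := by rw [pow_add]; ring
      _ ≤ _ := by gcongr
  | succ N ih =>
    intro q
    obtain ⟨⟨C0, q0, hC0, h0⟩, hs⟩ := hf.shift_bound hD
    obtain ⟨C1, h1⟩ := ih hs q
    obtain ⟨C2, h2⟩ := hg (N + 1) (q + q0)
    refine ⟨C0 * C2 + C1, fun t x hx => ?_⟩
    obtain ⟨ht, ht1, hx0⟩ := hD t x hx
    have h0 := h0 t x hx
    have h1 := h1 t x hx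
    have h2 := h2 t x hx
    have hconv : ∀ n, conv c d (n + 1) x = c 0 x * d (n + 1) x
        + conv (fun n => c (n + 1)) d n x := by
      intro n
      rw [conv, Finset.sum_range_succ, Nat.sub_self, add_comm]
      congr 1
      refine Finset.sum_congr rfl fun i hi => ?_
      rw [Finset.mem_range] at hi
      rw [show n + 1 - i = n - i + 1 by omega]
    have hconv0 : conv c d 0 x = c 0 x * d 0 x := by simp [conv]
    have e : f t x * g t x - ∑ k ∈ Finset.range (N + 1), t ^ k * conv c d k x
        = c 0 x * (g t x - ∑ k ∈ Finset.range (N + 1), t ^ k * d k x)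
          + t * ((f t x - c 0 x) / t * g t x
            - ∑ k ∈ Finset.range N, t ^ k * conv (fun n => c (n + 1)) d k x) := by
      have s1 : ∑ k ∈ Finset.range (N + 1), t ^ k * conv c d k x
          = c 0 x * ∑ k ∈ Finset.range (N + 1), t ^ k * d k x
            + t * ∑ k ∈ Finset.range N, t ^ k * conv (fun n => c (n + 1)) d k x := by
        rw [Finset.sum_range_succ', Finset.sum_range_succ' (fun k => t ^ k * d k x), hconv0,
          mul_add, Finset.mul_sum, Finset.mul_sum]
        simp only [hconv, mul_add, Finset.sum_add_distrib]
        have : ∀ k, t ^ (k + 1) * (c 0 x * d (k + 1) x) = c 0 x * (t ^ (k + 1) * d (k + 1) x) :=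
          fun k => by ring
        simp only [this]
        have : ∀ k, t ^ (k + 1) * conv (fun n => c (n + 1)) d k x
            = t * (t ^ k * conv (fun n => c (n + 1)) d k x) := fun k => by ring
        simp only [this]
        ring
      rw [s1]
      field_simp
      ring
    rw [e]
    calc _ ≤ (1 + x) ^ q * (|c 0 x| * |g t x - ∑ k ∈ Finset.range (N + 1), t ^ k * d k x|
          + t * |(f t x - c 0 x) / t * g t x
            - ∑ k ∈ Finset.range N, t ^ k * conv (fun n => c (n + 1)) d k x|) := by
          gcongr
          refine (abs_add_le _ _).trans ?_
          rw [abs_mul, abs_mul, abs_of_pos ht]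
      _ ≤ (1 + x) ^ q * ((C0 * (1 + x) ^ q0)
            * |g t x - ∑ k ∈ Finset.range (N + 1), t ^ k * d k x|)
          + t * ((1 + x) ^ q * |(f t x - c 0 x) / t * g t x
            - ∑ k ∈ Finset.range N, t ^ k * conv (fun n => c (n + 1)) d k x|) := by
          rw [mul_add]
          refine add_le_add (by gcongr) (le_of_eq (by ring))
      _ = C0 * ((1 + x) ^ (q + q0) * |g t x - ∑ k ∈ Finset.range (N + 1), t ^ k * d k x|)
          + t * ((1 + x) ^ q * |(f t x - c 0 x) / t * g t x
            - ∑ k ∈ Finset.range N, t ^ k * conv (fun n => c (n + 1)) d k x|) := by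
          rw [pow_add]; ring
      _ ≤ C0 * (C2 * t ^ (N + 1)) + t * (C1 * t ^ N) := by gcongr
      _ = _ := by ring

theorem Asy.mul_t (hf : Asy D f c) (hD : ∀ t x, (t, x) ∈ D → 0 < t ∧ t ≤ 1 ∧ 0 ≤ x) :
    Asy D (fun t x => t * f t x) (shiftCoeff c) := by
  intro N
  rcases N with _ | N
  · obtain ⟨C, q, h⟩ := hf 0
    refine ⟨|C|, q, fun t x hx => ?_⟩
    obtain ⟨ht, ht1, hx0⟩ := hD t x hx
    have h := h t x hx
    simp only [Finset.range_zero, Finset.sum_empty, sub_zero, pow_zero, mul_one] at h ⊢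
    rw [abs_mul, abs_of_pos ht]
    calc t * |f t x| ≤ 1 * |f t x| := by gcongr
      _ ≤ _ := by
        rw [one_mul]
        exact h.trans (mul_le_mul_of_nonneg_right (le_abs_self _) (by positivity))
  · obtain ⟨C, q, h⟩ := hf N
    refine ⟨C, q, fun t x hx => ?_⟩
    obtain ⟨ht, ht1, hx0⟩ := hD t x hx
    have h := h t x hx
    have e : t * f t x - ∑ k ∈ Finset.range (N + 1), t ^ k * shiftCoeff c k x
        = t * (f t x - ∑ k ∈ Finset.range N, t ^ k * c k x) := by
      rw [Finset.sum_range_succ', mul_sub, Finset.mul_sum]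
      simp only [shiftCoeff, mul_zero, add_zero]
      congr 1
      exact Finset.sum_congr rfl fun k _ => by ring
    rw [e, abs_mul, abs_of_pos ht]
    calc t * |f t x - ∑ k ∈ Finset.range N, t ^ k * c k x| ≤ t * (C * t ^ N * (1 + x) ^ q) := by
          gcongr
      _ = _ := by ring

theorem HasTaylor.asy {h : ℝ → ℝ} {a : ℕ → ℝ} {r : ℝ} (hh : HasTaylor h a r)
    (hD : ∀ t x, (t, x) ∈ D → 0 < t ∧ t ≤ 1 ∧ 0 ≤ x) (hDr : ∀ t x, (t, x) ∈ D → t * x ≤ r) :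
    Asy D (fun t x => h (t * x)) (fun k x => a k * x ^ k) := by
  intro N
  obtain ⟨C, hC⟩ := hh N
  refine ⟨|C|, N, fun t x hx => ?_⟩
  obtain ⟨ht, ht1, hx0⟩ := hD t x hx
  have := hC (t * x) ⟨by positivity, hDr t x hx⟩
  have e : ∑ k ∈ Finset.range N, t ^ k * (a k * x ^ k)
      = ∑ k ∈ Finset.range N, a k * (t * x) ^ k :=
    Finset.sum_congr rfl fun k _ => by rw [mul_pow]; ring
  rw [e]
  refine this.trans ?_
  rw [mul_pow, ← mul_assoc]
  have : x ^ N ≤ (1 + x) ^ N := by gcongr; linarith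
  gcongr
  exact le_abs_self _

/-- The two vanishing coefficients remove the singularity of 1/t². For the effective potential they
express that `effCurvature n R = 0`. -/
theorem HasTaylor.asy_div_sq {h : ℝ → ℝ} {a : ℕ → ℝ} {r : ℝ} (hh : HasTaylor h a r)
    (h0 : a 0 = 0) (h1 : a 1 = 0)
    (hD : ∀ t x, (t, x) ∈ D → 0 < t ∧ t ≤ 1 ∧ 0 ≤ x) (hDr : ∀ t x, (t, x) ∈ D → t * x ≤ r) :
    Asy D (fun t x => h (t * x) / t ^ 2) (fun k x => a (k + 2) * x ^ (k + 2)) := by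
  have h2 := ((hh.asy hD hDr).shift_bound hD).2
  have h3 := (h2.shift_bound hD).2
  intro N
  obtain ⟨C, q, h⟩ := h3 N
  refine ⟨C, q, fun t x hx => ?_⟩
  obtain ⟨ht, ht1, hx0⟩ := hD t x hx
  have := h t x hx
  simp only [h0, h1, zero_mul, sub_zero, zero_add] at this
  rwa [div_div, ← pow_two] at this

theorem asy_const {E : ℝ → ℝ} {e : ℕ → ℝ}
    (h : ∀ N, ∃ C, ∀ t ∈ Icc (0 : ℝ) 1, |E t - ∑ k ∈ Finset.range N, t ^ k * e k| ≤ C * t ^ N)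
    (hD : ∀ t x, (t, x) ∈ D → 0 < t ∧ t ≤ 1 ∧ 0 ≤ x) :
    Asy D (fun t _ => E t) (fun k _ => e k) := by
  intro N
  obtain ⟨C, hC⟩ := h N
  refine ⟨C, 0, fun t x hx => ?_⟩
  obtain ⟨ht, ht1, hx0⟩ := hD t x hx
  simpa using hC t ⟨ht.le, ht1⟩

/-- The coefficients of `f / (1 + t² x)`, where `f` has the coefficients `c`. -/
def divCoeff (c : ℕ → ℝ → ℝ) : ℕ → ℝ → ℝ
  | 0 => c 0
  | 1 => c 1
  | n + 2 => fun x => c (n + 2) x - x * divCoeff c n x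

/-- From f/(1 + t²x) = f - t²x · f/(1 + t²x), order N + 2 of the quotient follows from its order N,
at the cost of one power of 1 + x. Since t²x ≥ 0, the quotient is bounded by |f|. -/
theorem Asy.div (hf : Asy D f c) (hD : ∀ t x, (t, x) ∈ D → 0 < t ∧ t ≤ 1 ∧ 0 ≤ x) :
    Asy D (fun t x => f t x / (1 + t ^ 2 * x)) (divCoeff c) := by
  have hs : ∀ t x, (t, x) ∈ D → 0 ≤ t ^ 2 * x := fun t x hx => by
    obtain ⟨ht, ht1, hx0⟩ := hD t x hx
    positivity
  have hle : ∀ t x, (t, x) ∈ D → |f t x / (1 + t ^ 2 * x)| ≤ |f t x| := fun t x hx => by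
    have := hs t x hx
    rw [abs_div, abs_of_pos (show 0 < 1 + t ^ 2 * x by linarith)]
    exact div_le_self (abs_nonneg _) (by linarith)
  intro N
  induction N using Nat.twoStepInduction with
  | zero =>
    obtain ⟨C, q, h⟩ := hf 0
    refine ⟨C, q, fun t x hx => ?_⟩
    have := h t x hx
    simp only [Finset.range_zero, Finset.sum_empty, sub_zero] at this ⊢
    exact (hle t x hx).trans this
  | one =>
    obtain ⟨C, q, h⟩ := hf 0
    obtain ⟨C', q', h'⟩ := hf 1
    refine ⟨|C'| + |C|, q' + (q + 1), fun t x hx => ?_⟩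
    obtain ⟨ht, ht1, hx0⟩ := hD t x hx
    have hp : 0 < 1 + t ^ 2 * x := by positivity
    have h := h t x hx
    have h' := h' t x hx
    simp only [Finset.range_zero, Finset.range_one, Finset.sum_empty, sub_zero,
      Finset.sum_singleton, pow_zero, one_mul, mul_one, pow_one, divCoeff] at h h' ⊢
    have e : f t x / (1 + t ^ 2 * x) - c 0 x
        = (f t x - c 0 x) - t ^ 2 * x * (f t x / (1 + t ^ 2 * x)) := by field_simp; ring
    have m1 : (1 + x) ^ q' ≤ (1 + x) ^ (q' + (q + 1)) :=
      pow_le_pow_right₀ (by linarith) (by omega)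
    have m2 : (1 + x) ^ (q + 1) ≤ (1 + x) ^ (q' + (q + 1)) :=
      pow_le_pow_right₀ (by linarith) (by omega)
    have a1 : |f t x - c 0 x| ≤ |C'| * t * (1 + x) ^ (q' + (q + 1)) := by
      refine h'.trans ?_
      gcongr
      exact le_abs_self _
    have a2 : t ^ 2 * x * |f t x / (1 + t ^ 2 * x)| ≤ |C| * t * (1 + x) ^ (q' + (q + 1)) := by
      calc t ^ 2 * x * |f t x / (1 + t ^ 2 * x)|
          ≤ (t * 1) * (1 + x) * (|C| * (1 + x) ^ q) := by
            have b1 : t ^ 2 * x ≤ (t * 1) * (1 + x) := by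
              rw [pow_two]; gcongr; linarith
            have b2 : |f t x / (1 + t ^ 2 * x)| ≤ |C| * (1 + x) ^ q :=
              (hle t x hx).trans (h.trans
                (mul_le_mul_of_nonneg_right (le_abs_self _) (by positivity)))
            exact mul_le_mul b1 b2 (abs_nonneg _) (by positivity)
        _ = |C| * t * (1 + x) ^ (q + 1) := by ring
        _ ≤ _ := by gcongr
    rw [e]
    refine (abs_sub _ _).trans ?_
    rw [abs_mul, abs_of_nonneg (hs t x hx)]
    linarith
  | more N ih _ =>
    obtain ⟨C, q, h⟩ := ih
    obtain ⟨C', q', h'⟩ := hf (N + 2)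
    refine ⟨|C'| + |C|, q' + (q + 1), fun t x hx => ?_⟩
    obtain ⟨ht, ht1, hx0⟩ := hD t x hx
    have h := h t x hx
    have h' := h' t x hx
    have hp : 0 < 1 + t ^ 2 * x := by positivity
    have e : f t x / (1 + t ^ 2 * x) - ∑ k ∈ Finset.range (N + 2), t ^ k * divCoeff c k x
        = (f t x - ∑ k ∈ Finset.range (N + 2), t ^ k * c k x)
          - t ^ 2 * x * (f t x / (1 + t ^ 2 * x)
            - ∑ k ∈ Finset.range N, t ^ k * divCoeff c k x) := by
      rw [Finset.sum_range_succ', Finset.sum_range_succ',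
        Finset.sum_range_succ' (fun k => t ^ k * c k x), Finset.sum_range_succ', mul_sub,
        Finset.mul_sum]
      simp only [divCoeff, zero_add, pow_zero, pow_one, one_mul, mul_sub, Finset.sum_sub_distrib]
      have : ∑ k ∈ Finset.range N, t ^ (k + 1 + 1) * (x * divCoeff c k x)
          = ∑ k ∈ Finset.range N, t ^ 2 * x * (t ^ k * divCoeff c k x) :=
        Finset.sum_congr rfl fun k _ => by ring
      rw [this]
      field_simp
      ring
    have m1 : (1 + x) ^ q' ≤ (1 + x) ^ (q' + (q + 1)) :=
      pow_le_pow_right₀ (by linarith) (by omega)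
    have m2 : (1 + x) ^ (q + 1) ≤ (1 + x) ^ (q' + (q + 1)) :=
      pow_le_pow_right₀ (by linarith) (by omega)
    rw [e]
    refine (abs_sub _ _).trans ?_
    rw [abs_mul, abs_of_nonneg (hs t x hx), add_mul, add_mul]
    refine add_le_add (h'.trans (by gcongr; exact le_abs_self _)) ?_
    calc t ^ 2 * x * |f t x / (1 + t ^ 2 * x) - ∑ k ∈ Finset.range N, t ^ k * divCoeff c k x|
        ≤ t ^ 2 * (1 + x) * (|C| * t ^ N * (1 + x) ^ q) := by
          gcongr
          · linarith
          · exact h.trans (by gcongr; exact le_abs_self _)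
      _ = |C| * t ^ (N + 2) * (1 + x) ^ (q + 1) := by ring
      _ ≤ _ := by gcongr

/-- The coefficients of the constant `1`. -/
def oneCoeff (k : ℕ) (_ : ℝ) : ℝ := if k = 0 then 1 else 0

theorem asy_one (hD : ∀ t x, (t, x) ∈ D → 0 < t ∧ t ≤ 1 ∧ 0 ≤ x) :
    Asy D (fun _ _ => 1) oneCoeff := by
  refine asy_const (fun N => ?_) hD (E := fun _ => 1) (e := fun k => if k = 0 then 1 else 0)
  rcases N with _ | N
  · exact ⟨1, fun t _ => by simp⟩
  · exact ⟨0, fun t _ => by simp⟩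

theorem AsyS.rapid (hf : AsyS D f c) (hc : ∀ t x, (t, x) ∈ D → ∀ k, c k x = 0) (N q : ℕ) :
    ∃ C, ∀ t x, (t, x) ∈ D → (1 + x) ^ q * |f t x| ≤ C * t ^ N := by
  obtain ⟨C, h⟩ := hf N q
  refine ⟨C, fun t x hx => ?_⟩
  have := h t x hx
  simpa [hc t x hx] using this

theorem asyS_of_pow {c : ℕ → ℝ → ℝ}
    (h : ∀ N a : ℕ, ∃ C, ∀ t ∈ Icc (0 : ℝ) 1, ∀ x, 0 ≤ x →
      |x| ^ a * |f t x - ∑ k ∈ Finset.range N, t ^ k * c k x| ≤ C * t ^ N)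
    (hD : ∀ t x, (t, x) ∈ D → 0 < t ∧ t ≤ 1 ∧ 0 ≤ x) : AsyS D f c := by
  intro N q
  obtain ⟨C0, h0⟩ := h N 0
  obtain ⟨C1, h1⟩ := h N q
  refine ⟨2 ^ q * (C0 + C1), fun t x hx => ?_⟩
  obtain ⟨ht, ht1, hx0⟩ := hD t x hx
  have h0 := h0 t ⟨ht.le, ht1⟩ x hx0
  have h1 := h1 t ⟨ht.le, ht1⟩ x hx0
  rw [pow_zero, one_mul] at h0
  rw [abs_of_nonneg hx0] at h1
  set Y := |f t x - ∑ k ∈ Finset.range N, t ^ k * c k x|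
  have hY : 0 ≤ Y := abs_nonneg _
  have hp : (1 + x) ^ q ≤ 2 ^ q * (1 + x ^ q) := by
    have hm : 1 + x ≤ 2 * max 1 x := by
      have := le_max_left 1 x; have := le_max_right 1 x; linarith
    calc (1 + x) ^ q ≤ (2 * max 1 x) ^ q := by gcongr
      _ = 2 ^ q * max 1 x ^ q := mul_pow _ _ _
      _ ≤ _ := by
        gcongr
        rcases le_total 1 x with h | h
        · rw [max_eq_right h]; linarith
        · rw [max_eq_left h, one_pow]
          have : 0 ≤ x ^ q := by positivity
          linarith
  calc (1 + x) ^ q * Y ≤ (2 ^ q * (1 + x ^ q)) * Y := by gcongr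
    _ = 2 ^ q * (Y + x ^ q * Y) := by ring
    _ ≤ 2 ^ q * (C0 * t ^ N + C1 * t ^ N) := by gcongr
    _ = _ := by ring

end

/-! ### The hierarchy of profile equations -/

/-- Dependent choice for conditions P k that see only the entries up to k. Stage k overwrites entry
k and later stages leave it alone, so the diagonal of the stages satisfies every condition. -/
theorem exists_seq_of_step {S : Type*} [Inhabited S] (P : ℕ → (ℕ → S) → Prop)
    (loc : ∀ k f g, (∀ i ≤ k, f i = g i) → P k f → P k g)
    (step : ∀ k f, (∀ i < k, P i f) → ∃ x, P k (Function.update f k x)) :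
    ∃ f, ∀ k, P k f := by
  choose! X hX using step
  let F : (n : ℕ) → ℕ → S := fun n => Nat.rec (fun _ => default)
    (fun k f => Function.update f k (X k f)) n
  have hF : ∀ n, F (n + 1) = Function.update (F n) n (X n (F n)) := fun n => rfl
  have hagree : ∀ n m i, i < n → n ≤ m → F m i = F n i := by
    intro n m i hi hnm
    induction m, hnm using Nat.le_induction with
    | base => rfl
    | succ m hm ih => rw [hF, Function.update_of_ne (by omega), ih]
  have hP : ∀ n, ∀ i < n, P i (F n) := by
    intro n
    induction n with
    | zero => intro i hi; omega
    | succ n ih =>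
      intro i hi
      rcases Nat.lt_succ_iff_lt_or_eq.1 hi with h | rfl
      · exact loc i (F n) _ (fun l hl => (hagree n (n + 1) l (by omega) (by omega)).symm) (ih i h)
      · exact hX i (F i) ih
  refine ⟨fun k => F (k + 1) k, fun k => ?_⟩
  exact loc k (F (k + 1)) _ (fun i hi => hagree (i + 1) (k + 1) i (by omega) (by omega))
    (hP (k + 1) k (by omega))

/-- The coefficients of `t² E`. -/
def shiftTwo (E : ℕ → ℝ) : ℕ → ℝ
  | 0 => 0
  | 1 => 0
  | n + 2 => E n

theorem shiftTwo_zero (E : ℕ → ℝ) : shiftTwo E 0 = 0 := rfl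

/-- The equations for the `k`-th interior and exterior profiles and the `k`-th energy. -/
structure ProfileEq (A B : ℕ → 𝓢(ℝ, ℝ) →L[ℝ] 𝓢(ℝ, ℝ)) (γ β : ℝ) (g ψ : ℕ → 𝓢(ℝ, ℝ)) (E : ℕ → ℝ)
    (k : ℕ) : Prop where
  interior : ∀ x > -1, ∑ i ∈ Finset.range (k + 1), A (k - i) (g i) x
    - ∑ i ∈ Finset.range (k + 1), E (k - i) * g i x = 0
  exterior : ∀ x > -1, ∑ i ∈ Finset.range (k + 1), B (k - i) (ψ i) x
    - γ * ∑ i ∈ Finset.range (k + 1), shiftTwo E (k - i) * ψ i x = 0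
  dirichlet : g k 0 = ψ k 0
  neumann : sD (ψ k) 0 = if k = 0 then 0 else -β * sD (g (k - 1)) 0

/-- At order k the exterior problem comes first: its Neumann datum involves the interior profile of
order k - 1 and its right-hand side only energies of order at most k - 2. Its value at 0 prescribes
the interior Dirichlet datum. The interior profile is then a particular solution plus E k times the
response to g₀ plus a multiple of g₀: E k adjusts the boundary value and the last multiple adjusts
the integral condition. -/
theorem exists_profiles (A B : ℕ → 𝓢(ℝ, ℝ) →L[ℝ] 𝓢(ℝ, ℝ)) (γ β E₀ : ℝ) (g₀ h : 𝓢(ℝ, ℝ))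
    (h₀ : ∀ x > -1, A 0 g₀ x - E₀ * g₀ x = 0) (h₀0 : g₀ 0 = 0)
    (hA : ∀ F : 𝓢(ℝ, ℝ), ∃ u : 𝓢(ℝ, ℝ), ∀ x > -1, A 0 u x - E₀ * u x = F x)
    (hB : ∀ (F : 𝓢(ℝ, ℝ)) (d : ℝ), ∃ u : 𝓢(ℝ, ℝ), (∀ x > -1, B 0 u x = F x) ∧ sD u 0 = d)
    (hG : ∀ u : 𝓢(ℝ, ℝ), (∀ x > -1, A 0 u x - E₀ * u x = g₀ x) → u 0 ≠ 0)
    (hn : (∫ x in Ioi (0 : ℝ), g₀ x * g₀ x) ≠ 0) :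
    ∃ (g ψ : ℕ → 𝓢(ℝ, ℝ)) (E : ℕ → ℝ), g 0 = g₀ ∧ ψ 0 = 0 ∧ E 0 = E₀ ∧
      (∀ k, ProfileEq A B γ β g ψ E k) ∧
      ∀ k, 0 < k → ∫ x in Ioi (0 : ℝ), (g k x - h x) * g₀ x = 0 := by
  obtain ⟨u₂, hu₂⟩ := hA g₀
  have hu₂0 := hG u₂ hu₂
  have hint : ∀ u v : 𝓢(ℝ, ℝ), IntegrableOn (fun x => u x * v x) (Ioi 0) := fun u v => by
    have := (SchwartzMap.pairing (ContinuousLinearMap.mul ℝ ℝ) u v).integrable (μ := volume)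
    exact this.integrableOn
  -- Entries are the triples (g k, E k, ψ k). At order 0 only the initial triple is prescribed; its
  -- profile equations are verified at the end.
  let P : ℕ → (ℕ → 𝓢(ℝ, ℝ) × ℝ × 𝓢(ℝ, ℝ)) → Prop := fun k s =>
    (k = 0 → s 0 = (g₀, E₀, 0)) ∧ (0 < k → s 0 = (g₀, E₀, 0) ∧
    ProfileEq A B γ β (fun i => (s i).1) (fun i => (s i).2.2) (fun i => (s i).2.1) k ∧
      ∫ x in Ioi (0 : ℝ), ((s k).1 x - h x) * g₀ x = 0)
  have hloc : ∀ k f g, (∀ i ≤ k, f i = g i) → P k f → P k g := by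
    intro k f g hfg hP
    refine ⟨fun hk => ?_, fun hk => ?_⟩
    · rw [← hfg 0 (by omega)]; exact hP.1 hk
    · obtain ⟨h1, h2, h3⟩ := hP.2 hk
      refine ⟨by rw [← hfg 0 (by omega)]; exact h1, ?_, by rw [← hfg k le_rfl]; exact h3⟩
      have hsh : ∀ i ≤ k, shiftTwo (fun i => (f i).2.1) i = shiftTwo (fun i => (g i).2.1) i := by
        intro i hi
        match i, hi with
        | 0, _ => rfl
        | 1, _ => rfl
        | i + 2, hi => simp only [shiftTwo]; rw [hfg i (by omega)]
      refine ⟨fun x hx => ?_, fun x hx => ?_, ?_, ?_⟩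
      · rw [← h2.interior x hx]
        congr 1
        · exact Finset.sum_congr rfl fun i hi => by
            rw [hfg i (by simp at hi; omega)]
        · exact Finset.sum_congr rfl fun i hi => by
            rw [hfg i (by simp at hi; omega), hfg (k - i) (by omega)]
      · rw [← h2.exterior x hx]
        congr 1
        · exact Finset.sum_congr rfl fun i hi => by
            rw [hfg i (by simp at hi; omega)]
        · congr 1
          exact Finset.sum_congr rfl fun i hi => by
            rw [hfg i (by simp at hi; omega), hsh (k - i) (by omega)]
      · have := h2.dirichlet
        simpa only [hfg k le_rfl] using this
      · have := h2.neumann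
        simpa only [hfg k le_rfl, hfg (k - 1) (by omega)] using this
  have hstep : ∀ k f, (∀ i < k, P i f) → ∃ x, P k (Function.update f k x) := by
    intro k f hf
    rcases k with _ | k
    · exact ⟨(g₀, E₀, 0), fun _ => by simp, fun h => absurd h (lt_irrefl _)⟩
    have hf0 : f 0 = (g₀, E₀, 0) := (hf 0 (Nat.succ_pos k)).1 rfl
    set g := fun i => (f i).1 with hg
    set E := fun i => (f i).2.1 with hE
    set ψ := fun i => (f i).2.2 with hψ
    have hg0 : g 0 = g₀ := by simp [hg, hf0]
    have hE0 : E 0 = E₀ := by simp [hE, hf0]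
    obtain ⟨v, hv, hv0⟩ := hB (-(∑ i ∈ Finset.range (k + 1), B (k + 1 - i) (ψ i))
      + γ • ∑ i ∈ Finset.range (k + 1), shiftTwo E (k + 1 - i) • ψ i) (-β * sD (g k) 0)
    obtain ⟨u₁, hu₁⟩ := hA (-(∑ i ∈ Finset.range (k + 1), A (k + 1 - i) (g i))
      + ∑ i ∈ Finset.range k, E (k - i) • g (i + 1))
    -- This is the new energy: since v(0) is already fixed, it is the only parameter that can
    -- achieve w(0) = v(0), and u₂(0) ≠ 0 makes this possible.
    set e := (v 0 - u₁ 0) / u₂ 0 with he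
    set w := u₁ + e • u₂ with hw
    -- Adding a multiple of g₀ disturbs neither the equation nor the value at 0.
    set c := -(∫ x in Ioi (0 : ℝ), (w x - h x) * g₀ x) / ∫ x in Ioi (0 : ℝ), g₀ x * g₀ x with hc
    refine ⟨(w + c • g₀, e, v), fun h => absurd h (by omega), fun _ => ⟨?_, ?_, ?_⟩⟩
    · rw [Function.update_of_ne (by omega)]; exact hf0
    · have hup : ∀ i, i ≤ k → Function.update f (k + 1) (w + c • g₀, e, v) i = f i :=
        fun i hi => Function.update_of_ne (by omega) _ _
      have hsh : ∀ i ≤ k + 2, shiftTwo (fun i =>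
          (Function.update f (k + 1) (w + c • g₀, e, v) i).2.1) i = shiftTwo E i := by
        intro i hi
        match i, hi with
        | 0, _ => rfl
        | 1, _ => rfl
        | i + 2, hi => simp only [shiftTwo]; rw [hup i (by omega)]
      refine ⟨fun x hx => ?_, fun x hx => ?_, ?_, ?_⟩
      · rw [Finset.sum_range_succ, Finset.sum_range_succ (fun i =>
          (Function.update f (k + 1) (w + c • g₀, e, v) (k + 1 - i)).2.1 * _),
          Finset.sum_range_succ' (fun i =>
          (Function.update f (k + 1) (w + c • g₀, e, v) (k + 1 - i)).2.1 * _)]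
        have s1 : ∑ i ∈ Finset.range (k + 1),
            A (k + 1 - i) (Function.update f (k + 1) (w + c • g₀, e, v) i).1 x
            = ∑ i ∈ Finset.range (k + 1), A (k + 1 - i) (g i) x :=
          Finset.sum_congr rfl fun i hi => by
            rw [hup i (by simp at hi; omega)]
        have s2 : ∑ i ∈ Finset.range k,
            (Function.update f (k + 1) (w + c • g₀, e, v) (k + 1 - (i + 1))).2.1
              * (Function.update f (k + 1) (w + c • g₀, e, v) (i + 1)).1 x
            = ∑ i ∈ Finset.range k, E (k - i) * g (i + 1) x :=
          Finset.sum_congr rfl fun i hi => by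
            rw [Finset.mem_range] at hi
            rw [hup (i + 1) (by omega), hup (k + 1 - (i + 1)) (by omega),
              show k + 1 - (i + 1) = k - i by omega]
        rw [s1, s2, Nat.sub_self, hup 0 (by omega), hf0]
        simp only [Function.update_self, Nat.sub_zero, hw]
        have h1 := hu₁ x hx
        have h2 := hu₂ x hx
        have h3 := h₀ x hx
        simp only [add_apply, neg_apply, sum_apply, smul_apply,
          smul_eq_mul, map_add, map_smul] at h1 ⊢
        linear_combination h1 + e * h2 + c * h3
      · rw [Finset.sum_range_succ, Finset.sum_range_succ (fun i => shiftTwo _ (k + 1 - i) * _)]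
        have s1 : ∑ i ∈ Finset.range (k + 1),
            B (k + 1 - i) (Function.update f (k + 1) (w + c • g₀, e, v) i).2.2 x
            = ∑ i ∈ Finset.range (k + 1), B (k + 1 - i) (ψ i) x :=
          Finset.sum_congr rfl fun i hi => by
            rw [hup i (by simp at hi; omega)]
        have s2 : ∑ i ∈ Finset.range (k + 1), shiftTwo (fun i =>
              (Function.update f (k + 1) (w + c • g₀, e, v) i).2.1) (k + 1 - i)
              * (Function.update f (k + 1) (w + c • g₀, e, v) i).2.2 x
            = ∑ i ∈ Finset.range (k + 1), shiftTwo E (k + 1 - i) * ψ i x :=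
          Finset.sum_congr rfl fun i hi => by
            rw [hup i (by simp at hi; omega), hsh _ (by omega)]
        rw [s1, s2, Nat.sub_self]
        have h1 := hv x hx
        simp only [add_apply, neg_apply, sum_apply, smul_apply,
          smul_eq_mul, Function.update_self, shiftTwo_zero, zero_mul, add_zero] at h1 ⊢
        linear_combination h1
      · simp only [Function.update_self, add_apply, smul_apply, smul_eq_mul, h₀0, hw, he]
        field_simp
        ring
      · simp only [Function.update_self, Nat.add_sub_cancel]
        rw [hup k le_rfl, hv0]
        simp [hg]
    · simp only [Function.update_self]
      have e1 : ∀ x, ((w + c • g₀) x - h x) * g₀ x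
          = (w - h) x * g₀ x + c * (g₀ x * g₀ x) := fun x => by
        simp only [add_apply, sub_apply, smul_apply, smul_eq_mul]; ring
      simp_rw [e1]
      rw [integral_add (hint _ _) ((hint _ _).const_mul c), integral_const_mul, hc,
        div_mul_cancel₀ _ hn]
      simp
  obtain ⟨s, hs⟩ := exists_seq_of_step P hloc hstep
  have hs0 : s 0 = (g₀, E₀, 0) := (hs 0).1 rfl
  refine ⟨fun i => (s i).1, fun i => (s i).2.2, fun i => (s i).2.1, by simp [hs0], by simp [hs0],
    by simp [hs0], fun k => ?_, fun k hk => ((hs k).2 hk).2.2⟩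
  rcases Nat.eq_zero_or_pos k with rfl | hk
  · refine ⟨fun x hx => ?_, fun x hx => ?_, ?_, ?_⟩
    · simpa [hs0] using h₀ x hx
    · simp [hs0]
    · simp [hs0, h₀0]
    · simp [hs0]
  · exact ((hs k).2 hk).2.1

/-! ### Integration by parts on the half-line -/

/-- The product of two Schwartz functions. -/
noncomputable def sP (f g : 𝓢(ℝ, ℝ)) : 𝓢(ℝ, ℝ) :=
  SchwartzMap.pairing (ContinuousLinearMap.mul ℝ ℝ) f g

theorem sP_apply (f g : 𝓢(ℝ, ℝ)) (x : ℝ) : sP f g x = f x * g x := rfl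

theorem sD_sP (f g : 𝓢(ℝ, ℝ)) (x : ℝ) : sD (sP f g) x = sD f x * g x + f x * sD g x :=
  ((hasDerivAt_sD f x).mul (hasDerivAt_sD g x)).deriv

theorem schwartz_integrableOn (f : 𝓢(ℝ, ℝ)) : IntegrableOn f (Ioi 0) :=
  (f.integrable (μ := volume)).integrableOn

theorem integral_sD (f : 𝓢(ℝ, ℝ)) : ∫ x in Ioi (0 : ℝ), sD f x = -f 0 := by
  have h : Tendsto f atTop (𝓝 0) :=
    (f.tendsto_cocompact).mono_left (by rw [cocompact_eq_atBot_atTop]; exact le_sup_right)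
  rw [integral_Ioi_of_hasDerivAt_of_tendsto f.continuous.continuousWithinAt
    (fun x _ => hasDerivAt_sD f x) (schwartz_integrableOn _) h, zero_sub]

theorem setIntegral_congr_Ioi {f g : ℝ → ℝ} (h : ∀ x, 0 < x → f x = g x) :
    ∫ x in Ioi (0 : ℝ), f x = ∫ x in Ioi (0 : ℝ), g x :=
  setIntegral_congr_fun measurableSet_Ioi fun x hx => h x hx

section Oscillator

variable {μ e : ℝ} {g : 𝓢(ℝ, ℝ)}

/-- Integrate (ug' - u'g)'; since g(0) = 0 only u(0)g'(0) survives at the boundary. With F = g it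
shows that the response to g cannot vanish at 0; with the data of order one it determines the
energy. -/
theorem green_oscillator (hg : ∀ x > -1, sD (sD g) x = (μ * x ^ 2 - e) * g x) (hg0 : g 0 = 0)
    {u F : 𝓢(ℝ, ℝ)} (hu : ∀ x > -1, -sD (sD u) x + (μ * x ^ 2 - e) * u x = F x) :
    ∫ x in Ioi (0 : ℝ), F x * g x = -(u 0 * sD g 0) := by
  have h := integral_sD (sP u (sD g) - sP (sD u) g)
  rw [setIntegral_congr_Ioi (g := fun x => F x * g x)] at h
  · rw [h]; simp [sP_apply, hg0]
  · intro x hx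
    simp only [map_sub, sub_apply, sD_sP]
    rw [hg x (by linarith), ← hu x (by linarith)]
    ring

/-- The function g'² - (μx² - e)g² has derivative -2μxg², and equals g'(0)² at 0. -/
theorem oscillator_moment_one (hg : ∀ x > -1, sD (sD g) x = (μ * x ^ 2 - e) * g x)
    (hg0 : g 0 = 0) :
    2 * μ * ∫ x in Ioi (0 : ℝ), x * (g x * g x) = (sD g 0) ^ 2 := by
  have h := integral_sD (sP (sD g) (sD g) - (μ • (sX ^ 2) (sP g g) - e • sP g g))
  rw [setIntegral_congr_Ioi (g := fun x => -(2 * μ * (x * (g x * g x))))] at h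
  · rw [integral_neg, integral_const_mul] at h
    simp [sP_apply, hg0, sX_apply, pow_two] at h
    linarith
  · intro x hx
    rw [pow_two sX]
    simp only [map_sub, map_smul, sub_apply, smul_apply, smul_eq_mul, sD_sP, mul_apply_eq_comp,
      sD_sX, sX_apply, sP_apply]
    rw [hg x (by linarith)]
    ring

/-- The combination -2x²g'² + 4xgg' - 2g² + 2μx⁴g² - 2ex²g² has derivative 12μx³g² - 8exg² and
vanishes at 0. -/
theorem oscillator_moment_three (hg : ∀ x > -1, sD (sD g) x = (μ * x ^ 2 - e) * g x)
    (hg0 : g 0 = 0) :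
    3 * μ * ∫ x in Ioi (0 : ℝ), x ^ 3 * (g x * g x)
      = 2 * e * ∫ x in Ioi (0 : ℝ), x * (g x * g x) := by
  have h := integral_sD (-(2 : ℝ) • (sX ^ 2) (sP (sD g) (sD g)) + (4 : ℝ) • sX (sP g (sD g))
    - (2 : ℝ) • sP g g + (2 * μ) • (sX ^ 4) (sP g g) - (2 * e) • (sX ^ 2) (sP g g))
  rw [setIntegral_congr_Ioi (g := fun x =>
    12 * μ * (x ^ 3 * (g x * g x)) - 8 * e * (x * (g x * g x)))] at h
  · have i1 : IntegrableOn (fun x => x ^ 3 * (g x * g x)) (Ioi 0) := by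
      have := schwartz_integrableOn ((sX ^ 3) (sP g g))
      refine this.congr_fun (fun x _ => ?_) measurableSet_Ioi
      simp only [sX_pow_apply, sP_apply]
    have i2 : IntegrableOn (fun x => x * (g x * g x)) (Ioi 0) := by
      have := schwartz_integrableOn (sX (sP g g))
      refine this.congr_fun (fun x _ => ?_) measurableSet_Ioi
      simp only [sX_apply, sP_apply]
    rw [integral_sub (i1.const_mul _) (i2.const_mul _), integral_const_mul,
      integral_const_mul] at h
    simp [sP_apply, hg0, sX_apply] at h
    linarith
  · intro x hx
    rw [show sX ^ 4 = sX * sX * (sX * sX) by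
      rw [show (4 : ℕ) = 2 + 2 from rfl, pow_add, pow_two], pow_two sX]
    simp only [map_sub, map_add, map_smul, sub_apply, add_apply, smul_apply, smul_eq_mul, sD_sP,
      mul_apply_eq_comp, sD_sX, sX_apply, sP_apply]
    rw [hg x (by linarith)]
    ring

/-- The solvability condition for the second profile. -/
theorem second_energy (hμ : μ ≠ 0) (hg : ∀ x > -1, sD (sD g) x = (μ * x ^ 2 - e) * g x)
    (hg0 : g 0 = 0) {u : 𝓢(ℝ, ℝ)} {e₁ s θ : ℝ}
    (hu : ∀ x > -1, -sD (sD u) x + (μ * x ^ 2 - e) * u x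
      = e₁ * g x - (2 * x * sD (sD g) x + s * sD g x + θ * x ^ 3 * g x)) :
    e₁ * ∫ x in Ioi (0 : ℝ), g x * g x
      = e * (sD g 0) ^ 2 / (3 * μ) * (θ / μ - 1) - u 0 * sD g 0 := by
  have h := green_oscillator hg hg0 (u := u)
    (F := e₁ • g - ((2 : ℝ) • sX (sD (sD g)) + s • sD g + θ • (sX ^ 3) g)) (fun x hx => by
      rw [hu x hx]
      simp only [sub_apply, add_apply, smul_apply, smul_eq_mul, sX_apply, sX_pow_apply]
      ring)
  have h1 := oscillator_moment_one hg hg0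
  have h3 := oscillator_moment_three hg hg0
  -- The term sg' contributes (s/2)∫(g²)' = 0. With s = 2 - p this shows that p enters the energy
  -- only through the boundary value u(0).
  have h2 := integral_sD ((s / 2) • sP g g)
  rw [setIntegral_congr_Ioi (g := fun x => e₁ * (g x * g x) - sD ((s / 2) • sP g g) x
    - ((2 * μ + θ) * (x ^ 3 * (g x * g x)) - 2 * e * (x * (g x * g x))))] at h
  · have i0 : IntegrableOn (fun x => g x * g x) (Ioi 0) := schwartz_integrableOn (sP g g)
    have i1 : IntegrableOn (fun x => x ^ 3 * (g x * g x)) (Ioi 0) := by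
      have := schwartz_integrableOn ((sX ^ 3) (sP g g))
      refine this.congr_fun (fun x _ => ?_) measurableSet_Ioi
      simp only [sX_pow_apply, sP_apply]
    have i2 : IntegrableOn (fun x => x * (g x * g x)) (Ioi 0) := by
      have := schwartz_integrableOn (sX (sP g g))
      refine this.congr_fun (fun x _ => ?_) measurableSet_Ioi
      simp only [sX_apply, sP_apply]
    have i3 := schwartz_integrableOn (sD ((s / 2) • sP g g))
    have a1 : IntegrableOn (fun x => e₁ * (g x * g x) - sD ((s / 2) • sP g g) x) (Ioi 0) :=
      (i0.const_mul _).sub i3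
    have a2 : IntegrableOn (fun x => (2 * μ + θ) * (x ^ 3 * (g x * g x))
        - 2 * e * (x * (g x * g x))) (Ioi 0) := (i1.const_mul _).sub (i2.const_mul _)
    rw [integral_sub a1 a2,
      integral_sub (i0.const_mul _) i3, integral_sub (i1.const_mul _) (i2.const_mul _),
      integral_const_mul, integral_const_mul, integral_const_mul, h2] at h
    simp only [smul_apply, sP_apply, hg0, mul_zero, smul_zero, neg_zero, sub_zero] at h
    set J0 := ∫ x in Ioi (0 : ℝ), g x * g x
    set J1 := ∫ x in Ioi (0 : ℝ), x * (g x * g x)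
    set J3 := ∫ x in Ioi (0 : ℝ), x ^ 3 * (g x * g x)
    have e1 : J3 = 2 * e * J1 / (3 * μ) := by field_simp; linarith
    have e2 : J1 = (sD g 0) ^ 2 / (2 * μ) := by field_simp; linarith
    rw [e1, e2] at h
    field_simp at h ⊢
    linarith
  · intro x hx
    simp only [sub_apply, add_apply, smul_apply, smul_eq_mul, sX_apply, sX_pow_apply, map_smul,
      sD_sP]
    rw [hg x (by linarith)]
    ring

end Oscillator

/-- Rapidly decreasing solutions of the exterior equation are exponentials. -/
theorem exterior_unique {α : ℝ} (hα : 0 < α) {u : 𝓢(ℝ, ℝ)}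
    (hu : ∀ x > -1, -sD (sD u) x + α ^ 2 * u x = 0) :
    ∀ x, 0 ≤ x → u x = -(sD u 0 / α) * Real.exp (-α * x) := by
  -- Since w' = αw, w is a multiple of e^{αx}; it tends to 0, hence vanishes, and u' = -αu remains.
  set w : 𝓢(ℝ, ℝ) := sD u + α • u with hw
  have hwd : ∀ x > -1, HasDerivAt w (α * w x) x := fun x hx => by
    have := hasDerivAt_sD w x
    convert! this using 1
    have := hu x hx
    simp only [hw, map_add, map_smul, add_apply, smul_apply, smul_eq_mul]
    linear_combination this
  have hconst : ∀ {f : ℝ → ℝ} {β : ℝ}, (∀ x > -1, HasDerivAt f (β * f x) x) → ∀ x, 0 ≤ x →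
      f x = f 0 * Real.exp (β * x) := by
    intro f β hf x hx
    have hd : ∀ y ∈ Ioi (-1 : ℝ), HasDerivAt (fun y => f y * Real.exp (-(β * y))) 0 y := by
      intro y hy
      have h1 := (hf y hy).mul (((hasDerivAt_id y).const_mul β).neg.exp)
      convert! h1 using 1
      simp; ring
    have h2 := (convex_Ioi (-1 : ℝ)).is_const_of_fderivWithin_eq_zero (𝕜 := ℝ)
      (f := fun y => f y * Real.exp (-(β * y)))
      (fun y hy => (hd y hy).differentiableAt.differentiableWithinAt)
      (fun y hy => by
        rw [((hd y hy).hasFDerivAt.hasFDerivWithinAt).fderivWithin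
          (isOpen_Ioi.uniqueDiffWithinAt hy)]
        ext; simp) (show x ∈ Ioi (-1 : ℝ) from lt_of_lt_of_le (by norm_num) hx)
        (show (0 : ℝ) ∈ Ioi (-1 : ℝ) by norm_num)
    simp only [mul_zero, neg_zero, Real.exp_zero, mul_one] at h2
    rw [← h2, mul_assoc, ← Real.exp_add]
    simp
  have hw0 : w 0 = 0 := by
    have h : Tendsto w atTop (𝓝 0) :=
      (w.tendsto_cocompact).mono_left (by rw [cocompact_eq_atBot_atTop]; exact le_sup_right)
    have hb : ∀ x, 0 ≤ x → |w 0| ≤ |w x| := fun x hx => by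
      rw [hconst hwd x hx, abs_mul, Real.abs_exp]
      exact le_mul_of_one_le_right (abs_nonneg _) (Real.one_le_exp (by positivity))
    have h0 := ge_of_tendsto h.abs (by filter_upwards [eventually_ge_atTop 0] with x hx using hb x hx)
    rw [abs_zero] at h0
    exact abs_nonpos_iff.1 h0
  have hwz : ∀ x, 0 ≤ x → w x = 0 := fun x hx => by rw [hconst hwd x hx, hw0, zero_mul]
  have hu0 : u 0 = -(sD u 0 / α) := by
    have := hw0
    simp only [hw, add_apply, smul_apply, smul_eq_mul] at this
    field_simp
    linarith
  intro x hx
  -- on `[0, ∞)` the function solves `u' = -α u`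
  have hcont : ContinuousOn (fun y => u y * Real.exp (α * y)) (Icc 0 x) :=
    (u.continuous.mul (by fun_prop)).continuousOn
  have h2 := constant_of_has_deriv_right_zero hcont (fun y hy => by
    have h1 := (hasDerivAt_sD u y).mul (((hasDerivAt_id y).const_mul α).exp)
    refine (h1.congr_deriv ?_).hasDerivWithinAt
    have := hwz y hy.1
    simp only [hw, add_apply, smul_apply, smul_eq_mul] at this
    simp only [id, mul_one]
    linear_combination Real.exp (α * y) * this) x ⟨hx, le_rfl⟩
  simp only [mul_zero, Real.exp_zero, mul_one] at h2
  rw [← hu0, ← h2, mul_assoc, ← Real.exp_add]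
  simp

/-! ### Gauss-Hermite functions -/

theorem derivative_hermite_succ (n : ℕ) :
    Polynomial.derivative (Polynomial.hermite (n + 1))
      = ((n + 1 : ℕ) : Polynomial ℤ) * Polynomial.hermite n := by
  induction n with
  | zero => simp
  | succ n ih =>
    rw [Polynomial.hermite_succ (n + 1), Polynomial.derivative_sub, Polynomial.derivative_mul,
      ih, Polynomial.derivative_X, Polynomial.derivative_mul, Polynomial.derivative_natCast,
      Polynomial.hermite_succ n]
    push_cast
    ring

/-- The Hermite function without normalization. -/
noncomputable def hermiteFun (l : ℕ) (z : ℝ) : ℝ :=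
  Polynomial.aeval (Real.sqrt 2 * z) (Polynomial.hermite l) * Real.exp (-z ^ 2 / 2)

theorem gaussHermite_eq (l : ℕ) :
    gaussHermite l = fun z => (Real.sqrt (l.factorial * Real.sqrt Real.pi))⁻¹ * hermiteFun l z := by
  ext z; simp only [gaussHermite, hermiteFun]; ring

theorem sqrt_two_mul_self : Real.sqrt 2 * Real.sqrt 2 = 2 := Real.mul_self_sqrt (by norm_num)

theorem hasDerivAt_polyGauss (P : Polynomial ℤ) (z : ℝ) :
    HasDerivAt (fun z => Polynomial.aeval (Real.sqrt 2 * z) P * Real.exp (-z ^ 2 / 2))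
      ((Real.sqrt 2 * Polynomial.aeval (Real.sqrt 2 * z) (Polynomial.derivative P)
        - z * Polynomial.aeval (Real.sqrt 2 * z) P) * Real.exp (-z ^ 2 / 2)) z := by
  have h1 : HasDerivAt (fun z : ℝ => Real.sqrt 2 * z) (Real.sqrt 2) z := by
    simpa using (hasDerivAt_id z).const_mul (Real.sqrt 2)
  have h2 := (P.hasDerivAt_aeval (Real.sqrt 2 * z)).comp z h1
  have h3 : HasDerivAt (fun z : ℝ => -z ^ 2 / 2) (-z) z := by
    have := ((hasDerivAt_id z).pow 2).neg.div_const 2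
    convert! this using 1
    simp; ring
  have := h2.mul h3.exp
  convert! this using 1
  simp only [Function.comp]; ring

/-- The raising relation. -/
theorem hasDerivAt_hermiteFun (l : ℕ) (z : ℝ) :
    HasDerivAt (hermiteFun l) (z * hermiteFun l z - Real.sqrt 2 * hermiteFun (l + 1) z) z := by
  have := hasDerivAt_polyGauss (Polynomial.hermite l) z
  convert! this using 1
  simp only [hermiteFun, Polynomial.hermite_succ, map_sub, map_mul, Polynomial.aeval_X]
  linear_combination -(z * Polynomial.aeval (Real.sqrt 2 * z) (Polynomial.hermite l)
    * Real.exp (-z ^ 2 / 2)) * sqrt_two_mul_self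

/-- The lowering relation. -/
theorem hasDerivAt_hermiteFun_succ (l : ℕ) (z : ℝ) :
    HasDerivAt (hermiteFun (l + 1))
      (Real.sqrt 2 * (l + 1) * hermiteFun l z - z * hermiteFun (l + 1) z) z := by
  have := hasDerivAt_polyGauss (Polynomial.hermite (l + 1)) z
  convert! this using 1
  rw [derivative_hermite_succ]
  simp only [hermiteFun, map_mul, map_natCast]
  push_cast
  ring

theorem deriv_hermiteFun (l : ℕ) :
    deriv (hermiteFun l) = fun z => z * hermiteFun l z - Real.sqrt 2 * hermiteFun (l + 1) z :=
  funext fun z => (hasDerivAt_hermiteFun l z).deriv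

theorem hasDerivAt_deriv_hermiteFun (l : ℕ) (z : ℝ) :
    HasDerivAt (deriv (hermiteFun l)) ((z ^ 2 - (2 * l + 1)) * hermiteFun l z) z := by
  rw [deriv_hermiteFun]
  have := ((hasDerivAt_id z).mul (hasDerivAt_hermiteFun l z)).sub
    ((hasDerivAt_hermiteFun_succ l z).const_mul (Real.sqrt 2))
  convert! this using 1
  simp only [id]
  linear_combination (l + 1) * hermiteFun l z * sqrt_two_mul_self

theorem hasDerivAt_gaussHermite (l : ℕ) (z : ℝ) :
    HasDerivAt (gaussHermite l) (deriv (gaussHermite l) z) z := by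
  rw [gaussHermite_eq]
  exact ((hasDerivAt_hermiteFun l z).const_mul _).differentiableAt.hasDerivAt

theorem hasDerivAt_deriv_gaussHermite (l : ℕ) (z : ℝ) :
    HasDerivAt (deriv (gaussHermite l)) ((z ^ 2 - (2 * l + 1)) * gaussHermite l z) z := by
  have : deriv (gaussHermite l)
      = fun z => (Real.sqrt (l.factorial * Real.sqrt Real.pi))⁻¹ * deriv (hermiteFun l) z := by
    ext z
    rw [gaussHermite_eq, deriv_const_mul_field]
  rw [this, gaussHermite_eq]
  convert! (hasDerivAt_deriv_hermiteFun l z).const_mul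
    (Real.sqrt (l.factorial * Real.sqrt Real.pi))⁻¹ using 1
  ring

theorem hermiteFun_zero_of_odd (j : ℕ) : hermiteFun (2 * j + 1) 0 = 0 := by
  have : Polynomial.aeval (0 : ℝ) (Polynomial.hermite (2 * j + 1)) = 0 := by
    rw [← Polynomial.coeff_zero_eq_aeval_zero',
      Polynomial.coeff_hermite_of_odd_add (by simp [parity_simps])]
    simp
  simp only [hermiteFun, mul_zero, this, zero_mul]

theorem gaussHermite_odd_zero (j : ℕ) : gaussHermite (2 * j + 1) 0 = 0 := by
  rw [gaussHermite_eq]; simp [hermiteFun_zero_of_odd]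

theorem norm_factor_pos (l : ℕ) : 0 < (Real.sqrt (l.factorial * Real.sqrt Real.pi))⁻¹ := by
  have := Real.pi_pos
  positivity

/-- By the lowering relation this derivative is a nonzero multiple of the even Hermite polynomial at
0, which is a double factorial up to sign. -/
theorem deriv_gaussHermite_odd_ne_zero (j : ℕ) : deriv (gaussHermite (2 * j + 1)) 0 ≠ 0 := by
  rw [gaussHermite_eq, deriv_const_mul_field, (hasDerivAt_hermiteFun_succ (2 * j) 0).deriv]
  refine mul_ne_zero (norm_factor_pos _).ne' ?_
  have h0 : hermiteFun (2 * j) 0 ≠ 0 := by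
    have : Polynomial.aeval (0 : ℝ) (Polynomial.hermite (2 * j)) ≠ 0 := by
      rw [← Polynomial.coeff_zero_eq_aeval_zero']
      have := Polynomial.coeff_hermite_explicit j 0
      simp only [add_zero] at this
      rw [this]
      simp [(Nat.doubleFactorial_pos _).ne']
    simpa [hermiteFun] using this
  rw [zero_mul, sub_zero]
  have : (0 : ℝ) < Real.sqrt 2 * ((2 * j : ℕ) + 1) := by positivity
  exact mul_ne_zero this.ne' h0

/-! ### Hermite functions in the reflected variable and their half-line norms. -/

section Reflected

variable {c : ℝ}

theorem exists_schwartz_gaussian (hc : 0 < c) :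
    ∃ g : 𝓢(ℝ, ℝ), ∀ x > -1, g x = Real.exp (-(c * x) ^ 2 / 2) := by
  have hd : ∀ x, HasDerivAt (fun x => Real.exp (-(c * x) ^ 2 / 2))
      ((0 + -c ^ 2 * x) * Real.exp (-(c * x) ^ 2 / 2) + (0 : 𝓢(ℝ, ℝ)) x) x := fun x => by
    have h1 : HasDerivAt (fun x : ℝ => -(c * x) ^ 2 / 2) (-c ^ 2 * x) x := by
      have := ((((hasDerivAt_id x).const_mul c).pow 2).neg).div_const 2
      convert! this using 1
      simp; ring
    convert! h1.exp using 1
    simp; ring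
  refine exists_schwartz_of_ode (0 : 𝓢(ℝ, ℝ)) (by fun_prop) hd fun a => ?_
  refine ⟨1 + a.factorial / (c ^ 2 / 2) ^ a, fun x hx => ?_⟩
  rw [abs_of_nonneg hx, Real.abs_exp]
  have hp : 0 ≤ (a.factorial : ℝ) / (c ^ 2 / 2) ^ a := by positivity
  rcases le_or_gt x 1 with h | h
  · have e1 : x ^ a ≤ 1 := pow_le_one₀ hx h
    have e2 : Real.exp (-(c * x) ^ 2 / 2) ≤ 1 := Real.exp_le_one_iff.2 (by
      have := sq_nonneg (c * x); linarith)
    linarith [mul_le_one₀ e1 (Real.exp_pos _).le e2]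
  · have e2 : Real.exp (-(c * x) ^ 2 / 2) ≤ Real.exp (-(c ^ 2 / 2 * x)) :=
      Real.exp_le_exp.2 (by
        have : c ^ 2 * x ≤ c ^ 2 * x ^ 2 := by gcongr; nlinarith
        rw [mul_pow]; linarith)
    have := pow_mul_exp_neg_le (ε := c ^ 2 / 2) (by positivity) a hx
    have h3 : x ^ a * Real.exp (-(c * x) ^ 2 / 2) ≤ x ^ a * Real.exp (-(c ^ 2 / 2 * x)) := by
      gcongr
    linarith

theorem exists_schwartz_polyGauss (hc : 0 < c) (P : Polynomial ℤ) : ∃ g : 𝓢(ℝ, ℝ), ∀ x > -1,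
    g x = Polynomial.aeval (Real.sqrt 2 * -(c * x)) P * Real.exp (-(-(c * x)) ^ 2 / 2) := by
  obtain ⟨γ, hγ⟩ := exists_schwartz_gaussian hc
  induction P using Polynomial.induction_on' with
  | add p q hp hq =>
    obtain ⟨g, hg⟩ := hp
    obtain ⟨h, hh⟩ := hq
    refine ⟨g + h, fun x hx => ?_⟩
    rw [add_apply, hg x hx, hh x hx, map_add, add_mul]
  | monomial n a =>
    refine ⟨((a : ℝ) * (-(Real.sqrt 2 * c)) ^ n) • (sX ^ n) γ, fun x hx => ?_⟩
    rw [smul_apply, sX_pow_apply, hγ x hx, Polynomial.aeval_monomial]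
    simp only [smul_eq_mul, neg_sq, eq_intCast]
    rw [show Real.sqrt 2 * -(c * x) = -(Real.sqrt 2 * c) * x by ring, mul_pow]
    ring

theorem exists_schwartz_hermiteFun (hc : 0 < c) (l : ℕ) :
    ∃ g : 𝓢(ℝ, ℝ), ∀ x > -1, g x = hermiteFun l (-(c * x)) :=
  exists_schwartz_polyGauss hc _

theorem exists_schwartz_gaussHermite (hc : 0 < c) (l : ℕ) :
    ∃ g : 𝓢(ℝ, ℝ), ∀ x > -1, g x = gaussHermite l (-(c * x)) := by
  obtain ⟨g, hg⟩ := exists_schwartz_hermiteFun hc l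
  refine ⟨(Real.sqrt (l.factorial * Real.sqrt Real.pi))⁻¹ • g, fun x hx => ?_⟩
  rw [gaussHermite_eq, smul_apply, hg x hx, smul_eq_mul]

theorem hasDerivAt_reflect (c x : ℝ) : HasDerivAt (fun x : ℝ => -(c * x)) (-c) x := by
  have := ((hasDerivAt_id x).const_mul c).neg
  convert! this using 1
  simp

/-- Up to a constant, the derivative of the product of two consecutive Hermite functions is h_{l+1}²
- (l+1)h_l². The product vanishes at 0, one of the two indices being odd, so there is no boundary
term and the half-line norms satisfy the recursion of the whole line. -/
theorem integral_hermiteFun_sq (hc : 0 < c) (l : ℕ) :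
    ∫ x in Ioi (0 : ℝ), hermiteFun l (-(c * x)) ^ 2 = l.factorial * Real.sqrt Real.pi / (2 * c) := by
  induction l with
  | zero =>
    have e : ∀ x : ℝ, hermiteFun 0 (-(c * x)) ^ 2 = Real.exp (-(c ^ 2) * x ^ 2) := fun x => by
      simp only [hermiteFun, Polynomial.hermite_zero, map_one, one_mul, ← Real.exp_nat_mul]
      congr 1; push_cast; ring
    simp_rw [e]
    rw [integral_gaussian_Ioi, Real.sqrt_div' _ (by positivity), Real.sqrt_sq hc.le]
    simp; ring
  | succ l ih =>
    obtain ⟨g, hg⟩ := exists_schwartz_hermiteFun hc l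
    obtain ⟨h, hh⟩ := exists_schwartz_hermiteFun hc (l + 1)
    have hgd := sD_congr hg fun x _ => (hasDerivAt_hermiteFun l _).comp x (hasDerivAt_reflect c x)
    have hhd := sD_congr hh fun x _ =>
      (hasDerivAt_hermiteFun_succ l _).comp x (hasDerivAt_reflect c x)
    have h0 := integral_sD (sP g h)
    have hz : g 0 * h 0 = 0 := by
      rw [hg 0 (by norm_num), hh 0 (by norm_num)]
      simp only [mul_zero, neg_zero]
      rcases Nat.even_or_odd' l with ⟨j, rfl | rfl⟩
      · rw [hermiteFun_zero_of_odd, mul_zero]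
      · rw [hermiteFun_zero_of_odd, zero_mul]
    rw [setIntegral_congr_Ioi (g := fun x => c * Real.sqrt 2 *
      (hermiteFun (l + 1) (-(c * x)) ^ 2 - (l + 1) * hermiteFun l (-(c * x)) ^ 2)), sP_apply, hz,
      integral_const_mul, neg_zero] at h0
    · have i1 : IntegrableOn (fun x => hermiteFun (l + 1) (-(c * x)) ^ 2) (Ioi 0) := by
        refine (schwartz_integrableOn (sP h h)).congr_fun (fun x hx => ?_) measurableSet_Ioi
        rw [sP_apply, hh x (lt_trans (by norm_num) hx), pow_two]
      have i2 : IntegrableOn (fun x => hermiteFun l (-(c * x)) ^ 2) (Ioi 0) := by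
        refine (schwartz_integrableOn (sP g g)).congr_fun (fun x hx => ?_) measurableSet_Ioi
        rw [sP_apply, hg x (lt_trans (by norm_num) hx), pow_two]
      have hne : c * Real.sqrt 2 ≠ 0 := by positivity
      have := (mul_eq_zero.1 h0).resolve_left hne
      rw [integral_sub i1 (i2.const_mul _), integral_const_mul, ih] at this
      rw [sub_eq_zero.1 this, Nat.factorial_succ]
      push_cast
      ring
    · intro x hx
      have hx' : x > -1 := by linarith
      rw [sD_sP, hgd x hx', hhd x hx', hg x hx', hh x hx']
      ring

theorem integral_gaussHermite_sq (hc : 0 < c) (l : ℕ) :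
    ∫ x in Ioi (0 : ℝ), gaussHermite l (-(c * x)) * gaussHermite l (-(c * x)) = 1 / (2 * c) := by
  have hN : 0 < (l.factorial : ℝ) * Real.sqrt Real.pi := by have := Real.pi_pos; positivity
  have e : ∀ x, gaussHermite l (-(c * x)) * gaussHermite l (-(c * x))
      = (l.factorial * Real.sqrt Real.pi)⁻¹ * hermiteFun l (-(c * x)) ^ 2 := fun x => by
    rw [gaussHermite_eq]
    have : (Real.sqrt (l.factorial * Real.sqrt Real.pi))⁻¹
        * (Real.sqrt (l.factorial * Real.sqrt Real.pi))⁻¹ = (l.factorial * Real.sqrt Real.pi)⁻¹ := by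
      rw [← mul_inv, Real.mul_self_sqrt hN.le]
    simp only
    linear_combination hermiteFun l (-(c * x)) ^ 2 * this
  simp_rw [e]
  rw [integral_const_mul, integral_hermiteFun_sq hc]
  field_simp

end Reflected

/-! ### The coefficients of the interior equation -/

section Coefficients

variable {n : ℝ → ℝ} {R : ℝ}

/-- The square of the quotient `n(R) / n(R (1 - y))`. -/
noncomputable def coefM (n : ℝ → ℝ) (R y : ℝ) : ℝ := (n R / n (R * (1 - y))) ^ 2

/-- The coefficient of the first order term of the interior equation. -/
noncomputable def coefB (n : ℝ → ℝ) (p : ℤ) (R y : ℝ) : ℝ :=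
  coefM n R y * (1 / (1 - y)
    + (p - 1) * R * derivWithin n (Icc 0 R) (R * (1 - y)) / n (R * (1 - y)))

/-- The effective potential of the interior equation. -/
noncomputable def coefT (n : ℝ → ℝ) (R y : ℝ) : ℝ := coefM n R y / (1 - y) ^ 2 - 1

theorem nCoeff_zero (n : ℝ → ℝ) (R : ℝ) : nCoeff n R 0 = n R := by
  simp [nCoeff]

theorem nCoeff_one (n : ℝ → ℝ) (R : ℝ) : nCoeff n R 1 = derivWithin n (Icc 0 R) R := by
  simp [nCoeff, iteratedDerivWithin_one]

theorem mapsTo_scale (hR : 0 < R) : MapsTo (fun y : ℝ => R * (1 - y)) (Icc 0 (1 / 2)) (Icc 0 R) :=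
  fun y hy => ⟨mul_nonneg hR.le (by linarith [hy.2]), by nlinarith [hy.1]⟩

theorem IsOpticalIndex.pos (hn : IsOpticalIndex n R) {r : ℝ} (hr : r ∈ Icc 0 R) : 0 < n r :=
  one_pos.trans (hn.one_lt r hr)

theorem IsOpticalIndex.R_pos (hn : IsOpticalIndex n R) (hR : 0 < R) : 1 < n R :=
  hn.one_lt R ⟨hR.le, le_rfl⟩

theorem contDiffOn_index (hR : 0 < R) (hn : IsOpticalIndex n R) :
    ContDiffOn ℝ ∞ (fun y => n (R * (1 - y))) (Icc 0 (1 / 2)) :=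
  hn.smooth.comp (by fun_prop) (mapsTo_scale hR)

theorem contDiffOn_index_deriv (hR : 0 < R) (hn : IsOpticalIndex n R) :
    ContDiffOn ℝ ∞ (fun y => derivWithin n (Icc 0 R) (R * (1 - y))) (Icc 0 (1 / 2)) :=
  (hn.smooth.derivWithin (uniqueDiffOn_Icc hR) (m := ∞) (by simp)).comp (by fun_prop)
    (mapsTo_scale hR)

theorem index_ne_zero (hR : 0 < R) (hn : IsOpticalIndex n R) :
    ∀ y ∈ Icc (0 : ℝ) (1 / 2), n (R * (1 - y)) ≠ 0 :=
  fun _ hy => (hn.pos (mapsTo_scale hR hy)).ne'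

theorem contDiffOn_coefM (hR : 0 < R) (hn : IsOpticalIndex n R) :
    ContDiffOn ℝ ∞ (coefM n R) (Icc 0 (1 / 2)) :=
  (contDiffOn_const.div (contDiffOn_index hR hn) (index_ne_zero hR hn)).pow 2

theorem one_sub_ne_zero' : ∀ y ∈ Icc (0 : ℝ) (1 / 2), (1 - y) ≠ 0 :=
  fun y hy => by have := hy.2; intro h; linarith

theorem contDiffOn_coefB (p : ℤ) (hR : 0 < R) (hn : IsOpticalIndex n R) :
    ContDiffOn ℝ ∞ (coefB n p R) (Icc 0 (1 / 2)) :=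
  (contDiffOn_coefM hR hn).mul ((contDiffOn_const.div (contDiffOn_const.sub contDiffOn_id)
    one_sub_ne_zero').add ((contDiffOn_const.mul (contDiffOn_index_deriv hR hn)).div
      (contDiffOn_index hR hn) (index_ne_zero hR hn)))

theorem contDiffOn_coefT (hR : 0 < R) (hn : IsOpticalIndex n R) :
    ContDiffOn ℝ ∞ (coefT n R) (Icc 0 (1 / 2)) :=
  ((contDiffOn_coefM hR hn).div ((contDiffOn_const.sub contDiffOn_id).pow 2)
    fun y hy => pow_ne_zero 2 (one_sub_ne_zero' y hy)).sub contDiffOn_const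

theorem HasTaylor.coeff_zero {h : ℝ → ℝ} {c : ℕ → ℝ} {r : ℝ} (hr : 0 ≤ r) (hc : HasTaylor h c r) :
    c 0 = h 0 := by
  obtain ⟨C, hC⟩ := hc 1
  have := hC 0 ⟨le_rfl, hr⟩
  simp at this
  linarith [sub_eq_zero.1 this]

theorem HasTaylor.unique_of_isBigO {h : ℝ → ℝ} {c d : ℕ → ℝ} {r : ℝ} (hr : 0 < r)
    (hc : HasTaylor h c r) (N : ℕ)
    (hd : (fun y => h y - ∑ k ∈ Finset.range N, d k * y ^ k) =O[𝓝[≥] 0] fun y => y ^ N) :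
    ∀ k < N, c k = d k := by
  obtain ⟨C, hC⟩ := hd.bound
  obtain ⟨r', hr', hsub⟩ := (mem_nhdsGE_iff_exists_Icc_subset).1 hC
  refine hc.unique hr hr' N (C := C) fun y hy => ?_
  have := hsub hy
  simpa [abs_of_nonneg hy.1] using this

theorem isBigO_one_of_continuous {f : ℝ → ℝ} (hf : ContinuousWithinAt f (Ici 0) 0) :
    f =O[𝓝[≥] 0] fun _ => (1 : ℝ) := Tendsto.isBigO_one ℝ hf

/-- Taylor's formula at R from inside, with r - R = -Ry; the term of order four is absorbed in the
remainder. -/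
theorem index_expansion (hR : 0 < R) (hn : IsOpticalIndex n R) :
    (fun y => n (R * (1 - y)) - (nCoeff n R 0 - R * nCoeff n R 1 * y
      + R ^ 2 * nCoeff n R 2 / 2 * y ^ 2 - R ^ 3 * nCoeff n R 3 / 6 * y ^ 3))
      =O[𝓝[≥] 0] fun y => y ^ 4 := by
  have h1 := taylor_isLittleO (n := 4) (convex_Icc 0 R) (right_mem_Icc.2 hR.le)
    (hn.smooth.of_le (by norm_cast))
  have ht : Tendsto (fun y : ℝ => R * (1 - y)) (𝓝[≥] 0) (𝓝[Icc 0 R] R) := by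
    refine tendsto_nhdsWithin_iff.2 ⟨?_, ?_⟩
    · have : Tendsto (fun y : ℝ => R * (1 - y)) (𝓝 0) (𝓝 (R * (1 - 0))) :=
        Continuous.tendsto (by fun_prop) _
      simp only [sub_zero, mul_one] at this
      exact this.mono_left nhdsWithin_le_nhds
    · filter_upwards [Icc_mem_nhdsGE (show (0 : ℝ) < 1 / 2 by norm_num)] with y hy
        using mapsTo_scale hR hy
  have h2 := (h1.comp_tendsto ht).isBigO
  have h3 : (fun y : ℝ => (R * (1 - y) - R) ^ 4) =O[𝓝[≥] 0] fun y : ℝ => y ^ 4 := by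
    have : (fun y : ℝ => (R * (1 - y) - R) ^ 4) = fun y => R ^ 4 * y ^ 4 := by ext y; ring
    rw [this]
    exact (Asymptotics.isBigO_refl _ _).const_mul_left _
  have h4 := (h2.trans h3).add (((Asymptotics.isBigO_refl (fun y : ℝ => y ^ 4) (𝓝[≥] 0))).const_mul_left
    (R ^ 4 * nCoeff n R 4 / 24))
  refine h4.congr_left fun y => ?_
  simp only [Function.comp, taylor_within_apply, Finset.sum_range_succ, Finset.sum_range_zero,
    smul_eq_mul, nCoeff]
  norm_num [Nat.factorial]
  ring

/-- Zero effective curvature means R n₁ = -n₀, so the coefficient of y is exactly 1; multiplied by 1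
- y, the linear terms cancel. -/
theorem relative_index_expansion (hR : 0 < R) (hn : IsOpticalIndex n R)
    (hκ : effCurvature n R = 0) :
    (fun y => n (R * (1 - y)) / n R - (1 + y + (1 - effHessian n R / 2) * y ^ 2
      - R ^ 3 * nCoeff n R 3 / (6 * nCoeff n R 0) * y ^ 3)) =O[𝓝[≥] 0] fun y => y ^ 4 := by
  have hn0 : n R ≠ 0 := (hn.pos ⟨hR.le, le_rfl⟩).ne'
  refine ((index_expansion hR hn).const_mul_left (n R)⁻¹).congr_left fun y => ?_
  have h1 : R * nCoeff n R 1 = -n R := by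
    have := hκ
    rw [effCurvature, nCoeff_zero] at this
    field_simp at this
    linarith
  have h2 : R ^ 2 * nCoeff n R 2 = (2 - effHessian n R) * n R := by
    rw [effHessian, nCoeff_zero]
    field_simp
    ring
  rw [h1, h2, nCoeff_zero]
  field_simp
  ring

theorem coefM_expansion (hR : 0 < R) (hn : IsOpticalIndex n R) (hκ : effCurvature n R = 0) :
    (fun y => coefM n R y - (1 - 2 * y)) =O[𝓝[≥] 0] fun y => y ^ 2 := by
  have hn0 : n R ≠ 0 := (hn.pos ⟨hR.le, le_rfl⟩).ne'
  set ν : ℝ → ℝ := fun y => n (R * (1 - y)) / n R with hν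
  set a := 1 - effHessian n R / 2
  set c := R ^ 3 * nCoeff n R 3 / (6 * nCoeff n R 0)
  set ρ : ℝ → ℝ := fun y => ν y - (1 + y + a * y ^ 2 - c * y ^ 3) with hρ
  have hρO : ρ =O[𝓝[≥] 0] fun y => y ^ 4 := relative_index_expansion hR hn hκ
  have hIcc : Icc (0 : ℝ) (1 / 2) ∈ 𝓝[≥] (0 : ℝ) := Icc_mem_nhdsGE (by norm_num)
  have hνc : ContinuousWithinAt ν (Ici 0) 0 := by
    have : ContinuousWithinAt ν (Icc 0 (1 / 2)) 0 :=
      ((contDiffOn_index hR hn).continuousOn.div_const _) 0 ⟨le_rfl, by norm_num⟩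
    exact this.mono_of_mem_nhdsWithin hIcc
  have hMc : ContinuousWithinAt (coefM n R) (Ici 0) 0 :=
    ((contDiffOn_coefM hR hn).continuousOn 0 ⟨le_rfl, by norm_num⟩).mono_of_mem_nhdsWithin hIcc
  have h42 : (fun y : ℝ => y ^ 4) =O[𝓝[≥] 0] fun y : ℝ => y ^ 2 := by
    have := (Asymptotics.isBigO_refl (fun y : ℝ => y ^ 2) (𝓝[≥] 0)).mul
      (isBigO_one_of_continuous (f := fun y : ℝ => y ^ 2) (by fun_prop))
    simpa [← pow_add] using this
  have hpc : ContinuousWithinAt (fun y => 3 + 2 * y - (a - c * y) * ((1 - 2 * y)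
      * (2 + 2 * y + a * y ^ 2 - c * y ^ 3))) (Ici 0) 0 := by fun_prop
  have hsc : ContinuousWithinAt (fun y => -((1 - 2 * y)
      * (ν y + (1 + y + a * y ^ 2 - c * y ^ 3)))) (Ici 0) 0 := by fun_prop
  -- This is 1 - (1 - 2y)ν², with ν replaced by its cubic approximation up to ρ. Since Mν² = 1,
  -- multiplication by M gives M - (1 - 2y).
  have hA : (fun y : ℝ => y ^ 2 * (3 + 2 * y - (a - c * y) * ((1 - 2 * y)
      * (2 + 2 * y + a * y ^ 2 - c * y ^ 3))) + ρ y * -((1 - 2 * y)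
      * (ν y + (1 + y + a * y ^ 2 - c * y ^ 3)))) =O[𝓝[≥] 0] fun y => y ^ 2 := by
    have h1 := (Asymptotics.isBigO_refl (fun y : ℝ => y ^ 2) (𝓝[≥] 0)).mul
      (isBigO_one_of_continuous hpc)
    have h2 := (hρO.trans h42).mul (isBigO_one_of_continuous hsc)
    simpa using h1.add h2
  have hB := (isBigO_one_of_continuous hMc).mul hA
  simp only [one_mul] at hB
  refine hB.congr' ?_ EventuallyEq.rfl
  filter_upwards [hIcc] with y hy
  have hne := index_ne_zero hR hn y hy
  have hM : coefM n R y * ν y ^ 2 = 1 := by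
    simp only [coefM, hν]; field_simp
  simp only [hρ]
  linear_combination (-(1 - 2 * y)) * hM

theorem coefT_expansion (hR : 0 < R) (hn : IsOpticalIndex n R) (hκ : effCurvature n R = 0) :
    (fun y => coefT n R y - (effHessian n R * y ^ 2
      + (2 - effHessian n R + R ^ 3 * nCoeff n R 3 / (3 * nCoeff n R 0)) * y ^ 3))
      =O[𝓝[≥] 0] fun y => y ^ 4 := by
  have hn0 : n R ≠ 0 := (hn.pos ⟨hR.le, le_rfl⟩).ne'
  set ν : ℝ → ℝ := fun y => n (R * (1 - y)) / n R with hν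
  set μ := effHessian n R
  have hc3 : R ^ 3 * nCoeff n R 3 / (3 * nCoeff n R 0)
      = 2 * (R ^ 3 * nCoeff n R 3 / (6 * nCoeff n R 0)) := by
    rw [nCoeff_zero]; field_simp; ring
  rw [hc3]
  set c := R ^ 3 * nCoeff n R 3 / (6 * nCoeff n R 0)
  set P : ℝ → ℝ := fun y => 1 + y + (1 - μ / 2) * y ^ 2 - c * y ^ 3 with hP
  set ρ : ℝ → ℝ := fun y => ν y - P y with hρ
  have hρO : ρ =O[𝓝[≥] 0] fun y => y ^ 4 := relative_index_expansion hR hn hκ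
  have hIcc : Icc (0 : ℝ) (1 / 2) ∈ 𝓝[≥] (0 : ℝ) := Icc_mem_nhdsGE (by norm_num)
  have hνc : ContinuousWithinAt ν (Ici 0) 0 := by
    have : ContinuousWithinAt ν (Icc 0 (1 / 2)) 0 :=
      ((contDiffOn_index hR hn).continuousOn.div_const _) 0 ⟨le_rfl, by norm_num⟩
    exact this.mono_of_mem_nhdsWithin hIcc
  have hTc : ContinuousWithinAt (fun y => coefT n R y + 1) (Ici 0) 0 :=
    (((contDiffOn_coefT hR hn).continuousOn 0
      ⟨le_rfl, by norm_num⟩).mono_of_mem_nhdsWithin hIcc).add continuousWithinAt_const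
  set β := (2 - μ + 2 * c) / 2 with hβ
  set Q : ℝ → ℝ := fun y => μ * y ^ 2 + (2 - μ + 2 * c) * y ^ 3 with hQ
  -- One has (1 - y)P = 1 - y²(μ/2 + βy - cy²) and Q = y²(μ + 2βy), whence 1 - (1 + Q)(1 - y)²P² =
  -- -y⁴K. Replacing P by ν costs a multiple of ρ, and (T + 1)(1 - y)²ν² = 1 turns the result into T
  -- - Q.
  set K : ℝ → ℝ := fun y => (2 * c + (μ / 2 + β * y - c * y ^ 2) ^ 2) * (1 + Q y)
    - (μ + 2 * β * y) ^ 2 with hK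
  have hKc : ContinuousWithinAt (fun y => -K y) (Ici 0) 0 := by
    simp only [hK, hQ]; fun_prop
  have hsc : ContinuousWithinAt (fun y => -((1 - y) ^ 2 * (ν y + P y) * (1 + Q y))) (Ici 0) 0 := by
    simp only [hP, hQ]; fun_prop
  have hA : (fun y : ℝ => y ^ 4 * -K y + ρ y * -((1 - y) ^ 2 * (ν y + P y) * (1 + Q y)))
      =O[𝓝[≥] 0] fun y => y ^ 4 := by
    have h1 := (Asymptotics.isBigO_refl (fun y : ℝ => y ^ 4) (𝓝[≥] 0)).mul
      (isBigO_one_of_continuous hKc)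
    have h2 := hρO.mul (isBigO_one_of_continuous hsc)
    simpa using h1.add h2
  have hB := (isBigO_one_of_continuous hTc).mul hA
  simp only [one_mul] at hB
  refine hB.congr' ?_ EventuallyEq.rfl
  filter_upwards [hIcc] with y hy
  have hne := index_ne_zero hR hn y hy
  have hy1 := one_sub_ne_zero' y hy
  have hT : (coefT n R y + 1) * ((1 - y) ^ 2 * ν y ^ 2) = 1 := by
    simp only [coefT, coefM, hν]; field_simp; ring
  simp only [hρ, hK, hP, hQ, hβ] at *
  linear_combination (-(1 + μ * y ^ 2 + (2 - μ + 2 * c) * y ^ 3)) * hT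

theorem exists_coefficients (p : ℤ) (hR : 0 < R) (hn : IsOpticalIndex n R)
    (hκ : effCurvature n R = 0) :
    ∃ m b θ : ℕ → ℝ, HasTaylor (coefM n R) m (1 / 2) ∧ HasTaylor (coefB n p R) b (1 / 2) ∧
      HasTaylor (coefT n R) θ (1 / 2) ∧ m 0 = 1 ∧ m 1 = -2 ∧ b 0 = 2 - p ∧ θ 0 = 0 ∧ θ 1 = 0 ∧
      θ 2 = effHessian n R ∧
      θ 3 = 2 - effHessian n R + R ^ 3 * nCoeff n R 3 / (3 * nCoeff n R 0) := by
  have hn0 : n R ≠ 0 := (hn.pos ⟨hR.le, le_rfl⟩).ne'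
  have h0 : (0 : ℝ) ≤ 1 / 2 := by norm_num
  have hm := hasTaylor_of_contDiffOn h0 (contDiffOn_coefM hR hn)
  have hb := hasTaylor_of_contDiffOn h0 (contDiffOn_coefB p hR hn)
  have hθ := hasTaylor_of_contDiffOn h0 (contDiffOn_coefT hR hn)
  have um := hm.unique_of_isBigO (by norm_num) 2 (d := fun k => if k = 0 then 1 else -2)
    ((coefM_expansion hR hn hκ).congr_left fun y => by
      simp [Finset.sum_range_succ]; ring)
  have uθ := hθ.unique_of_isBigO (by norm_num) 4 (d := fun k => if k = 2 then effHessian n R else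
    if k = 3 then 2 - effHessian n R + R ^ 3 * nCoeff n R 3 / (3 * nCoeff n R 0) else 0)
    ((coefT_expansion hR hn hκ).congr_left fun y => by
      simp [Finset.sum_range_succ])
  refine ⟨_, _, _, hm, hb, hθ, ?_, ?_, ?_, ?_, ?_, ?_, ?_⟩
  · simpa using um 0 (by norm_num)
  · simpa using um 1 (by norm_num)
  · have := hb.coeff_zero h0
    rw [this]
    simp only [coefB, coefM, sub_zero, mul_one]
    have h1 : R * derivWithin n (Icc 0 R) R = -n R := by
      have := hκ
      rw [effCurvature, nCoeff_zero, nCoeff_one] at this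
      field_simp at this
      linarith
    rw [mul_assoc, h1]
    field_simp
    ring
  · simpa using uθ 0 (by norm_num)
  · simpa using uθ 1 (by norm_num)
  · simpa using uθ 2 (by norm_num)
  · simpa using uθ 3 (by norm_num)

end Coefficients

/-! ### The formal solution -/

/-- The coefficients `c k` act on the Schwartz space by multiplication. -/
def ActsOnSchwartz (c : ℕ → ℝ → ℝ) : Prop :=
  ∀ l, ∃ P : 𝓢(ℝ, ℝ) →L[ℝ] 𝓢(ℝ, ℝ), ∀ f x, P f x = c l x * f x

theorem actsOnSchwartz_one : ActsOnSchwartz oneCoeff := fun l => by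
  by_cases h : l = 0
  · exact ⟨1, fun f x => by simp [oneCoeff, h]⟩
  · exact ⟨0, fun f x => by simp [oneCoeff, h]⟩

theorem ActsOnSchwartz.shift {c : ℕ → ℝ → ℝ} (hc : ActsOnSchwartz c) :
    ActsOnSchwartz (shiftCoeff c) := fun l => by
  rcases l with _ | l
  · exact ⟨0, fun f x => by simp [shiftCoeff]⟩
  · exact hc l

theorem ActsOnSchwartz.div {c : ℕ → ℝ → ℝ} (hc : ActsOnSchwartz c) :
    ActsOnSchwartz (divCoeff c) := fun l => by
  induction l using Nat.twoStepInduction with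
  | zero => exact hc 0
  | one => exact hc 1
  | more l ih _ =>
    obtain ⟨P, hP⟩ := hc (l + 2)
    obtain ⟨Q, hQ⟩ := ih
    refine ⟨P - sX * Q, fun f x => ?_⟩
    rw [sub_apply, sub_apply, mul_apply_eq_comp, sX_apply, hP, hQ, divCoeff]
    ring

/-- The coefficients of the interior operator. -/
noncomputable def interiorOp (m b θ : ℕ → ℝ) (l : ℕ) : 𝓢(ℝ, ℝ) →L[ℝ] 𝓢(ℝ, ℝ) :=
  -(m l • (sX ^ l * sD * sD)) + (if l = 0 then 0 else b (l - 1) • (sX ^ (l - 1) * sD))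
    + θ (l + 2) • sX ^ (l + 2)

theorem interiorOp_apply (m b θ : ℕ → ℝ) (l : ℕ) (f : 𝓢(ℝ, ℝ)) (x : ℝ) :
    interiorOp m b θ l f x = -(m l * x ^ l * sD (sD f) x)
      + shiftCoeff (fun k x => b k * x ^ k) l x * sD f x + θ (l + 2) * x ^ (l + 2) * f x := by
  have h : ∀ (l : ℕ) (f : 𝓢(ℝ, ℝ)), ((sX ^ l : 𝓢(ℝ, ℝ) →L[ℝ] 𝓢(ℝ, ℝ)) f) x = x ^ l * f x :=
    fun l f => sX_pow_apply f l x
  rcases l with _ | l <;>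
  simp only [interiorOp, shiftCoeff, add_apply, neg_apply, smul_apply, mul_apply_eq_comp, h,
    smul_eq_mul, if_true, zero_apply, Nat.add_sub_cancel, Nat.succ_ne_zero, if_false] <;>
  ring

/-- The coefficients of the exterior operator. -/
theorem exists_exteriorOp (γ : ℝ) : ∃ B : ℕ → 𝓢(ℝ, ℝ) →L[ℝ] 𝓢(ℝ, ℝ), ∀ l f x,
    B l f x = -(oneCoeff l x * sD (sD f) x)
      - shiftCoeff (shiftCoeff (divCoeff oneCoeff)) l x * sD f x
      + divCoeff (divCoeff oneCoeff) l x * f x - γ * (oneCoeff l x * f x) := by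
  choose P hP using actsOnSchwartz_one.div.shift.shift
  choose Q hQ using actsOnSchwartz_one.div.div
  choose O hO using actsOnSchwartz_one
  refine ⟨fun l => -(O l * sD * sD) - P l * sD + Q l - γ • O l, fun l f x => ?_⟩
  simp [hP, hQ, hO]

/-- The formal expansions of the profiles and of the energy of a quasi-mode. -/
structure FormalSolution (n : ℝ → ℝ) (p : ℤ) (R : ℝ) (j : ℕ) (m b θ : ℕ → ℝ)
    (g ψ : ℕ → 𝓢(ℝ, ℝ)) (E : ℕ → ℝ) : Prop where
  interior : ∀ k, ∀ x > -1, -conv (fun k x => m k * x ^ k) (fun k => sD (sD (g k))) k x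
    + conv (shiftCoeff fun k x => b k * x ^ k) (fun k => sD (g k)) k x
    + conv (fun k x => θ (k + 2) * x ^ (k + 2)) (fun k => g k) k x
    - conv (fun k _ => E k) (fun k => g k) k x = 0
  exterior : ∀ k, ∀ x > -1, -conv oneCoeff (fun k => sD (sD (ψ k))) k x
    - conv (shiftCoeff (shiftCoeff (divCoeff oneCoeff))) (fun k => sD (ψ k)) k x
    + conv (divCoeff (divCoeff oneCoeff)) (fun k => ψ k) k x
    - (nCoeff n R 0 ^ 2)⁻¹ * (conv oneCoeff (fun k => ψ k) k x
      + conv (fun k _ => shiftTwo E k) (fun k => ψ k) k x) = 0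
  dirichlet : ∀ k, g k 0 = ψ k 0
  neumann : ∀ k, sD (ψ k) 0
    = if k = 0 then 0 else -(nCoeff n R 0 ^ (p - 1)) * sD (g (k - 1)) 0
  leading_interior : ∀ x > -1,
    g 0 x = gaussHermite (2 * j + 1) (-(effHessian n R ^ (1 / 4 : ℝ) * x))
  leading_exterior : ψ 0 = 0
  leading_energy : E 0 = (4 * j + 3) * Real.sqrt (effHessian n R)
  second_interior : ∀ x > -1, -sD (sD (g 1)) x
      + (effHessian n R * x ^ 2 - (4 * j + 3) * Real.sqrt (effHessian n R)) * g 1 x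
    = E 1 * g 0 x - (2 * x * sD (sD (g 0)) x + (2 - p) * sD (g 0) x
      + (2 - effHessian n R + R ^ 3 * nCoeff n R 3 / (3 * nCoeff n R 0)) * x ^ 3 * g 0 x)
  second_boundary : g 1 0 = exteriorAmplitude n p R j
  second_orthogonal : ∫ x in Ioi (0 : ℝ), (g 1 x - exteriorAmplitude n p R j / gaussHermite 0 0
    * gaussHermite 0 (-(effHessian n R ^ (1 / 4 : ℝ) * x))) * g 0 x = 0
  second_exterior : ∀ x, 0 ≤ x → ψ 1 x = exteriorAmplitude n p R j
    * Real.exp (-(Real.sqrt (nCoeff n R 0 ^ 2 - 1) / nCoeff n R 0) * x)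
  second_energy : E 1 = 2 * effHessian n R ^ (3 / 4 : ℝ) * thirdCoeff n p R j

/-- With c = μ^{1/4}, all fractional powers become integer powers of c and the final identities are
rational. -/
theorem rpow_quarter_identities {μ : ℝ} (hμ : 0 < μ) :
    0 < μ ^ (1 / 4 : ℝ) ∧ (μ ^ (1 / 4 : ℝ)) ^ 4 = μ ∧ Real.sqrt μ = (μ ^ (1 / 4 : ℝ)) ^ 2 ∧
      μ ^ (3 / 4 : ℝ) = (μ ^ (1 / 4 : ℝ)) ^ 3 ∧ μ ^ (3 / 2 : ℝ) = (μ ^ (1 / 4 : ℝ)) ^ 6 := by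
  refine ⟨Real.rpow_pos_of_pos hμ _, ?_, ?_, ?_, ?_⟩
  all_goals
    first
    | rw [Real.sqrt_eq_rpow, ← Real.rpow_natCast, ← Real.rpow_mul hμ.le]
    | rw [← Real.rpow_natCast, ← Real.rpow_mul hμ.le]
    norm_num

/-- The hierarchy is started from level 2j + 1 of the oscillator of frequency √μ = c², whose
eigenfunction vanishes at 0. -/
theorem exists_formalSolution {n : ℝ → ℝ} {R : ℝ} (hR : 0 < R) (hn : IsOpticalIndex n R)
    (hμ : 0 < effHessian n R) (p : ℤ) (j : ℕ) {m b θ : ℕ → ℝ} (m0 : m 0 = 1) (m1 : m 1 = -2)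
    (b0 : b 0 = 2 - p) (θ2 : θ 2 = effHessian n R)
    (θ3 : θ 3 = 2 - effHessian n R + R ^ 3 * nCoeff n R 3 / (3 * nCoeff n R 0)) :
    ∃ g ψ E, FormalSolution n p R j m b θ g ψ E := by
  obtain ⟨hc, hc4, hc2, hc3, hc6⟩ := rpow_quarter_identities hμ
  have hn0 : 1 < nCoeff n R 0 := by rw [nCoeff_zero]; exact hn.R_pos hR
  set ν := nCoeff n R 0 with hν
  set μ := effHessian n R with hμdef
  set c := μ ^ (1 / 4 : ℝ) with hcdef
  set G := deriv (gaussHermite (2 * j + 1)) 0 with hG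
  have hGne : G ≠ 0 := deriv_gaussHermite_odd_ne_zero j
  obtain ⟨g₀, hg₀⟩ := exists_schwartz_gaussHermite hc (2 * j + 1)
  obtain ⟨h, hh⟩ := exists_schwartz_gaussHermite hc 0
  have hd1 : ∀ x > -1, sD g₀ x = deriv (gaussHermite (2 * j + 1)) (-(c * x)) * -c :=
    sD_congr hg₀ fun x _ => (hasDerivAt_gaussHermite _ _).comp x (hasDerivAt_reflect c x)
  have hd2 : ∀ x > -1, sD (sD g₀) x = (μ * x ^ 2 - (4 * j + 3) * Real.sqrt μ) * g₀ x := by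
    intro x hx
    have := sD_congr hd1 (fun x _ => ((hasDerivAt_deriv_gaussHermite (2 * j + 1) _).comp x
      (hasDerivAt_reflect c x)).mul_const (-c)) x hx
    rw [this, ← hg₀ x hx, hc2, ← hc4]
    push_cast
    ring
  have hg00 : g₀ 0 = 0 := by
    rw [hg₀ 0 (by norm_num)]; simp [gaussHermite_odd_zero]
  have hg0d : sD g₀ 0 = -(c * G) := by
    rw [hd1 0 (by norm_num)]; simp [hG]; ring
  have hA0 : ∀ (u : 𝓢(ℝ, ℝ)) (x : ℝ), interiorOp m b θ 0 u x - (4 * j + 3) * Real.sqrt μ * u x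
      = -sD (sD u) x + (μ * x ^ 2 - (4 * j + 3) * Real.sqrt μ) * u x := fun u x => by
    rw [interiorOp_apply]
    simp only [m0, zero_add, θ2, shiftCoeff]
    ring
  have hnint : ∫ x in Ioi (0 : ℝ), g₀ x * g₀ x = 1 / (2 * c) := by
    rw [setIntegral_congr_Ioi (fun x hx => by rw [hg₀ x (by linarith)]),
      integral_gaussHermite_sq hc]
  have hs : 0 < ν ^ 2 - 1 := by nlinarith
  set s := Real.sqrt (ν ^ 2 - 1) with hsdef
  have hs0 : 0 < s := Real.sqrt_pos.2 hs
  have hs2 : s ^ 2 = ν ^ 2 - 1 := Real.sq_sqrt hs.le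
  have hα : 0 < s / ν := by positivity
  -- The leading exterior operator is -d²/dρ² + 1 - ν⁻², so s/ν is the decay rate of the exterior
  -- profiles.
  have hα2 : (s / ν) ^ 2 = 1 - (ν ^ 2)⁻¹ := by rw [div_pow, hs2]; field_simp
  obtain ⟨B, hB⟩ := exists_exteriorOp (ν ^ 2)⁻¹
  have hB0 : ∀ (u : 𝓢(ℝ, ℝ)) (x : ℝ), B 0 u x = -sD (sD u) x + (s / ν) ^ 2 * u x := fun u x => by
    rw [hB, hα2]
    simp only [oneCoeff, shiftCoeff, divCoeff, if_true]
    ring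
  obtain ⟨g, ψ, E, hg0, hψ0, hE0, heq, horth⟩ := exists_profiles (interiorOp m b θ) B (ν ^ 2)⁻¹
    (ν ^ (p - 1)) ((4 * j + 3) * Real.sqrt μ) g₀
    ((exteriorAmplitude n p R j / gaussHermite 0 0) • h)
    (fun x hx => by rw [hA0, hd2 x hx]; ring) hg00
    (fun F => by
      obtain ⟨u, hu⟩ := exists_solution_oscillator (b := c ^ 2) (by positivity) (2 * j + 1) F
      refine ⟨u, fun x hx => ?_⟩
      rw [hA0, ← hu x hx, hc2, ← hc4]
      push_cast
      ring)
    (fun F d => by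
      obtain ⟨u, hu, hu0⟩ := exists_solution_exponential hα F d
      exact ⟨u, fun x hx => by rw [hB0, hu x hx], hu0⟩)
    -- A response to g₀ vanishing at 0 would give ∫g₀² = 0 by Green's formula.
    (fun u hu hu0 => by
      have := green_oscillator hd2 hg00 (u := u) (F := g₀) fun x hx => by rw [← hA0, hu x hx]
      rw [hnint, hu0] at this
      have h2 : 0 < 1 / (2 * c) := by positivity
      simp at this
      exact hc.ne' this)
    (by rw [hnint]; positivity)
  have hint1 : ∀ x > -1, -sD (sD (g 1)) x + (μ * x ^ 2 - (4 * j + 3) * Real.sqrt μ) * g 1 x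
      = E 1 * g 0 x - (2 * x * sD (sD (g 0)) x + (2 - p) * sD (g 0) x
        + (2 - μ + R ^ 3 * nCoeff n R 3 / (3 * ν)) * x ^ 3 * g 0 x) := fun x hx => by
    have h1 := (heq 1).interior x hx
    simp only [Finset.sum_range_succ, Finset.sum_range_zero, zero_add, Nat.sub_zero, Nat.sub_self,
      hE0, interiorOp_apply, m0, m1, θ2, θ3, shiftCoeff, b0] at h1
    linear_combination h1
  have hψ1d : sD (ψ 1) 0 = ν ^ (p - 1) * (c * G) := by
    rw [(heq 1).neumann]; simp [hg0, hg0d]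
  have hAmp : -(sD (ψ 1) 0 / (s / ν)) = exteriorAmplitude n p R j := by
    rw [hψ1d, exteriorAmplitude, ← hν, ← hμdef, ← hcdef, ← hG, ← hsdef, zpow_sub_one₀ (by positivity)]
    field_simp
  have hψ1 : ∀ x, 0 ≤ x → ψ 1 x = exteriorAmplitude n p R j * Real.exp (-(s / ν) * x) := by
    rw [← hAmp]
    refine exterior_unique hα fun x hx => ?_
    have h1 := (heq 1).exterior x hx
    simpa [Finset.sum_range_succ, hψ0, shiftTwo, hB0] using h1
  have hb1 : g 1 0 = exteriorAmplitude n p R j := by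
    rw [(heq 1).dirichlet, hψ1 0 le_rfl]; simp
  refine ⟨g, ψ, E, ?_, ?_, fun k => (heq k).dirichlet, fun k => (heq k).neumann, ?_, hψ0, hE0,
    hint1, hb1, ?_, hψ1, ?_⟩
  · intro k x hx
    rw [← (heq k).interior x hx]
    simp only [conv, interiorOp_apply, Finset.sum_add_distrib, Finset.sum_neg_distrib]
  · intro k x hx
    rw [← (heq k).exterior x hx]
    simp only [conv, hB, Finset.sum_add_distrib, Finset.sum_neg_distrib, Finset.sum_sub_distrib,
      ← Finset.mul_sum]
    ring
  · rw [hg0]; exact hg₀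
  · have := horth 1 one_pos
    refine Eq.trans ?_ this
    rw [hg0]
    refine setIntegral_congr_Ioi fun x hx => ?_
    rw [smul_apply, hh x (by linarith), smul_eq_mul]
  · have h1 := second_energy hμ.ne' hd2 hg00 (u := g 1) (e₁ := E 1) (by rw [← hg0]; exact hint1)
    rw [hnint, hg0d, hb1, exteriorAmplitude, ← hν, ← hμdef, ← hcdef, ← hG, ← hsdef] at h1
    rw [thirdCoeff, ← hν, ← hμdef, ← hG, ← hsdef, hc6, hc3]
    -- The factor 1/(2c) is ∫g₀², which brings E 1 into the form of the solvability condition.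
    have h2 : E 1 = 2 * c * (E 1 * (1 / (2 * c))) := by field_simp
    rw [h2, h1, hc2, ← hc4]
    field_simp
    ring

/-! ### Profile functions -/

/-- `F` is a smooth function with the expansion `F (t, x) ∼ ∑ t^k φ_k(x)`, which may be
differentiated in `x`. -/
structure IsProfile (F : ℝ × ℝ → ℝ) (φ : ℕ → 𝓢(ℝ, ℝ)) : Prop where
  smooth : ContDiff ℝ ∞ F
  decay : ∀ a d : ℕ, ∃ C, ∀ t ∈ Icc (0 : ℝ) 1, ∀ x,
    |x| ^ a * ‖iteratedFDeriv ℝ d F (t, x)‖ ≤ C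
  expansion : ∀ i N a : ℕ, ∃ C, ∀ t ∈ Icc (0 : ℝ) 1, ∀ x : ℝ,
    |x| ^ a * |iteratedDeriv i (fun x => F (t, x)) x
      - ∑ k ∈ Finset.range N, t ^ k * (sD ^ i) (φ k) x| ≤ C * t ^ N

theorem iteratedDeriv_borelSum {φ : ℕ → 𝓢(ℝ, ℝ)} {δ : ℝ} {ε : ℕ → ℝ} (hε : BorelScale φ δ ε)
    {t : ℝ} (ht : t ∈ Icc (0 : ℝ) 1) (i : ℕ) :
    iteratedDeriv i (fun x => borelSum φ ε 0 (t, x)) = fun x => borelSum φ ε i (t, x) := by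
  induction i with
  | zero => simp
  | succ i ih =>
    rw [iteratedDeriv_succ, ih]
    exact funext fun x => (borelSum_hasDerivAt hε i ht x).deriv

theorem isProfile_borelSum {φ : ℕ → 𝓢(ℝ, ℝ)} {δ : ℝ} {ε : ℕ → ℝ} (hε : BorelScale φ δ ε) :
    IsProfile (borelSum φ ε 0) φ where
  smooth := contDiff_borelSum hε
  decay a d := (borelSum_decay hε a d).imp fun _ hC t _ x => hC (t, x)
  expansion i N a := (borelSum_asymp hε i N a).imp fun _ hC t ht x => by
    rw [iteratedDeriv_borelSum hε ht]; exact hC t ht x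

theorem iteratedDeriv_schwartz (f : 𝓢(ℝ, ℝ)) (i : ℕ) :
    iteratedDeriv i f = (sD ^ i) f := by
  induction i with
  | zero => simp
  | succ i ih =>
    rw [iteratedDeriv_succ, ih, pow_succ', mul_apply_eq_comp]
    rfl

theorem contDiff_slice {F : ℝ × ℝ → ℝ} (hF : ContDiff ℝ ∞ F) (t : ℝ) :
    ContDiff ℝ ∞ (fun x => F (t, x)) :=
  hF.comp (contDiff_const.prodMk contDiff_id)

theorem exists_tensor_bound {c : ℝ → ℝ} (hc : ContDiff ℝ ∞ c) (e : 𝓢(ℝ, ℝ)) (a d : ℕ) :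
    ∃ C, ∀ t ∈ Icc (0 : ℝ) 1, ∀ x : ℝ,
      |x| ^ a * ‖iteratedFDeriv ℝ d (fun z : ℝ × ℝ => c z.1 * e z.2) (t, x)‖ ≤ C := by
  have h1 : ∀ i, ∃ C, ∀ t ∈ Icc (0 : ℝ) 1, |iteratedDeriv i c t| ≤ C := fun i => by
    obtain ⟨C, hC⟩ := isCompact_Icc.exists_bound_of_continuousOn
      (f := iteratedDeriv i c) (s := Icc (0 : ℝ) 1)
      (hc.continuous_iteratedDeriv i (by exact_mod_cast le_top)).continuousOn
    exact ⟨C, hC⟩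
  choose C hC using h1
  choose C' hC' using fun i => schwartz_decay_iteratedDeriv e a i
  refine ⟨∑ i ∈ Finset.range (d + 1), d.choose i * (C i * C' (d - i)), fun t ht x => ?_⟩
  have h2 := norm_iteratedFDeriv_tensor_le hc (e.smooth ⊤) d (t, x)
  refine (mul_le_mul_of_nonneg_left h2 (by positivity)).trans ?_
  rw [Finset.mul_sum]
  refine Finset.sum_le_sum fun i _ => ?_
  have h3 := hC i t ht
  have h4 := hC' (d - i) x
  calc _ = d.choose i * (|iteratedDeriv i c t| * (|x| ^ a * |iteratedDeriv (d - i) e x|)) := by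
        ring
    _ ≤ _ := by gcongr; exact (abs_nonneg _).trans h3

/-- `c (t) = O (t^∞)` on `[0, 1]`. -/
def IsFlat (c : ℝ → ℝ) : Prop := ∀ N : ℕ, ∃ C, ∀ t ∈ Icc (0 : ℝ) 1, |c t| ≤ C * t ^ N

/-- A flat factor is invisible to the expansion at every order, which leaves room to repair boundary
values exactly. -/
theorem IsProfile.add_flat {F : ℝ × ℝ → ℝ} {φ : ℕ → 𝓢(ℝ, ℝ)} (hF : IsProfile F φ) {c : ℝ → ℝ}
    (hc : ContDiff ℝ ∞ c) (hc0 : IsFlat c) (e : 𝓢(ℝ, ℝ)) :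
    IsProfile (fun z => F z + c z.1 * e z.2) φ where
  smooth := hF.smooth.add ((hc.comp contDiff_fst).mul ((e.smooth ⊤).comp contDiff_snd))
  decay a d := by
    obtain ⟨C, hC⟩ := hF.decay a d
    obtain ⟨C', hC'⟩ := exists_tensor_bound hc e a d
    refine ⟨C + C', fun t ht x => ?_⟩
    have hT : ContDiff ℝ ∞ (fun z : ℝ × ℝ => c z.1 * e z.2) :=
      (hc.comp contDiff_fst).mul ((e.smooth ⊤).comp contDiff_snd)
    have e1 : iteratedFDeriv ℝ d (fun z : ℝ × ℝ => F z + c z.1 * e z.2) (t, x)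
        = iteratedFDeriv ℝ d F (t, x)
          + iteratedFDeriv ℝ d (fun z : ℝ × ℝ => c z.1 * e z.2) (t, x) :=
      iteratedFDeriv_add_apply (hF.smooth.of_le (by exact_mod_cast le_top)).contDiffAt
        (hT.of_le (by exact_mod_cast le_top)).contDiffAt
    rw [e1]
    refine (mul_le_mul_of_nonneg_left (norm_add_le _ _) (by positivity)).trans ?_
    rw [mul_add]
    exact add_le_add (hC t ht x) (hC' t ht x)
  expansion i N a := by
    obtain ⟨C, hC⟩ := hF.expansion i N a
    obtain ⟨C', hC'⟩ := hc0 N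
    obtain ⟨M, hM0, hM⟩ := schwartz_bound ((sD ^ i) e) a
    refine ⟨C + C' * M, fun t ht x => ?_⟩
    have e1 : iteratedDeriv i (fun x => F (t, x) + c t * e x) x
        = iteratedDeriv i (fun x => F (t, x)) x + c t * (sD ^ i) e x := by
      rw [iteratedDeriv_fun_add
        ((contDiff_slice hF.smooth t).of_le (by exact_mod_cast le_top)).contDiffAt
        ((contDiff_const.mul (e.smooth ⊤)).of_le (by exact_mod_cast le_top)).contDiffAt,
        iteratedDeriv_const_mul_field, iteratedDeriv_schwartz]
    simp only [e1]
    have h1 := hC t ht x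
    have h2 := hC' t ht
    have h3 := hM x
    calc _ ≤ |x| ^ a * (|iteratedDeriv i (fun x => F (t, x)) x
          - ∑ k ∈ Finset.range N, t ^ k * (sD ^ i) (φ k) x| + |c t| * |(sD ^ i) e x|) := by
          gcongr
          rw [← abs_mul, add_sub_right_comm]
          exact abs_add_le _ _
      _ = |x| ^ a * |iteratedDeriv i (fun x => F (t, x)) x
          - ∑ k ∈ Finset.range N, t ^ k * (sD ^ i) (φ k) x|
          + |c t| * (|x| ^ a * |(sD ^ i) e x|) := by ring
      _ ≤ C * t ^ N + C' * t ^ N * M := by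
          gcongr
          exact (abs_nonneg _).trans h2
      _ = _ := by ring

theorem contDiff_deriv_slice {F : ℝ × ℝ → ℝ} (hF : ContDiff ℝ ∞ F) (x : ℝ) :
    ContDiff ℝ ∞ (fun t => deriv (fun x => F (t, x)) x) := by
  have e : (fun t => deriv (fun x => F (t, x)) x) = fun t => fderiv ℝ F (t, x) (0, 1) := by
    ext t
    have h1 : HasDerivAt (fun x : ℝ => (t, x)) ((0 : ℝ), (1 : ℝ)) x :=
      (hasDerivAt_const x t).prodMk (hasDerivAt_id x)
    exact ((hF.differentiable (by simp)).differentiableAt.hasFDerivAt.comp_hasDerivAt x h1).deriv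
  rw [e]
  exact ((hF.fderiv_right (m := ∞) (by simp)).comp (contDiff_id.prodMk contDiff_const)).clm_apply
    contDiff_const

theorem exists_schwartz_jet : ∃ e₀ e₁ : 𝓢(ℝ, ℝ),
    e₀ 0 = 1 ∧ sD e₀ 0 = 0 ∧ e₁ 0 = 0 ∧ sD e₁ 0 = 1 := by
  obtain ⟨e, he⟩ := exists_schwartz_gaussian one_pos
  have h0 : e 0 = 1 := by rw [he 0 (by norm_num)]; simp
  refine ⟨e, sX e, h0, ?_, by simp [sX_apply], by rw [sD_sX, h0]; simp⟩
  have hd : ∀ x > -1, HasDerivAt (fun x : ℝ => Real.exp (-(1 * x) ^ 2 / 2))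
      (Real.exp (-(1 * x) ^ 2 / 2) * -x) x := fun x _ => by
    have h1 : HasDerivAt (fun x : ℝ => -(1 * x) ^ 2 / 2) (-x) x := by
      have := ((((hasDerivAt_id x).const_mul 1).pow 2).neg).div_const 2
      convert! this using 1
      simp
      ring
    exact h1.exp
  rw [sD_congr he hd 0 (by norm_num)]
  simp

/-- Correction of the boundary values of a profile by flat terms. -/
theorem IsProfile.exists_transmission {G Ψ : ℝ × ℝ → ℝ} {g ψ : ℕ → 𝓢(ℝ, ℝ)} (hG : IsProfile G g)
    (hΨ : IsProfile Ψ ψ) {β : ℝ} (h0 : ∀ k, g k 0 = ψ k 0)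
    (h1 : ∀ k, sD (ψ k) 0 = if k = 0 then 0 else -β * sD (g (k - 1)) 0) :
    ∃ Ψ', IsProfile Ψ' ψ ∧ (∀ t, G (t, 0) = Ψ' (t, 0)) ∧
      ∀ t, deriv (fun x => Ψ' (t, x)) 0 = -β * (t * deriv (fun x => G (t, x)) 0) := by
  obtain ⟨e₀, e₁, h00, h01, h10, h11⟩ := exists_schwartz_jet
  set c₀ : ℝ → ℝ := fun t => G (t, 0) - Ψ (t, 0) with hc₀
  set c₁ : ℝ → ℝ := fun t => -β * (t * deriv (fun x => G (t, x)) 0)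
    - deriv (fun x => Ψ (t, x)) 0 with hc₁
  have hc₀s : ContDiff ℝ ∞ c₀ :=
    (hG.smooth.comp (contDiff_id.prodMk contDiff_const)).sub
      (hΨ.smooth.comp (contDiff_id.prodMk contDiff_const))
  have hc₁s : ContDiff ℝ ∞ c₁ :=
    (contDiff_const.mul (contDiff_id.mul (contDiff_deriv_slice hG.smooth 0))).sub
      (contDiff_deriv_slice hΨ.smooth 0)
  have hf₀ : IsFlat c₀ := fun N => by
    obtain ⟨C, hC⟩ := hG.expansion 0 N 0
    obtain ⟨C', hC'⟩ := hΨ.expansion 0 N 0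
    refine ⟨C + C', fun t ht => ?_⟩
    have a1 := hC t ht 0
    have a2 := hC' t ht 0
    simp only [pow_zero, one_mul, iteratedDeriv_zero, one_apply_eq_self, ← h0] at a1 a2
    rw [add_mul, hc₀]
    calc |G (t, 0) - Ψ (t, 0)| = |(G (t, 0) - ∑ k ∈ Finset.range N, t ^ k * g k 0)
          - (Ψ (t, 0) - ∑ k ∈ Finset.range N, t ^ k * g k 0)| := by ring_nf
      _ ≤ _ := (abs_sub _ _).trans (add_le_add a1 a2)
  have hf₁ : IsFlat c₁ := fun N => by
    obtain ⟨C, hC⟩ := hG.expansion 1 N 0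
    -- One term more than for G, because the factor t in the Neumann relation shifts the index by
    -- one.
    obtain ⟨C', hC'⟩ := hΨ.expansion 1 (N + 1) 0
    refine ⟨|β| * |C| + |C'|, fun t ht => ?_⟩
    have a1 := hC t ht 0
    have a2 := hC' t ht 0
    rw [Finset.sum_range_succ'] at a2
    simp only [pow_zero, one_mul, iteratedDeriv_one, pow_one, h1, Nat.succ_ne_zero, if_false,
      if_true, add_zero, Nat.add_sub_cancel] at a1 a2
    set S := ∑ k ∈ Finset.range N, t ^ k * sD (g k) 0 with hS
    have e : ∑ k ∈ Finset.range N, t ^ (k + 1) * (-β * sD (g k) 0) = -β * (t * S) := by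
      rw [hS, Finset.mul_sum, Finset.mul_sum]
      exact Finset.sum_congr rfl fun k _ => by ring
    rw [e] at a2
    rw [hc₁]
    calc _ = |-β * (t * (deriv (fun x => G (t, x)) 0 - S))
          - (deriv (fun x => Ψ (t, x)) 0 - -β * (t * S))| := by ring_nf
      _ ≤ |-β * (t * (deriv (fun x => G (t, x)) 0 - S))|
          + |deriv (fun x => Ψ (t, x)) 0 - -β * (t * S)| := abs_sub _ _
      _ ≤ |β| * (1 * (|C| * t ^ N)) + |C'| * t ^ N := by
          refine add_le_add ?_ ?_
          · rw [abs_mul, abs_neg, abs_mul, abs_of_nonneg ht.1]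
            have h3 := ht.1
            gcongr
            · exact ht.2
            · exact a1.trans (mul_le_mul_of_nonneg_right (le_abs_self _) (pow_nonneg ht.1 _))
          · refine a2.trans ?_
            rw [pow_succ]
            have h3 : t ^ N * t ≤ t ^ N := mul_le_of_le_one_right (pow_nonneg ht.1 _) ht.2
            exact mul_le_mul (le_abs_self _) h3 (mul_nonneg (pow_nonneg ht.1 _) ht.1)
              (abs_nonneg _)
      _ = _ := by ring
  -- The jets (1, 0) and (0, 1) of e₀ and e₁ at 0 correct the value and the slope independently.
  refine ⟨_, (hΨ.add_flat hc₀s hf₀ e₀).add_flat hc₁s hf₁ e₁, fun t => ?_, fun t => ?_⟩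
  · simp [h00, h10, hc₀]
  · have d1 : HasDerivAt (fun x => Ψ (t, x)) (deriv (fun x => Ψ (t, x)) 0) 0 :=
      ((contDiff_slice hΨ.smooth t).differentiable (by simp)).differentiableAt.hasDerivAt
    have := ((d1.add ((hasDerivAt_sD e₀ 0).const_mul (c₀ t))).add
      ((hasDerivAt_sD e₁ 0).const_mul (c₁ t))).deriv
    rw [h01, h11] at this
    refine this.trans ?_
    simp [hc₁]

/-- Scalar Borel lemma: tensor the coefficients with a Schwartz function equal to 1 at 0, sum, and
evaluate at 0. -/
theorem exists_smooth_of_coeff (E : ℕ → ℝ) {δ : ℝ} (hδ : 0 < δ) : ∃ e : ℝ → ℝ, ContDiff ℝ ∞ e ∧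
    (∀ N, ∃ C, ∀ t ∈ Icc (0 : ℝ) 1, |e t - ∑ k ∈ Finset.range N, t ^ k * E k| ≤ C * t ^ N) ∧
    ∀ t ∈ Icc (0 : ℝ) 1, |e t - E 0| ≤ δ := by
  obtain ⟨e₀, -, h00, -⟩ := exists_schwartz_jet
  obtain ⟨ε, hε⟩ := exists_borelScale (fun k => E k • e₀) hδ
  refine ⟨fun t => borelSum (fun k => E k • e₀) ε 0 (t, 0),
    (contDiff_borelSum hε).comp (contDiff_id.prodMk contDiff_const), fun N => ?_, fun t ht => ?_⟩
  · obtain ⟨C, hC⟩ := borelSum_asymp hε 0 N 0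
    exact ⟨C, fun t ht => by simpa [h00] using hC t ht 0⟩
  · simpa [h00] using borelSum_sub_zero_le hε ht 0

/-- The exact profiles and energy of the quasi-modes. -/
structure ExactProfiles (n : ℝ → ℝ) (p : ℤ) (R : ℝ) (g ψ : ℕ → 𝓢(ℝ, ℝ)) (E : ℕ → ℝ)
    (G Ψ : ℝ × ℝ → ℝ) (e : ℝ → ℝ) : Prop where
  interior : IsProfile G g
  exterior : IsProfile Ψ ψ
  energy_smooth : ContDiff ℝ ∞ e
  energy : ∀ N, ∃ C, ∀ t ∈ Icc (0 : ℝ) 1,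
    |e t - ∑ k ∈ Finset.range N, t ^ k * E k| ≤ C * t ^ N
  energy_pos : ∀ t ∈ Icc (0 : ℝ) 1, 0 < e t
  dirichlet : ∀ t, G (t, 0) = Ψ (t, 0)
  neumann : ∀ t, deriv (fun x => Ψ (t, x)) 0
    = -(nCoeff n R 0 ^ (p - 1)) * (t * deriv (fun x => G (t, x)) 0)
  lower_bound : ∃ x₁ x₂ δ : ℝ, 0 < x₁ ∧ x₁ < x₂ ∧ x₂ < 1 / 4 ∧ 0 < δ ∧ ∀ t ∈ Icc (0 : ℝ) 1,
    ∀ x ∈ Icc x₁ x₂, δ ≤ |G (t, x)|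

theorem FormalSolution.exists_exactProfiles {n : ℝ → ℝ} {p : ℤ} {R : ℝ} {j : ℕ} {m b θ : ℕ → ℝ}
    {g ψ : ℕ → 𝓢(ℝ, ℝ)} {E : ℕ → ℝ} (hμ : 0 < effHessian n R)
    (hS : FormalSolution n p R j m b θ g ψ E) :
    ∃ G Ψ e, ExactProfiles n p R g ψ E G Ψ e := by
  have hc : 0 < effHessian n R ^ (1 / 4 : ℝ) := Real.rpow_pos_of_pos hμ _
  have hg0 : g 0 0 = 0 := by
    rw [hS.leading_interior 0 (by norm_num)]; simp [gaussHermite_odd_zero]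
  have hgd : sD (g 0) 0 ≠ 0 := by
    rw [sD_congr hS.leading_interior (fun x _ => (hasDerivAt_gaussHermite _ _).comp x
      (hasDerivAt_reflect _ x)) 0 (by norm_num)]
    simp only [mul_zero, neg_zero]
    exact mul_ne_zero (deriv_gaussHermite_odd_ne_zero j) (neg_ne_zero.2 hc.ne')
  -- The leading profile has nonzero slope at 0, hence is nonzero at points as close to 0 as
  -- desired. The bound 1/4 keeps the corresponding radii, for every t ≤ 1, in the region where the
  -- cut-off equals 1.
  obtain ⟨x₀, hx₀, hx₀'⟩ : ∃ x₀ ∈ Ioo (0 : ℝ) (1 / 4), g 0 x₀ ≠ 0 := by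
    have h1 := (hasDerivAt_sD (g 0) 0).eventually_ne (c := 0) hgd
    have h2 : ∀ᶠ x in 𝓝[>] (0 : ℝ), g 0 x ≠ 0 :=
      h1.filter_mono (nhdsWithin_mono _ fun x hx => ne_of_gt hx)
    obtain ⟨x, hx, hx'⟩ := (h2.and (Ioo_mem_nhdsGT (show (0 : ℝ) < 1 / 4 by norm_num))).exists
    exact ⟨x, hx', hx⟩
  -- Near x₀ the leading profile is at least 2δ in modulus, and the Borel sum stays within δ of it
  -- for every t in [0, 1].
  set δ := |g 0 x₀| / 4 with hδ
  have hδ0 : 0 < δ := by positivity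
  obtain ⟨r, hr, hball⟩ : ∃ r > 0, ∀ x ∈ Icc (x₀ - r) (x₀ + r),
      x ∈ Ioo (0 : ℝ) (1 / 4) ∧ 2 * δ ≤ |g 0 x| := by
    have h1 : ∀ᶠ x in 𝓝 x₀, x ∈ Ioo (0 : ℝ) (1 / 4) ∧ 2 * δ ≤ |g 0 x| := by
      refine Filter.Eventually.and (Ioo_mem_nhds hx₀.1 hx₀.2) ?_
      have : Tendsto (fun x => |g 0 x|) (𝓝 x₀) (𝓝 |g 0 x₀|) :=
        ((g 0).continuous.abs).tendsto x₀
      exact this.eventually_const_le (by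
        have : |g 0 x₀| = 4 * δ := by rw [hδ]; ring
        rw [this]; linarith)
    obtain ⟨r, hr, h⟩ := Metric.nhds_basis_closedBall.mem_iff.1 h1
    exact ⟨r, hr, fun x hx => h (by rwa [Real.closedBall_eq_Icc])⟩
  obtain ⟨ε, hε⟩ := exists_borelScale g hδ0
  obtain ⟨ε', hε'⟩ := exists_borelScale ψ one_pos
  have hE0 : 0 < E 0 := by
    rw [hS.leading_energy]
    have := Real.sqrt_pos.2 hμ
    positivity
  obtain ⟨e, he, hea, heb⟩ := exists_smooth_of_coeff E (half_pos hE0)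
  obtain ⟨Ψ, hΨ, hd, hnn⟩ := (isProfile_borelSum hε).exists_transmission
    (isProfile_borelSum hε') hS.dirichlet hS.neumann
  refine ⟨_, Ψ, e, isProfile_borelSum hε, hΨ, he, hea, fun t ht => ?_, hd, hnn,
    x₀ - r, x₀ + r, δ, ?_, by linarith, ?_, hδ0, fun t ht x hx => ?_⟩
  · have := (abs_le.1 (heb t ht)).1
    linarith
  · exact (hball _ ⟨le_rfl, by linarith⟩).1.1
  · exact (hball _ ⟨by linarith, le_rfl⟩).1.2
  · have h1 := borelSum_sub_zero_le hε ht x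
    have h2 := (hball x hx).2
    have h3 := abs_sub_abs_le_abs_sub (g 0 x) (borelSum g ε 0 (t, x))
    rw [abs_sub_comm] at h3
    linarith

/-! ### Residuals of the exact profiles -/

theorem IsProfile.asyS {F : ℝ × ℝ → ℝ} {φ : ℕ → 𝓢(ℝ, ℝ)} (hF : IsProfile F φ) (i : ℕ)
    {D : Set (ℝ × ℝ)} (hD : ∀ t x, (t, x) ∈ D → 0 < t ∧ t ≤ 1 ∧ 0 ≤ x) :
    AsyS D (fun t x => iteratedDeriv i (fun x => F (t, x)) x) (fun k x => (sD ^ i) (φ k) x) :=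
  asyS_of_pow (fun N a => (hF.expansion i N a).imp fun _ hC t ht x _ => hC t ht x) hD

/-- The residual of the interior equation. -/
noncomputable def interiorResidual (n : ℝ → ℝ) (p : ℤ) (R : ℝ) (G : ℝ × ℝ → ℝ) (e : ℝ → ℝ)
    (t x : ℝ) : ℝ :=
  -(coefM n R (t * x) * iteratedDeriv 2 (fun x => G (t, x)) x)
    + t * coefB n p R (t * x) * iteratedDeriv 1 (fun x => G (t, x)) x
    + coefT n R (t * x) / t ^ 2 * G (t, x) - e t * G (t, x)

/-- The residual of the exterior equation. -/
noncomputable def exteriorResidual (n : ℝ → ℝ) (R : ℝ) (Ψ : ℝ × ℝ → ℝ) (e : ℝ → ℝ)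
    (t x : ℝ) : ℝ :=
  -iteratedDeriv 2 (fun x => Ψ (t, x)) x
    - t ^ 2 / (1 + t ^ 2 * x) * iteratedDeriv 1 (fun x => Ψ (t, x)) x
    + 1 / (1 + t ^ 2 * x) ^ 2 * Ψ (t, x)
    - (nCoeff n R 0 ^ 2)⁻¹ * ((1 + t ^ 2 * e t) * Ψ (t, x))

section

variable {n : ℝ → ℝ} {p : ℤ} {R : ℝ} {j : ℕ} {m b θ : ℕ → ℝ} {g ψ : ℕ → 𝓢(ℝ, ℝ)} {E : ℕ → ℝ}
  {G Ψ : ℝ × ℝ → ℝ} {e : ℝ → ℝ}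

/-- The coefficients of the residual are Cauchy products that vanish by `FormalSolution.interior`,
so the remainder alone is left. The restriction tx ≤ 1/2 keeps the coefficient functions within
their Taylor range. -/
theorem interiorResidual_rapid (hS : FormalSolution n p R j m b θ g ψ E)
    (hX : ExactProfiles n p R g ψ E G Ψ e) (hm : HasTaylor (coefM n R) m (1 / 2))
    (hb : HasTaylor (coefB n p R) b (1 / 2)) (hθ : HasTaylor (coefT n R) θ (1 / 2))
    (θ0 : θ 0 = 0) (θ1 : θ 1 = 0) (N : ℕ) :
    ∃ C, ∀ t x, 0 < t → t ≤ 1 → 0 ≤ x → t * x ≤ 1 / 2 →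
      |interiorResidual n p R G e t x| ≤ C * t ^ N := by
  set D : Set (ℝ × ℝ) := {z | (0 < z.1 ∧ z.1 ≤ 1 ∧ 0 ≤ z.2) ∧ z.1 * z.2 ≤ 1 / 2} with hDdef
  have hD : ∀ t x, (t, x) ∈ D → 0 < t ∧ t ≤ 1 ∧ 0 ≤ x := fun t x h => h.1
  have hDr : ∀ t x, (t, x) ∈ D → t * x ≤ 1 / 2 := fun t x h => h.2
  have hD0 : ∀ t x, (t, x) ∈ D → 0 ≤ x := fun t x h => h.1.2.2
  have a1 := ((hm.asy hD hDr).mulS (hX.interior.asyS 2 hD) hD).neg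
  have a2 := ((hb.asy hD hDr).mul_t hD).mulS (hX.interior.asyS 1 hD) hD
  have a3 := (hθ.asy_div_sq θ0 θ1 hD hDr).mulS (hX.interior.asyS 0 hD) hD
  have a4 := ((asy_const hX.energy hD).mulS (hX.interior.asyS 0 hD) hD).neg
  have a := ((a1.add a2 hD0).add a3 hD0).add a4 hD0
  refine (a.rapid (fun t x hx k => ?_) N 0).imp fun C hC t x h1 h2 h3 h4 => ?_
  · have := hS.interior k x (by have := hD0 t x hx; linarith)
    rw [← this, sub_eq_add_neg]
    rfl
  · have := hC t x ⟨⟨h1, h2, h3⟩, h4⟩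
    rw [pow_zero, one_mul] at this
    convert! this using 2

theorem exteriorResidual_rapid (hS : FormalSolution n p R j m b θ g ψ E)
    (hX : ExactProfiles n p R g ψ E G Ψ e) (N : ℕ) :
    ∃ C, ∀ t x, 0 < t → t ≤ 1 → 0 ≤ x → |exteriorResidual n R Ψ e t x| ≤ C * t ^ N := by
  set D : Set (ℝ × ℝ) := {z | 0 < z.1 ∧ z.1 ≤ 1 ∧ 0 ≤ z.2} with hDdef
  have hD : ∀ t x, (t, x) ∈ D → 0 < t ∧ t ≤ 1 ∧ 0 ≤ x := fun t x h => h
  have hD0 : ∀ t x, (t, x) ∈ D → 0 ≤ x := fun t x h => h.2.2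
  set ν := (nCoeff n R 0 ^ 2)⁻¹ with hν
  have h1 := asy_one hD
  have a1 := (h1.mulS (hX.exterior.asyS 2 hD) hD).neg
  have a2 := (((((h1.div hD).mul_t hD).mul_t hD)).mulS (hX.exterior.asyS 1 hD) hD).neg
  have a3 := ((h1.div hD).div hD).mulS (hX.exterior.asyS 0 hD) hD
  have hν' : Asy D (fun _ _ => -ν) (fun k _ => if k = 0 then -ν else 0) := by
    refine asy_const (fun N => ?_) hD (E := fun _ => -ν) (e := fun k => if k = 0 then -ν else 0)
    rcases N with _ | N
    · exact ⟨|ν|, fun t _ => by simp⟩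
    · exact ⟨0, fun t _ => by simp⟩
  have a4 := hν'.mulS ((h1.mulS (hX.exterior.asyS 0 hD) hD).add
    ((((asy_const hX.energy hD).mul_t hD).mul_t hD).mulS (hX.exterior.asyS 0 hD) hD) hD0) hD
  have a := ((a1.add a2 hD0).add a3 hD0).add a4 hD0
  refine (a.rapid (fun t x hx k => ?_) N 0).imp fun C hC t x h1 h2 h3 => ?_
  · have := hS.exterior k x (by have := hD0 t x hx; linarith)
    have hsh : shiftCoeff (shiftCoeff fun k _ => E k) = fun k _ => shiftTwo E k := by
      funext k
      match k with
      | 0 => rfl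
      | 1 => rfl
      | k + 2 => rfl
    have hcv : ∀ c : ℕ → ℝ → ℝ, conv (fun k _ => if k = 0 then -ν else 0) c k x = -ν * c k x := by
      intro c
      rw [conv, Finset.sum_range_succ, Finset.sum_eq_zero fun i hi => ?_]
      · simp
      · rw [Finset.mem_range] at hi
        rw [if_neg (by omega), zero_mul]
    simp only [hcv, hsh]
    rw [← this, ← hν]
    simp only [pow_zero, pow_one, pow_two, mul_apply_eq_comp, one_apply_eq_self]
    ring
  · have := hC t x ⟨h1, h2, h3⟩
    rw [pow_zero, one_mul] at this
    have h4 : 0 < 1 + t ^ 2 * x := by positivity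
    convert! this using 2
    simp only [exteriorResidual, iteratedDeriv_zero, ← hν]
    field_simp
    ring

end

/-! ### Size of the profiles -/

theorem IsProfile.exists_bound {F : ℝ × ℝ → ℝ} {φ : ℕ → 𝓢(ℝ, ℝ)} (hF : IsProfile F φ) (i a : ℕ) :
    ∃ C, 0 ≤ C ∧ ∀ t ∈ Icc (0 : ℝ) 1, ∀ x : ℝ,
      |x| ^ a * |iteratedDeriv i (fun x => F (t, x)) x| ≤ C := by
  obtain ⟨C, hC⟩ := hF.expansion i 0 a
  refine ⟨C, ?_, fun t ht x => by simpa using hC t ht x⟩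
  have := hC 0 (by simp) 0
  simp only [pow_zero, mul_one] at this
  exact le_trans (by positivity) this

/-- Where tx ≥ δ one has 1 ≤ (tx/δ)^N, so decay like x^{-N} is worth t^N. -/
theorem IsProfile.exists_tail_bound {F : ℝ × ℝ → ℝ} {φ : ℕ → 𝓢(ℝ, ℝ)} (hF : IsProfile F φ)
    (i N : ℕ) {δ : ℝ} (hδ : 0 < δ) : ∃ C, 0 ≤ C ∧ ∀ t, 0 < t → t ≤ 1 → ∀ x : ℝ, δ ≤ t * x →
      |iteratedDeriv i (fun x => F (t, x)) x| ≤ C * t ^ N := by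
  obtain ⟨C, hC0, hC⟩ := hF.exists_bound i N
  refine ⟨C / δ ^ N, by positivity, fun t ht ht1 x hx => ?_⟩
  have h1 := hC t ⟨ht.le, ht1⟩ x
  have hx0 : 0 < x := by
    by_contra h
    have : t * x ≤ 0 := mul_nonpos_of_nonneg_of_nonpos ht.le (not_lt.1 h)
    linarith
  rw [abs_of_pos hx0] at h1
  rw [div_mul_eq_mul_div, le_div_iff₀ (by positivity)]
  calc _ ≤ |iteratedDeriv i (fun x => F (t, x)) x| * (t * x) ^ N := by gcongr
    _ = t ^ N * (x ^ N * |iteratedDeriv i (fun x => F (t, x)) x|) := by rw [mul_pow]; ring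
    _ ≤ t ^ N * C := by gcongr
    _ = _ := mul_comm _ _

/-! ### Classical functions and weak derivatives -/

theorem isOpen_cavity (R : ℝ) : IsOpen (cavity R) := isOpen_lt continuous_norm continuous_const

theorem isOpen_exterior (R : ℝ) : IsOpen (exterior R) := isOpen_lt continuous_const continuous_norm

theorem compl_interface (R : ℝ) : (interface R)ᶜ = cavity R ∪ exterior R := by
  ext x
  simp only [interface, cavity, exterior, mem_compl_iff, Set.mem_ofPred_eq, mem_union]
  exact ne_iff_lt_or_gt

theorem isOpen_compl_interface (R : ℝ) : IsOpen (interface R)ᶜ := by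
  rw [compl_interface]; exact (isOpen_cavity R).union (isOpen_exterior R)

theorem volume_interface {R : ℝ} (hR : 0 < R) : volume (interface R) = 0 := by
  have : interface R = Metric.sphere (0 : Plane) R := by ext x; simp [interface]
  rw [this]
  exact Measure.addHaar_sphere_of_ne_zero _ _ hR.ne'

section

variable {U : Set Plane} {φ : Plane → ℝ} {F : Plane → ℂ}

theorem continuous_smul_of_tsupport {f : Plane → ℝ} (hU : IsOpen U) (hf : Continuous f)
    (hs : tsupport f ⊆ U) (hF : ContinuousOn F U) : Continuous fun x => f x • F x := by
  refine continuous_iff_continuousAt.2 fun x => ?_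
  by_cases hx : x ∈ tsupport f
  · exact hf.continuousAt.smul (hF.continuousAt (hU.mem_nhds (hs hx)))
  · have : (fun x => f x • F x) =ᶠ[𝓝 x] fun _ => 0 := by
      filter_upwards [(isClosed_tsupport f).isOpen_compl.mem_nhds hx] with y hy
      rw [image_eq_zero_of_notMem_tsupport hy, zero_smul]
    exact (continuousAt_const (y := (0 : ℂ))).congr this.symm

theorem integrable_smul_of_tsupport {f : Plane → ℝ} (hU : IsOpen U) (hf : Continuous f)
    (hc : HasCompactSupport f) (hs : tsupport f ⊆ U) (hF : ContinuousOn F U) :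
    Integrable fun x => f x • F x :=
  (continuous_smul_of_tsupport hU hf hs hF).integrable_of_hasCompactSupport
    (hc.smul_right (f' := F))

theorem IsTestFunction.continuous_partialDeriv (hφ : IsTestFunction U φ) (i : Fin 2) :
    Continuous (partialDeriv i φ) :=
  (hφ.1.continuous_fderiv (by simp)).clm_apply continuous_const

theorem tsupport_partialDeriv_subset (φ : Plane → ℝ) (i : Fin 2) :
    tsupport (partialDeriv i φ) ⊆ tsupport φ :=
  tsupport_fderiv_apply_subset ℝ _

theorem IsTestFunction.hasCompactSupport_partialDeriv (hφ : IsTestFunction U φ) (i : Fin 2) :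
    HasCompactSupport (partialDeriv i φ) :=
  hφ.2.1.fderiv_apply (𝕜 := ℝ) _

theorem IsTestFunction.integrable_smul (hU : IsOpen U) (hφ : IsTestFunction U φ)
    (hF : ContinuousOn F U) : Integrable fun x => φ x • F x :=
  integrable_smul_of_tsupport hU hφ.1.continuous hφ.2.1 hφ.2.2 hF

theorem IsTestFunction.integrable_partialDeriv_smul (hU : IsOpen U) (hφ : IsTestFunction U φ)
    (hF : ContinuousOn F U) (i : Fin 2) : Integrable fun x => partialDeriv i φ x • F x :=
  integrable_smul_of_tsupport hU (hφ.continuous_partialDeriv i)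
    (hφ.hasCompactSupport_partialDeriv i) ((tsupport_partialDeriv_subset φ i).trans hφ.2.2) hF

/-- The partial derivatives of a complex valued function. -/
noncomputable def pderiv (i : Fin 2) (F : Plane → ℂ) (x : Plane) : ℂ :=
  fderiv ℝ F x (EuclideanSpace.single i (1 : ℝ))

theorem contDiffOn_pderiv (hU : IsOpen U) (hF : ContDiffOn ℝ ∞ F U) (i : Fin 2) :
    ContDiffOn ℝ ∞ (pderiv i F) U :=
  (hF.fderiv_of_isOpen hU (m := ∞) (by simp)).clm_apply contDiffOn_const

theorem contDiff_pderiv (hF : ContDiff ℝ ∞ F) (i : Fin 2) : ContDiff ℝ ∞ (pderiv i F) :=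
  (hF.fderiv_right (m := ∞) (by simp)).clm_apply contDiff_const

theorem HasCompactSupport.pderiv (hF : HasCompactSupport F) (i : Fin 2) :
    HasCompactSupport (pderiv i F) :=
  hF.fderiv_apply (𝕜 := ℝ) _

theorem integral_partialDeriv_smul (hU : IsOpen U) (hF : ContDiffOn ℝ ∞ F U)
    (hφ : IsTestFunction U φ) (i : Fin 2) :
    ∫ x, partialDeriv i φ x • F x = -∫ x, φ x • pderiv i F x := by
  have h := integral_smul_fderiv_eq_neg_fderiv_smul_of_integrable (μ := volume) (f := φ) (g := F)
    (v := EuclideanSpace.single i (1 : ℝ))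
    (hφ.integrable_partialDeriv_smul hU hF.continuousOn i)
    (hφ.integrable_smul hU (contDiffOn_pderiv hU hF i).continuousOn)
    (hφ.integrable_smul hU hF.continuousOn)
    (fun x _ => (hφ.1.differentiable (by simp)).differentiableAt)
    (fun x hx => (hF.contDiffAt (hU.mem_nhds (hφ.2.2 hx))).differentiableAt (by simp))
  rw [eq_comm, neg_eq_iff_eq_neg]
  exact h

theorem hasWeakGradient_of_contDiffOn (hU : IsOpen U) (hF : ContDiffOn ℝ ∞ F U) :
    HasWeakGradient U F fun i => pderiv i F where
  loc := hF.continuousOn.locallyIntegrableOn hU.measurableSet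
  loc_grad i := (contDiffOn_pderiv hU hF i).continuousOn.locallyIntegrableOn hU.measurableSet
  parts i _ hφ := integral_partialDeriv_smul hU hF hφ i

theorem pderiv_congr {F' : Plane → ℂ} (hU : IsOpen U) (h : EqOn F F' U) (i : Fin 2) :
    EqOn (pderiv i F) (pderiv i F') U := fun x hx => by
  rw [pderiv, pderiv, (h.eventuallyEq_of_mem (hU.mem_nhds hx)).fderiv_eq]

theorem memLp_restrict_of_eqOn {v : Plane → ℂ} (hU : IsOpen U) (h : EqOn F v U)
    (hv : Continuous v) (hc : HasCompactSupport v) : MemLp F 2 (volume.restrict U) := by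
  refine (memLp_congr_ae ?_).2 ((hv.memLp_of_hasCompactSupport hc (p := 2)
    (μ := volume)).restrict U)
  exact (ae_restrict_iff' hU.measurableSet).2 (ae_of_all _ fun x hx => h hx)

theorem memH1_of_eqOn {v : Plane → ℂ} (hU : IsOpen U) (h : EqOn F v U)
    (hv : ContDiff ℝ ∞ v) (hc : HasCompactSupport v) : MemH1 U F :=
  ⟨memLp_restrict_of_eqOn hU h hv.continuous hc, fun i => pderiv i F,
    hasWeakGradient_of_contDiffOn hU (hv.contDiffOn.congr h), fun i =>
    memLp_restrict_of_eqOn hU (pderiv_congr hU h i) (contDiff_pderiv hv i).continuous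
      (HasCompactSupport.pderiv hc i)⟩

theorem memH2_of_eqOn {v : Plane → ℂ} (hU : IsOpen U) (h : EqOn F v U)
    (hv : ContDiff ℝ ∞ v) (hc : HasCompactSupport v) : MemH2 U F :=
  ⟨memLp_restrict_of_eqOn hU h hv.continuous hc, fun i => pderiv i F,
    hasWeakGradient_of_contDiffOn hU (hv.contDiffOn.congr h), fun i =>
    memH1_of_eqOn hU (pderiv_congr hU h i) (contDiff_pderiv hv i)
      (HasCompactSupport.pderiv hc i)⟩

end

/-! ### Traces -/

theorem continuous_polarPoint : Continuous fun z : ℝ × ℝ => polarPoint z.1 z.2 := by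
  refine (PiLp.continuous_toLp 2 _).comp (continuous_pi fun i => ?_)
  fin_cases i
  · exact continuous_fst.mul (Real.continuous_cos.comp continuous_snd)
  · exact continuous_fst.mul (Real.continuous_sin.comp continuous_snd)

theorem norm_polarPoint {r : ℝ} (hr : 0 ≤ r) (θ : ℝ) : ‖polarPoint r θ‖ = r := by
  rw [EuclideanSpace.norm_eq]
  simp only [polarPoint, Fin.sum_univ_two, Real.norm_eq_abs, sq_abs]
  simp only [Matrix.cons_val_zero, Matrix.cons_val_one]
  rw [show (r * Real.cos θ) ^ 2 + (r * Real.sin θ) ^ 2 = r ^ 2 by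
    linear_combination r ^ 2 * Real.cos_sq_add_sin_sq θ]
  exact Real.sqrt_sq hr

/-- Uniform continuity on a compact annulus gives uniform, hence L², convergence on circles, without
discarding any radii near R in l. Continuity at the origin is not needed, since the flux is singular
there. -/
theorem hasTrace_of_continuousOn {R : ℝ} (hR : 0 < R) {l : Filter ℝ} (hl : l ≤ 𝓝 R)
    {v W : Plane → ℂ} (hW : ContinuousOn W {0}ᶜ)
    (hv : ∀ᶠ r in l, ∀ θ, v (polarPoint r θ) = W (polarPoint r θ)) :
    HasTrace l v fun θ => W (polarPoint R θ) := by
  have hc : ContinuousOn (fun z : ℝ × ℝ => W (polarPoint z.1 z.2)) (Ioi 0 ×ˢ univ) := by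
    refine hW.comp continuous_polarPoint.continuousOn fun z hz => ?_
    have := norm_polarPoint (mem_Ioi.1 hz.1).le z.2
    rw [mem_compl_iff, mem_singleton_iff, ← norm_eq_zero, this]
    exact (mem_Ioi.1 hz.1).ne'
  set I : Set ℝ := Icc 0 (2 * Real.pi) with hI
  have hg : Continuous fun θ => W (polarPoint R θ) :=
    continuousOn_univ.1 (hc.comp (continuous_const.prodMk continuous_id).continuousOn
      fun θ _ => ⟨hR, mem_univ _⟩)
  have hfin : IsFiniteMeasure (volume.restrict (Ioc 0 (2 * Real.pi))) :=
    ⟨by rw [Measure.restrict_apply_univ]; exact measure_Ioc_lt_top⟩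
  refine ⟨?_, ?_⟩
  · obtain ⟨C, hC⟩ := isCompact_Icc.exists_bound_of_continuousOn (s := I) hg.continuousOn
    refine MemLp.of_bound hg.aestronglyMeasurable C ?_
    exact (ae_restrict_iff' measurableSet_Ioc).2 (ae_of_all _ fun θ hθ => hC θ (Ioc_subset_Icc_self hθ))
  · refine Tendsto.mono_left ?_ inf_le_left
    have hu : TendstoUniformlyOn (fun r θ => W (polarPoint r θ)) (fun θ => W (polarPoint R θ))
        (𝓝 R) I := by
      have h1 : ContinuousOn (Function.uncurry fun r θ => W (polarPoint r θ))
          (Icc (R / 2) (2 * R) ×ˢ I) :=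
        hc.mono (prod_mono (fun r hr => (by linarith [hr.1] : (0 : ℝ) < r)) (subset_univ _))
      have h2 := UniformContinuousOn.tendstoUniformlyOn (F := fun r θ => W (polarPoint r θ))
        ((isCompact_Icc.prod isCompact_Icc).uniformContinuousOn_of_continuous h1)
        (x := R) ⟨by linarith, by linarith⟩
      rwa [nhdsWithin_eq_nhds.2 (Icc_mem_nhds (by linarith) (by linarith))] at h2
    rw [Metric.tendstoUniformlyOn_iff] at hu
    rw [ENNReal.tendsto_nhds_zero]
    intro ε hε
    set V := volume.restrict (Ioc 0 (2 * Real.pi)) univ ^ (2 : ℝ≥0∞).toReal⁻¹ with hV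
    have hVtop : V ≠ ⊤ := by
      rw [hV]
      exact ENNReal.rpow_ne_top_of_nonneg (by positivity) (measure_ne_top _ _)
    obtain ⟨δ, hδ, hδV⟩ : ∃ δ : ℝ, 0 < δ ∧ V * ENNReal.ofReal δ ≤ ε := by
      have h1 : Tendsto (fun δ : ℝ => V * ENNReal.ofReal δ) (𝓝[>] 0) (𝓝 0) := by
        have h2 : Tendsto (fun δ : ℝ => ENNReal.ofReal δ) (𝓝[>] 0) (𝓝 0) := by
          have := (ENNReal.continuous_ofReal.tendsto 0).mono_left
            (nhdsWithin_le_nhds (s := Ioi (0 : ℝ)))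
          simpa using this
        simpa using ENNReal.Tendsto.const_mul h2 (Or.inr hVtop)
      obtain ⟨δ, h2, h3⟩ := ((h1.eventually_le_const hε).and self_mem_nhdsWithin).exists
      exact ⟨δ, h3, h2⟩
    filter_upwards [hv, hl (hu δ hδ)] with r hr hr'
    refine (eLpNorm_le_of_ae_bound (C := δ) ?_).trans hδV
    refine (ae_restrict_iff' measurableSet_Ioc).2 (ae_of_all _ fun θ hθ => ?_)
    have := hr' θ (Ioc_subset_Icc_self hθ)
    rw [dist_eq_norm, norm_sub_rev] at this
    rw [hr θ]
    exact this.le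

/-! ### Functions that are smooth on both sides of the interface -/

/-- The function equal to `v₁` in the cavity and to `v₂` elsewhere. -/
noncomputable def glue (R : ℝ) (v₁ v₂ : Plane → ℂ) (x : Plane) : ℂ := if ‖x‖ < R then v₁ x else v₂ x

theorem eqOn_glue_cavity (R : ℝ) (v₁ v₂ : Plane → ℂ) : EqOn (glue R v₁ v₂) v₁ (cavity R) :=
  fun _ hx => if_pos hx

theorem eqOn_glue_exterior (R : ℝ) (v₁ v₂ : Plane → ℂ) : EqOn (glue R v₁ v₂) v₂ (exterior R) :=
  fun x hx => if_neg (not_lt.2 (le_of_lt (show R < ‖x‖ from hx)))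

/-- The components of `n^{p-1} ∇v`. -/
noncomputable def flux (n : ℝ → ℝ) (p : ℤ) (i : Fin 2) (v : Plane → ℂ) (x : Plane) : ℂ :=
  ((n ‖x‖) ^ (p - 1) : ℝ) • pderiv i v x

/-- The function `- div (n^{p-1} ∇v) - k² n^{p+1} v`. -/
noncomputable def helmholtz (n : ℝ → ℝ) (p : ℤ) (k : ℝ) (v : Plane → ℂ) (x : Plane) : ℂ :=
  -∑ i, pderiv i (flux n p i v) x - (k ^ 2 * (n ‖x‖) ^ (p + 1) : ℝ) • v x

theorem contDiffAt_zpow {f : ℝ → ℝ} {x : ℝ} (hf : ContDiffAt ℝ ∞ f x) (h0 : f x ≠ 0) (q : ℤ) :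
    ContDiffAt ℝ ∞ (fun y => f y ^ q) x := by
  rcases q with q | q
  · simpa using hf.pow q
  · simp only [zpow_negSucc]
    exact (hf.pow (q + 1)).inv (pow_ne_zero _ h0)

section

variable {n : ℝ → ℝ} {R : ℝ} {p : ℤ}

theorem IsOpticalIndex.contDiffAt (hn : IsOpticalIndex n R) {r : ℝ} (hr : 0 < r) (hrR : r ≠ R) :
    ContDiffAt ℝ ∞ n r := by
  rcases lt_or_gt_of_ne hrR with h | h
  · exact hn.smooth.contDiffAt (Icc_mem_nhds hr h)
  · refine (contDiffAt_const (c := (1 : ℝ))).congr_of_eventuallyEq ?_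
    filter_upwards [lt_mem_nhds h] with s hs using hn.eq_one s hs

theorem IsOpticalIndex.index_pos (hn : IsOpticalIndex n R) {r : ℝ} (hr : 0 ≤ r) : 0 < n r := by
  rcases le_or_gt r R with h | h
  · exact hn.pos ⟨hr, h⟩
  · rw [hn.eq_one r h]; exact one_pos

theorem IsOpticalIndex.contDiffAt_zpow (hn : IsOpticalIndex n R) (q : ℤ) {r : ℝ} (hr : 0 < r)
    (hrR : r ≠ R) : ContDiffAt ℝ ∞ (fun s => n s ^ q) r :=
  WGM.contDiffAt_zpow (hn.contDiffAt hr hrR) (hn.index_pos hr.le).ne' q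

theorem IsOpticalIndex.contDiffAt_zpow_norm (hn : IsOpticalIndex n R) (q : ℤ) {x : Plane}
    (hx : x ≠ 0) (hxR : ‖x‖ ≠ R) : ContDiffAt ℝ ∞ (fun y : Plane => n ‖y‖ ^ q) x :=
  (hn.contDiffAt_zpow q (norm_pos_iff.2 hx) hxR).comp x (contDiffAt_norm ℝ hx)

variable {u : Plane → ℂ}

/-- The function n(‖x‖) need not be smooth at the origin, so u is required to vanish near it. -/
theorem contDiffOn_flux (hn : IsOpticalIndex n R) (hu : ContDiffOn ℝ ∞ u (interface R)ᶜ)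
    (h0 : ∀ᶠ x in 𝓝 0, u x = 0) (i : Fin 2) : ContDiffOn ℝ ∞ (flux n p i u) (interface R)ᶜ := by
  intro x hx
  refine ContDiffAt.contDiffWithinAt ?_
  by_cases hx0 : x = 0
  · subst hx0
    refine (contDiffAt_const (c := (0 : ℂ))).congr_of_eventuallyEq ?_
    filter_upwards [h0.eventually_nhds] with y hy
    have : u =ᶠ[𝓝 y] fun _ => 0 := hy
    simp [flux, pderiv, this.fderiv_eq]
  · exact (hn.contDiffAt_zpow_norm _ hx0 hx).smul ((contDiffOn_pderiv (isOpen_compl_interface R)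
      hu i).contDiffAt ((isOpen_compl_interface R).mem_nhds hx))

theorem continuousOn_index_norm (hR : 0 < R) (hn : IsOpticalIndex n R) (q : ℤ) :
    ContinuousOn (fun x : Plane => n ‖x‖ ^ q) (interface R)ᶜ := by
  intro x hx
  refine ContinuousAt.continuousWithinAt ?_
  refine ContinuousAt.zpow₀ ?_ _ (Or.inl (hn.index_pos (norm_nonneg x)).ne')
  by_cases hx0 : x = 0
  · subst hx0
    have h1 : ContinuousWithinAt n (Icc 0 R) ‖(0 : Plane)‖ :=
      hn.smooth.continuousOn _ (by simp [hR.le])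
    refine ContinuousWithinAt.tendsto_nhdsWithin h1 (t := univ) (fun _ _ => mem_univ _) |>.mono_right
      (by simp) |>.comp (tendsto_nhdsWithin_iff.2 ⟨continuous_norm.continuousAt, ?_⟩)
    have : ∀ᶠ y : Plane in 𝓝 0, ‖y‖ < R := (isOpen_cavity R).mem_nhds (by simp [cavity, hR])
    filter_upwards [this] with y hy using ⟨norm_nonneg y, hy.le⟩
  · exact (hn.contDiffAt (norm_pos_iff.2 hx0) hx).continuousAt.comp continuous_norm.continuousAt

theorem continuousOn_helmholtz (hR : 0 < R) (hn : IsOpticalIndex n R)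
    (hu : ContDiffOn ℝ ∞ u (interface R)ᶜ) (h0 : ∀ᶠ x in 𝓝 0, u x = 0) (k : ℝ) :
    ContinuousOn (helmholtz n p k u) (interface R)ᶜ := by
  refine ContinuousOn.sub (ContinuousOn.neg (continuousOn_finsetSum _ fun i _ => ?_)) ?_
  · exact (contDiffOn_pderiv (isOpen_compl_interface R) (contDiffOn_flux hn hu h0 i) i).continuousOn
  · exact (continuousOn_const.mul (continuousOn_index_norm hR hn _)).smul hu.continuousOn

/-- Test functions are supported off the interface, so integration by parts produces no jump terms;
the transmission conditions are carried by `MemDomain`. -/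
theorem isHelmholtzResidual_helmholtz (hR : 0 < R) (hn : IsOpticalIndex n R)
    (hu : ContDiffOn ℝ ∞ u (interface R)ᶜ) (h0 : ∀ᶠ x in 𝓝 0, u x = 0) (k : ℝ) :
    IsHelmholtzResidual n p R k u (helmholtz n p k u) := by
  have hU := isOpen_compl_interface R
  have hf := continuousOn_helmholtz (p := p) hR hn hu h0 k
  refine ⟨fun i => pderiv i u, hasWeakGradient_of_contDiffOn hU hu,
    hf.locallyIntegrableOn hU.measurableSet, fun φ hφ => ?_⟩
  have hF := fun i => contDiffOn_flux (p := p) hn hu h0 i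
  have e1 : ∀ x, ∑ i, ((n ‖x‖) ^ (p - 1) * partialDeriv i φ x : ℝ) • pderiv i u x
      = ∑ i, partialDeriv i φ x • flux n p i u x := fun x =>
    Finset.sum_congr rfl fun i _ => by rw [flux, mul_comm, mul_smul]
  have hmass : ContinuousOn (fun x => (k ^ 2 * (n ‖x‖) ^ (p + 1) : ℝ) • u x) (interface R)ᶜ :=
    (continuousOn_const.mul (continuousOn_index_norm hR hn _)).smul hu.continuousOn
  have e2 : ∀ x, (k ^ 2 * (n ‖x‖) ^ (p + 1) * φ x : ℝ) • u x
      = φ x • ((k ^ 2 * (n ‖x‖) ^ (p + 1) : ℝ) • u x) := fun x => by rw [mul_comm, mul_smul]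
  simp_rw [e1, e2]
  rw [integral_finsetSum _ fun i _ => hφ.integrable_partialDeriv_smul hU (hF i).continuousOn i]
  simp_rw [fun i => integral_partialDeriv_smul hU (hF i) hφ i]
  rw [Finset.sum_neg_distrib, ← integral_finsetSum _ fun i _ =>
    hφ.integrable_smul hU (contDiffOn_pderiv hU (hF i) i).continuousOn, ← integral_neg,
    ← integral_sub]
  · refine integral_congr_ae (ae_of_all _ fun x => ?_)
    simp only [helmholtz, smul_sub, smul_neg, Finset.smul_sum]
  · exact (integrable_finsetSum _ fun i _ =>
      hφ.integrable_smul hU (contDiffOn_pderiv hU (hF i) i).continuousOn).neg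
  · exact hφ.integrable_smul hU hmass

theorem ae_mem_compl_interface (hR : 0 < R) : ∀ᵐ x : Plane, x ∈ (interface R)ᶜ :=
  compl_mem_ae_iff.2 (volume_interface hR)

theorem memLp_of_bound (hR : 0 < R) {f : Plane → ℂ} (hf : ContinuousOn f (interface R)ᶜ)
    {B ρ : ℝ} (hB : ∀ x ∈ (interface R)ᶜ, ‖f x‖ ≤ B)
    (hρ : ∀ x ∈ (interface R)ᶜ, ρ < ‖x‖ → f x = 0) :
    MemLp f 2 volume ∧ (eLpNorm f 2 volume).toReal
      ≤ (volume (Metric.closedBall (0 : Plane) ρ) ^ (2 : ℝ≥0∞).toReal⁻¹).toReal * |B| := by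
  set S := Metric.closedBall (0 : Plane) ρ
  have hae : f =ᵐ[volume] S.indicator f := by
    filter_upwards [ae_mem_compl_interface hR] with x hx
    by_cases hxS : x ∈ S
    · rw [indicator_of_mem hxS]
    · rw [indicator_of_notMem hxS]
      exact hρ x hx (by simpa [S] using hxS)
  have hmeas : AEStronglyMeasurable f volume := by
    have := hf.aestronglyMeasurable (μ := volume) (isOpen_compl_interface R).measurableSet
    rwa [Measure.restrict_eq_self_of_ae_mem (ae_mem_compl_interface hR)] at this
  have hfin : volume S ≠ ⊤ := measure_closedBall_lt_top.ne
  have hfin' : volume S ^ (2 : ℝ≥0∞).toReal⁻¹ ≠ ⊤ :=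
    ENNReal.rpow_ne_top_of_nonneg (by positivity) hfin
  have hle : eLpNorm f 2 volume
      ≤ volume S ^ (2 : ℝ≥0∞).toReal⁻¹ * ENNReal.ofReal |B| := by
    rw [eLpNorm_congr_ae hae, eLpNorm_indicator_eq_eLpNorm_restrict measurableSet_closedBall]
    refine (eLpNorm_le_of_ae_bound (C := |B|) ?_).trans (by rw [Measure.restrict_apply_univ])
    filter_upwards [ae_restrict_of_ae (ae_mem_compl_interface hR)] with x hx
    exact (hB x hx).trans (le_abs_self B)
  have hlt : volume S ^ (2 : ℝ≥0∞).toReal⁻¹ * ENNReal.ofReal |B| ≠ ⊤ :=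
    ENNReal.mul_ne_top hfin' ENNReal.ofReal_ne_top
  refine ⟨⟨hmeas, hle.trans_lt hlt.lt_top⟩, ?_⟩
  refine (ENNReal.toReal_mono hlt hle).trans (le_of_eq ?_)
  rw [ENNReal.toReal_mul, ENNReal.toReal_ofReal (abs_nonneg B)]

variable {v₁ v₂ : Plane → ℂ}

theorem contDiffOn_glue (hv₁ : ContDiff ℝ ∞ v₁) (hv₂ : ContDiff ℝ ∞ v₂) :
    ContDiffOn ℝ ∞ (glue R v₁ v₂) (interface R)ᶜ := by
  intro x hx
  refine ContDiffAt.contDiffWithinAt ?_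
  rw [compl_interface] at hx
  rcases hx with hx | hx
  · exact hv₁.contDiffAt.congr_of_eventuallyEq
      ((eqOn_glue_cavity R v₁ v₂).eventuallyEq_of_mem ((isOpen_cavity R).mem_nhds hx))
  · exact hv₂.contDiffAt.congr_of_eventuallyEq
      ((eqOn_glue_exterior R v₁ v₂).eventuallyEq_of_mem ((isOpen_exterior R).mem_nhds hx))

/-- The radial derivative. -/
noncomputable def radialDeriv (v : Plane → ℂ) (x : Plane) : ℂ :=
  ∑ i, (x i / ‖x‖ : ℝ) • pderiv i v x

theorem continuousOn_radialDeriv {v : Plane → ℂ} (hv : ContDiff ℝ ∞ v) :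
    ContinuousOn (radialDeriv v) {0}ᶜ := by
  refine continuousOn_finsetSum _ fun i _ => ?_
  have h : ContinuousOn (fun x : Plane => x i / ‖x‖) {0}ᶜ :=
    ContinuousOn.div (by fun_prop) continuous_norm.continuousOn fun x hx => norm_ne_zero_iff.2 hx
  exact h.smul (contDiff_pderiv hv i).continuous.continuousOn

theorem radialFlux_eq (G : Fin 2 → Plane → ℂ) (x : Plane) :
    radialFlux n p G x = ((n ‖x‖) ^ (p - 1) : ℝ) • ∑ i, (x i / ‖x‖ : ℝ) • G i x := rfl

theorem memDomain_glue (hR : 0 < R) (hn : IsOpticalIndex n R) (hv₁ : ContDiff ℝ ∞ v₁)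
    (hv₂ : ContDiff ℝ ∞ v₂) (hc₁ : HasCompactSupport v₁) (hc₂ : HasCompactSupport v₂)
    (hD : ∀ x ∈ interface R, v₁ x = v₂ x)
    (hN : ∀ x ∈ interface R, (n R ^ (p - 1) : ℝ) • radialDeriv v₁ x = radialDeriv v₂ x) :
    MemDomain n p R (glue R v₁ v₂) := by
  have e₁ := eqOn_glue_cavity R v₁ v₂
  have e₂ := eqOn_glue_exterior R v₁ v₂
  have pR : ∀ θ, polarPoint R θ ∈ interface R := fun θ => norm_polarPoint hR.le θ
  have hin : ∀ᶠ r in 𝓝[<] R, ∀ θ, polarPoint r θ ∈ cavity R ∧ ‖polarPoint r θ‖ ∈ Icc 0 R := by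
    filter_upwards [Ioo_mem_nhdsLT hR] with r hr θ
    rw [cavity, Set.mem_ofPred_eq, norm_polarPoint hr.1.le]
    exact ⟨hr.2, hr.1.le, hr.2.le⟩
  have hout : ∀ᶠ r in 𝓝[>] R, ∀ θ, polarPoint r θ ∈ exterior R := by
    filter_upwards [self_mem_nhdsWithin] with r hr θ
    rw [exterior, Set.mem_ofPred_eq, norm_polarPoint (hR.trans hr).le]
    exact hr
  have hl : 𝓝[<] R ≤ 𝓝 R := nhdsWithin_le_nhds
  have hg : 𝓝[>] R ≤ 𝓝 R := nhdsWithin_le_nhds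
  refine ⟨?_, memH2_of_eqOn (isOpen_cavity R) e₁ hv₁ hc₁,
    memH2_of_eqOn (isOpen_exterior R) e₂ hv₂ hc₂, ⟨fun θ => v₁ (polarPoint R θ), ?_, ?_⟩,
    fun i => pderiv i (glue R v₁ v₂),
    hasWeakGradient_of_contDiffOn (isOpen_cavity R) (hv₁.contDiffOn.congr e₁),
    hasWeakGradient_of_contDiffOn (isOpen_exterior R) (hv₂.contDiffOn.congr e₂),
    fun θ => (n (min ‖polarPoint R θ‖ R) ^ (p - 1) : ℝ) • radialDeriv v₁ (polarPoint R θ), ?_, ?_⟩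
  · have h1 : MemLp v₁ 2 (volume : Measure Plane) := hv₁.continuous.memLp_of_hasCompactSupport hc₁
    have h2 : MemLp v₂ 2 (volume : Measure Plane) := hv₂.continuous.memLp_of_hasCompactSupport hc₂
    have h3 := (h1.indicator (isOpen_cavity R).measurableSet).add
      (h2.indicator (isOpen_cavity R).measurableSet.compl)
    convert! h3 using 1
    ext x
    by_cases hx : x ∈ cavity R
    · simp [e₁ hx, hx]
    · have : ¬ ‖x‖ < R := hx
      simp [glue, hx, this]
  · exact hasTrace_of_continuousOn hR hl hv₁.continuous.continuousOn
      (hin.mono fun r hr θ => e₁ (hr θ).1)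
  · have := hasTrace_of_continuousOn hR hg hv₂.continuous.continuousOn
      (v := glue R v₁ v₂) (hout.mono fun r hr θ => e₂ (hr θ))
    simpa only [hD _ (pR _)] using this
  -- The truncation min ‖x‖ R extends the interior index continuously across the circle, where n
  -- itself jumps.
  · refine hasTrace_of_continuousOn hR hl
      (W := fun x => (n (min ‖x‖ R) ^ (p - 1) : ℝ) • radialDeriv v₁ x) ?_ ?_
    · have hm : ∀ x : Plane, min ‖x‖ R ∈ Icc 0 R :=
        fun x => ⟨le_min (norm_nonneg x) hR.le, min_le_right _ _⟩
      have hc : Continuous fun x : Plane => n (min ‖x‖ R) ^ (p - 1) :=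
        (hn.smooth.continuousOn.comp_continuous (by fun_prop) hm).zpow₀ _
          fun x => Or.inl (hn.pos (hm x)).ne'
      exact hc.continuousOn.smul (continuousOn_radialDeriv hv₁)
    · refine hin.mono fun r hr θ => ?_
      obtain ⟨h1, h2⟩ := hr θ
      rw [radialFlux_eq, min_eq_left h2.2, radialDeriv]
      simp only [fun i => pderiv_congr (isOpen_cavity R) e₁ i h1]
  · have := hasTrace_of_continuousOn hR hg (continuousOn_radialDeriv hv₂)
      (v := radialFlux n p fun i => pderiv i (glue R v₁ v₂)) (hout.mono fun r hr θ => ?_)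
    · convert! this using 2 with θ
      rw [norm_polarPoint hR.le, min_self, hN _ (pR θ)]
    · have h1 := hr θ
      rw [radialFlux_eq, hn.eq_one _ h1, one_zpow, one_smul, radialDeriv]
      simp only [fun i => pderiv_congr (isOpen_exterior R) e₂ i h1]

end

/-! ### Separated functions in polar coordinates -/

/-- The function `e^{imθ}`. -/
noncomputable def angular (m : ℕ) (x : Plane) : ℂ :=
  (((x 0 : ℂ) + x 1 * Complex.I) / (‖x‖ : ℝ)) ^ m

/-- The function `w(r) e^{imθ}`. -/
noncomputable def mode (w : ℝ → ℝ) (m : ℕ) (x : Plane) : ℂ := (w ‖x‖ : ℝ) * angular m x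

/-- The rotated position vector. -/
def rot (x : Plane) : Fin 2 → ℝ := ![-x 1, x 0]

/-- The line through `x` in the direction of the `i`-th axis. -/
noncomputable def axisLine (i : Fin 2) (x : Plane) (s : ℝ) : Plane :=
  x + s • EuclideanSpace.single i (1 : ℝ)

theorem axisLine_zero (i : Fin 2) (x : Plane) : axisLine i x 0 = x := by simp [axisLine]

theorem hasDerivAt_axisLine (i : Fin 2) (x : Plane) :
    HasDerivAt (axisLine i x) (EuclideanSpace.single i (1 : ℝ)) 0 := by
  have := ((hasDerivAt_id (0 : ℝ)).smul_const (EuclideanSpace.single i (1 : ℝ))).const_add x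
  rw [one_smul] at this
  exact this

theorem hasDerivAt_axisLine_coord (i j : Fin 2) (x : Plane) :
    HasDerivAt (fun s => axisLine i x s j) (if j = i then 1 else 0) 0 := by
  have h : (fun s => axisLine i x s j) = fun s => x j + s * (if j = i then 1 else 0) := by
    ext s
    simp [axisLine]
  rw [h]
  simpa using ((hasDerivAt_id (0 : ℝ)).mul_const (if j = i then (1 : ℝ) else 0)).const_add (x j)

theorem norm_sq_eq (x : Plane) : ‖x‖ ^ 2 = x 0 ^ 2 + x 1 ^ 2 := by
  rw [EuclideanSpace.norm_sq_eq]
  simp [Fin.sum_univ_two]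

theorem hasDerivAt_norm_axisLine (i : Fin 2) {x : Plane} (hx : x ≠ 0) :
    HasDerivAt (fun s => ‖axisLine i x s‖) (x i / ‖x‖) 0 := by
  have h0 : ‖x‖ ≠ 0 := norm_ne_zero_iff.2 hx
  have h1 := (hasDerivAt_axisLine i x).norm_sq
  have h2 := h1.sqrt (by rw [axisLine_zero]; exact pow_ne_zero 2 h0)
  have e : (fun s => ‖axisLine i x s‖) = fun s => Real.sqrt (‖axisLine i x s‖ ^ 2) := by
    ext s; rw [Real.sqrt_sq (norm_nonneg _)]
  rw [e]
  convert! h2 using 1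
  rw [axisLine_zero, Real.sqrt_sq (norm_nonneg _), EuclideanSpace.inner_single_right]
  simp
  field_simp

theorem pderiv_eq_of_hasDerivAt {F : Plane → ℂ} {x : Plane} {i : Fin 2} {f' : ℂ}
    (hF : DifferentiableAt ℝ F x) (h : HasDerivAt (fun s => F (axisLine i x s)) f' 0) :
    pderiv i F x = f' := by
  have h1 : HasFDerivAt F (fderiv ℝ F x) (axisLine i x 0) := by
    rw [axisLine_zero]; exact hF.hasFDerivAt
  exact (h1.comp_hasDerivAt 0 (hasDerivAt_axisLine i x)).unique h

theorem HasDerivAt.comp_norm_axisLine {w : ℝ → ℝ} {w' : ℝ} {x : Plane} (hx : x ≠ 0)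
    (hw : HasDerivAt w w' ‖x‖) (i : Fin 2) :
    HasDerivAt (fun s => w ‖axisLine i x s‖) (w' * (x i / ‖x‖)) 0 := by
  have h1 : HasDerivAt w w' ‖axisLine i x 0‖ := by rwa [axisLine_zero]
  exact h1.comp 0 (hasDerivAt_norm_axisLine i hx)

/-- The differential of the polar angle is `rot x` · dx/‖x‖². -/
theorem hasDerivAt_angular (m : ℕ) (i : Fin 2) {x : Plane} (hx : x ≠ 0) :
    HasDerivAt (fun s => angular m (axisLine i x s))
      (Complex.I * m * ((rot x i / ‖x‖ ^ 2 : ℝ) : ℂ) * angular m x) 0 := by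
  have h0 : ‖x‖ ≠ 0 := norm_ne_zero_iff.2 hx
  have h0c : ((‖x‖ : ℝ) : ℂ) ≠ 0 := by exact_mod_cast h0
  have hc := fun j => (hasDerivAt_axisLine_coord i j x).ofReal_comp
  have hz := (hc 0).add ((hc 1).mul_const Complex.I)
  have hq := hz.div (hasDerivAt_norm_axisLine i hx).ofReal_comp (by rw [axisLine_zero]; exact h0c)
  have hp := hq.pow m
  have hs : ((‖x‖ : ℝ) : ℂ) ^ 2 = (x 0 : ℂ) ^ 2 + (x 1 : ℂ) ^ 2 := by exact_mod_cast norm_sq_eq x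
  convert! hp using 1
  rcases m with _ | m
  · simp
  · simp only [Pi.add_apply, Pi.div_apply, axisLine_zero, Nat.add_sub_cancel, angular, pow_succ]
    push_cast
    have key : ∀ j : Fin 2, Complex.I * ((rot x j : ℂ)) * ((x 0 : ℂ) + x 1 * Complex.I)
        = ((if (0 : Fin 2) = j then 1 else 0) + (if (1 : Fin 2) = j then 1 else 0) * Complex.I)
            * ((x 0 : ℂ) ^ 2 + (x 1 : ℂ) ^ 2) - ((x 0 : ℂ) + x 1 * Complex.I) * x j := by
      intro j
      fin_cases j
      · simp [rot]
        linear_combination (-(x 1 : ℂ) ^ 2) * Complex.I_sq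
      · simp [rot]
        linear_combination ((x 0 : ℂ) * x 1) * Complex.I_sq
    have k := key i
    rw [← hs] at k
    generalize (((x 0 : ℂ) + x 1 * Complex.I) / (‖x‖ : ℝ)) ^ m = q
    have k2 : ((if (0 : Fin 2) = i then (1 : ℂ) else 0)
        + (if (1 : Fin 2) = i then 1 else 0) * Complex.I) * ((‖x‖ : ℝ) : ℂ)
          - ((x 0 : ℂ) + x 1 * Complex.I) * (x i / (‖x‖ : ℝ))
        = Complex.I * ((rot x i : ℂ)) * ((x 0 : ℂ) + x 1 * Complex.I) / (‖x‖ : ℝ) := by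
      rw [k]; field_simp
    have k3 : ∀ c : Prop, [Decidable c] → (((if c then (1 : ℝ) else 0) : ℝ) : ℂ)
        = if c then (1 : ℂ) else 0 := by
      intro c _; split_ifs <;> simp
    simp only [k3, k2]
    field_simp

theorem norm_angular (m : ℕ) {x : Plane} (hx : x ≠ 0) : ‖angular m x‖ = 1 := by
  have h0 : ‖x‖ ≠ 0 := norm_ne_zero_iff.2 hx
  have h1 : ‖(x 0 : ℂ) + x 1 * Complex.I‖ = ‖x‖ := by
    rw [Complex.norm_add_mul_I, ← norm_sq_eq, Real.sqrt_sq (norm_nonneg _)]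
  rw [angular, norm_pow, norm_div, h1]
  simp [h0]

theorem contDiffOn_angular (m : ℕ) : ContDiffOn ℝ ∞ (angular m) {0}ᶜ := by
  have h1 : ∀ j : Fin 2, ContDiff ℝ ∞ fun x : Plane => (x j : ℂ) := fun j =>
    Complex.ofRealCLM.contDiff.comp (by fun_prop)
  have h2 : ContDiffOn ℝ ∞ (fun x : Plane => ((‖x‖ : ℝ) : ℂ)) {0}ᶜ :=
    Complex.ofRealCLM.contDiff.comp_contDiffOn fun x hx => (contDiffAt_norm ℝ hx).contDiffWithinAt
  refine ContDiffOn.pow ?_ m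
  have h3 : ∀ x ∈ ({0}ᶜ : Set Plane), ((‖x‖ : ℝ) : ℂ) ≠ 0 := fun x hx => by
    exact_mod_cast norm_ne_zero_iff.2 hx
  simp only [div_eq_mul_inv]
  exact (((h1 0).add ((h1 1).mul contDiff_const)).contDiffOn).mul (h2.inv h3)

theorem contDiffAt_mode {w : ℝ → ℝ} {x : Plane} (hx : x ≠ 0) (hw : ContDiffAt ℝ ∞ w ‖x‖) (m : ℕ) :
    ContDiffAt ℝ ∞ (mode w m) x :=
  (Complex.ofRealCLM.contDiff.contDiffAt.comp x (hw.comp x (contDiffAt_norm ℝ hx))).mul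
    ((contDiffOn_angular m).contDiffAt (isOpen_compl_singleton.mem_nhds hx))

theorem pderiv_mode {w : ℝ → ℝ} {x : Plane} (hx : x ≠ 0) (hw : ContDiffAt ℝ ∞ w ‖x‖) (m : ℕ)
    (i : Fin 2) : pderiv i (mode w m) x
      = (((deriv w ‖x‖ / ‖x‖ * x i : ℝ) : ℂ)
        + Complex.I * m * ((w ‖x‖ / ‖x‖ ^ 2 * rot x i : ℝ) : ℂ)) * angular m x := by
  refine pderiv_eq_of_hasDerivAt ((contDiffAt_mode hx hw m).differentiableAt (by simp)) ?_
  have h1 := (HasDerivAt.comp_norm_axisLine hx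
    (hw.differentiableAt (by simp)).hasDerivAt i).ofReal_comp
  have h2 := h1.mul (hasDerivAt_angular m i hx)
  convert! h2 using 1
  rw [axisLine_zero]
  push_cast
  ring

theorem hasDerivAt_rot (i : Fin 2) (x : Plane) :
    HasDerivAt (fun s => rot (axisLine i x s) i) 0 0 := by
  fin_cases i
  · have := (hasDerivAt_axisLine_coord 0 1 x).neg
    simp only [Fin.isValue, one_ne_zero, if_false, neg_zero] at this
    exact this
  · simpa [rot] using hasDerivAt_axisLine_coord 1 0 x

theorem pderiv_field {A B : ℝ → ℝ} {x : Plane} (hx : x ≠ 0) (hA : DifferentiableAt ℝ A ‖x‖)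
    (hB : DifferentiableAt ℝ B ‖x‖) (m : ℕ) (i : Fin 2) {F : Plane → ℂ}
    (hd : DifferentiableAt ℝ F x)
    (hF : ∀ᶠ y in 𝓝 x, F y = (((A ‖y‖ * y i : ℝ) : ℂ)
      + Complex.I * m * ((B ‖y‖ * rot y i : ℝ) : ℂ)) * angular m y) :
    pderiv i F x = (((deriv A ‖x‖ * (x i / ‖x‖) * x i + A ‖x‖ : ℝ) : ℂ)
      + Complex.I * m * ((deriv B ‖x‖ * (x i / ‖x‖) * rot x i : ℝ) : ℂ)
      + (((A ‖x‖ * x i : ℝ) : ℂ) + Complex.I * m * ((B ‖x‖ * rot x i : ℝ) : ℂ))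
        * (Complex.I * m * ((rot x i / ‖x‖ ^ 2 : ℝ) : ℂ))) * angular m x := by
  refine pderiv_eq_of_hasDerivAt hd ?_
  have h1 := ((HasDerivAt.comp_norm_axisLine hx hA.hasDerivAt i).mul
    (hasDerivAt_axisLine_coord i i x)).ofReal_comp
  have h2 := (((HasDerivAt.comp_norm_axisLine hx hB.hasDerivAt i).mul
    (hasDerivAt_rot i x)).ofReal_comp).const_mul (Complex.I * m)
  have h3 := (h1.add h2).mul (hasDerivAt_angular m i hx)
  have hc : Tendsto (axisLine i x) (𝓝 0) (𝓝 x) := by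
    have := (hasDerivAt_axisLine i x).continuousAt.tendsto
    rwa [axisLine_zero] at this
  refine (h3.congr_of_eventuallyEq ?_).congr_deriv ?_
  · filter_upwards [hc.eventually hF] with s hs
    rw [hs]
    simp
  · simp only [Pi.add_apply, Pi.mul_apply, axisLine_zero, if_true]
    push_cast
    ring

/-- Orthogonality of x and `rot x` removes the cross terms, and |rot x| = ‖x‖ produces -m²B. -/
theorem sum_pderiv_field {A B A' B' : ℝ} {x : Plane} (hx : x ≠ 0) (m : ℕ) :
    ∑ i, (((A' * (x i / ‖x‖) * x i + A : ℝ) : ℂ)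
      + Complex.I * m * ((B' * (x i / ‖x‖) * rot x i : ℝ) : ℂ)
      + (((A * x i : ℝ) : ℂ) + Complex.I * m * ((B * rot x i : ℝ) : ℂ))
        * (Complex.I * m * ((rot x i / ‖x‖ ^ 2 : ℝ) : ℂ))) * angular m x
      = ((A' * ‖x‖ + 2 * A - m ^ 2 * B : ℝ) : ℂ) * angular m x := by
  have h0 : ((‖x‖ : ℝ) : ℂ) ≠ 0 := by exact_mod_cast norm_ne_zero_iff.2 hx
  have hs : ((‖x‖ : ℝ) : ℂ) ^ 2 = (x 0 : ℂ) ^ 2 + (x 1 : ℂ) ^ 2 := by exact_mod_cast norm_sq_eq x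
  rw [Fin.sum_univ_two, ← add_mul]
  congr 1
  simp only [rot, Matrix.cons_val_zero, Matrix.cons_val_one]
  push_cast
  field_simp
  linear_combination (-(A' : ℂ) * ‖x‖ + B * m ^ 2) * hs
    + B * m ^ 2 * ((x 0 : ℂ) ^ 2 + (x 1 : ℂ) ^ 2) * Complex.I_sq

section

variable {n : ℝ → ℝ} {R : ℝ} {p : ℤ}

theorem helmholtz_mode (hn : IsOpticalIndex n R) {w : ℝ → ℝ} {x : Plane} (hx : x ≠ 0)
    (hxR : ‖x‖ ≠ R) (hw : ContDiff ℝ ∞ w) (m : ℕ) (k : ℝ) :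
    helmholtz n p k (mode w m) x = -((n ‖x‖ ^ (p - 1) * iteratedDeriv 2 w ‖x‖
      + deriv (fun r => n r ^ (p - 1)) ‖x‖ * deriv w ‖x‖
      + n ‖x‖ ^ (p - 1) * deriv w ‖x‖ / ‖x‖
      - m ^ 2 * (n ‖x‖ ^ (p - 1) * w ‖x‖ / ‖x‖ ^ 2)
      + k ^ 2 * n ‖x‖ ^ (p + 1) * w ‖x‖ : ℝ) : ℂ) * angular m x := by
  have hr : 0 < ‖x‖ := norm_pos_iff.2 hx
  have hcd := hn.contDiffAt_zpow (p - 1) hr hxR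
  set c : ℝ → ℝ := fun r => n r ^ (p - 1) with hc
  have hw1 : ContDiff ℝ ∞ (deriv w) := by
    rw [← iteratedDeriv_one]
    exact (contDiff_infty_iff_deriv.1 hw).2 |> fun h => by simpa using h
  -- The flux of the mode is (A(r) x + imB(r) rot x) e^{imθ}.
  set A : ℝ → ℝ := fun r => c r * deriv w r / r with hA
  set B : ℝ → ℝ := fun r => c r * w r / r ^ 2 with hB
  have hcd' := (hcd.differentiableAt (by simp)).hasDerivAt
  have hw' := (hw.differentiable (by simp)).differentiableAt (x := ‖x‖) |>.hasDerivAt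
  have hw'' := (hw1.differentiable (by simp)).differentiableAt (x := ‖x‖) |>.hasDerivAt
  have hAd : HasDerivAt A (((deriv c ‖x‖ * deriv w ‖x‖ + c ‖x‖ * deriv (deriv w) ‖x‖) * ‖x‖
      - (c ‖x‖ * deriv w ‖x‖) * 1) / ‖x‖ ^ 2) ‖x‖ := (hcd'.mul hw'').div (hasDerivAt_id ‖x‖) hr.ne'
  have hBd : DifferentiableAt ℝ B ‖x‖ :=
    ((hcd'.mul hw').differentiableAt.div (differentiableAt_id.pow 2) (pow_ne_zero 2 hr.ne'))
  have hflux : ∀ i, ∀ᶠ y in 𝓝 x, flux n p i (mode w m) y = (((A ‖y‖ * y i : ℝ) : ℂ)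
      + Complex.I * m * ((B ‖y‖ * rot y i : ℝ) : ℂ)) * angular m y := fun i => by
    filter_upwards [isOpen_compl_singleton.mem_nhds hx] with y hy
    rw [flux, pderiv_mode hy hw.contDiffAt, Complex.real_smul]
    simp only [hA, hB, hc]
    push_cast
    ring
  have hfd : ∀ i, DifferentiableAt ℝ (flux n p i (mode w m)) x := fun i => by
    have h1 : ContDiffOn ℝ ∞ (mode w m) {0}ᶜ := fun y hy =>
      (contDiffAt_mode hy hw.contDiffAt m).contDiffWithinAt
    have h2 := (contDiffOn_pderiv isOpen_compl_singleton h1 i).contDiffAt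
      (isOpen_compl_singleton.mem_nhds hx)
    exact ((hn.contDiffAt_zpow_norm _ hx hxR).smul h2).differentiableAt (by simp)
  have hp := fun i => pderiv_field hx hAd.differentiableAt hBd m i (hfd i) (hflux i)
  rw [helmholtz]
  simp_rw [hp]
  rw [sum_pderiv_field hx, hAd.deriv, mode, Complex.real_smul,
    iteratedDeriv_succ, iteratedDeriv_one]
  simp only [hA, hB, hc]
  have h0 : ((‖x‖ : ℝ) : ℂ) ≠ 0 := by exact_mod_cast hr.ne'
  push_cast
  field_simp
  ring

end

/-! ### Cut-off functions -/

theorem pderiv_smul {f : Plane → ℝ} {F : Plane → ℂ} {x : Plane} (hf : DifferentiableAt ℝ f x)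
    (hF : DifferentiableAt ℝ F x) (i : Fin 2) :
    pderiv i (fun y => f y • F y) x = partialDeriv i f x • F x + f x • pderiv i F x := by
  rw [pderiv, fderiv_fun_smul hf hF]
  simp [pderiv, partialDeriv, add_comm]

theorem contDiff_partialDeriv {χ : Plane → ℝ} (hχ : ContDiff ℝ ∞ χ) (i : Fin 2) :
    ContDiff ℝ ∞ (partialDeriv i χ) :=
  (hχ.fderiv_right (m := ∞) (by simp)).clm_apply contDiff_const

/-- The coefficients of order zero of the commutator with a cut-off function. -/
noncomputable def commutatorCoeff (n : ℝ → ℝ) (p : ℤ) (χ : Plane → ℝ) (i : Fin 2) (x : Plane) : ℝ :=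
  partialDeriv i (fun y => n ‖y‖ ^ (p - 1) * partialDeriv i χ y) x

section

variable {n : ℝ → ℝ} {R : ℝ} {p : ℤ} {χ : Plane → ℝ} {F : Plane → ℂ}

/-- The flux of χF is n^{p-1}(∂χ)F plus χ times the flux of F; the additional terms live only where
χ is not locally constant. -/
theorem helmholtz_smul (hn : IsOpticalIndex n R) (hχ : ContDiff ℝ ∞ χ)
    (hF : ContDiffOn ℝ ∞ F {0}ᶜ) {x : Plane} (hx : x ≠ 0) (hxR : ‖x‖ ≠ R) (k : ℝ) :
    helmholtz n p k (fun y => χ y • F y) x = χ x • helmholtz n p k F x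
      - ∑ i, (commutatorCoeff n p χ i x • F x
        + (2 * n ‖x‖ ^ (p - 1) * partialDeriv i χ x) • pderiv i F x) := by
  have hU : ({0}ᶜ : Set Plane) ∈ 𝓝 x := isOpen_compl_singleton.mem_nhds hx
  have hc := hn.contDiffAt_zpow_norm (p - 1) hx hxR
  have hpF := fun i => ((contDiffOn_pderiv isOpen_compl_singleton hF i).contDiffAt hU)
  have hflux : ∀ i, DifferentiableAt ℝ (flux n p i F) x := fun i =>
    (hc.smul (hpF i)).differentiableAt (by simp)
  have hcχ : ∀ i, DifferentiableAt ℝ (fun y : Plane => n ‖y‖ ^ (p - 1) * partialDeriv i χ y) x :=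
    fun i => (hc.mul (contDiff_partialDeriv hχ i).contDiffAt).differentiableAt (by simp)
  have hFd := (hF.contDiffAt hU).differentiableAt (by simp)
  have hχd : DifferentiableAt ℝ χ x := (hχ.differentiable (by simp)).differentiableAt
  have e1 : ∀ i, flux n p i (fun y => χ y • F y) =ᶠ[𝓝 x]
      fun y => (n ‖y‖ ^ (p - 1) * partialDeriv i χ y) • F y + χ y • flux n p i F y := fun i => by
    filter_upwards [hU] with y hy
    rw [flux, pderiv_smul (hχ.differentiable (by simp)).differentiableAt
      ((hF.contDiffAt (isOpen_compl_singleton.mem_nhds hy)).differentiableAt (by simp)),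
      smul_add, mul_smul, flux, smul_comm (χ y)]
  have e2 : ∀ i, pderiv i (flux n p i (fun y => χ y • F y)) x
      = commutatorCoeff n p χ i x • F x + (2 * n ‖x‖ ^ (p - 1) * partialDeriv i χ x) • pderiv i F x
        + χ x • pderiv i (flux n p i F) x := fun i => by
    have h1 : pderiv i (flux n p i (fun y => χ y • F y)) x
        = pderiv i (fun y => (n ‖y‖ ^ (p - 1) * partialDeriv i χ y) • F y) x
          + pderiv i (fun y => χ y • flux n p i F y) x := by
      have h2 := fderiv_add ((hcχ i).smul hFd) (hχd.smul (hflux i))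
      rw [pderiv, (e1 i).fderiv_eq]
      exact congrArg (fun L : Plane →L[ℝ] ℂ => L (EuclideanSpace.single i 1)) h2
    rw [h1, pderiv_smul (hcχ i) hFd, pderiv_smul hχd (hflux i), commutatorCoeff, flux,
      smul_smul]
    module
  rw [helmholtz]
  simp_rw [e2]
  rw [helmholtz, Finset.sum_add_distrib, ← Finset.smul_sum]
  module

/-- Cut-off functions that can be used to localize the quasi-modes. -/
structure IsGalleryCutoff (R : ℝ) (χ : Plane → ℝ) : Prop where
  smooth : ContDiff ℝ ∞ χ
  compact : HasCompactSupport χ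
  mem_Icc : ∀ x, χ x ∈ Icc (0 : ℝ) 1
  -- This removes the singularity of e^{imθ} at the origin and leaves only 1 - r/R ≤ 1/2, the range
  -- of the Taylor expansions.
  zero : ∀ x, ‖x‖ ≤ R / 2 → χ x = 0
  one : ∀ᶠ x in 𝓝ˢ (interface R), χ x = 1

/-- By compactness a neighbourhood of the circle contains an annulus; the radial projection (R/‖x‖)x
realizes the distance ‖x‖ - R. -/
theorem exists_one_near_interface (hR : 0 < R) (h : ∀ᶠ x in 𝓝ˢ (interface R), χ x = 1) :
    ∃ δ > 0, ∀ x, |‖x‖ - R| < δ → ∀ᶠ y in 𝓝 x, χ y = 1 := by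
  have hs : interface R = Metric.sphere (0 : Plane) R := by ext x; simp [interface]
  obtain ⟨V, hV, hsub, hV1⟩ := eventually_nhdsSet_iff_exists.1 h
  obtain ⟨δ, hδ, hthick⟩ := (show IsCompact (interface R) by
    rw [hs]; exact isCompact_sphere _ _).exists_thickening_subset_open hV hsub
  refine ⟨min δ R, lt_min hδ hR, fun x hx => ?_⟩
  have hx0 : 0 < ‖x‖ := by
    have := (abs_lt.1 (hx.trans_le (min_le_right _ _))).1
    linarith
  suffices hmem : x ∈ Metric.thickening δ (interface R) by
    filter_upwards [hV.mem_nhds (hthick hmem)] with y hy using hV1 y hy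
  refine Metric.mem_thickening_iff.2 ⟨(R / ‖x‖) • x, ?_, ?_⟩
  · change ‖(R / ‖x‖) • x‖ = R
    rw [norm_smul, Real.norm_eq_abs, abs_of_pos (by positivity)]
    field_simp
  · have : x - (R / ‖x‖) • x = ((‖x‖ - R) / ‖x‖) • x := by
      rw [sub_div, div_self hx0.ne', sub_smul, one_smul]
    rw [dist_eq_norm, this, norm_smul, Real.norm_eq_abs, abs_div, abs_of_pos hx0,
      div_mul_cancel₀ _ hx0.ne']
    exact hx.trans_le (min_le_left _ _)

theorem partialDeriv_eq_zero {f : Plane → ℝ} {x : Plane} {c : ℝ} (h : ∀ᶠ y in 𝓝 x, f y = c)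
    (i : Fin 2) : ∀ᶠ y in 𝓝 x, partialDeriv i f y = 0 := by
  filter_upwards [h.eventually_nhds] with y hy
  have : f =ᶠ[𝓝 y] fun _ => c := hy
  simp [partialDeriv, this.fderiv_eq]

theorem commutatorCoeff_eq_zero {x : Plane} {c : ℝ} (h : ∀ᶠ y in 𝓝 x, χ y = c) (i : Fin 2) :
    commutatorCoeff n p χ i x = 0 := by
  refine (partialDeriv_eq_zero (c := 0) ?_ i).self_of_nhds
  filter_upwards [partialDeriv_eq_zero h i] with y hy
  rw [hy, mul_zero]

theorem IsGalleryCutoff.eventually_zero (hχ : IsGalleryCutoff R χ) {x : Plane}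
    (hx : ‖x‖ < R / 2) : ∀ᶠ y in 𝓝 x, χ y = 0 := by
  filter_upwards [(isOpen_lt continuous_norm continuous_const).mem_nhds hx] with y hy
    using hχ.zero y (le_of_lt hy)

/-- Outside the annulus where χ is 1, the coefficients are supported in a compact set that avoids
the circle and the origin, where n(‖x‖) is smooth. -/
theorem IsGalleryCutoff.exists_coeff_bound (hR : 0 < R) (hn : IsOpticalIndex n R)
    (hχ : IsGalleryCutoff R χ) (p : ℤ) {δ : ℝ} (hδ : 0 < δ)
    (h1 : ∀ x, |‖x‖ - R| < δ → ∀ᶠ y in 𝓝 x, χ y = 1) :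
    ∃ M, 0 ≤ M ∧ ∀ x i, |commutatorCoeff n p χ i x|
        ≤ (if |‖x‖ - R| < δ then 0 else M) ∧
      |2 * n ‖x‖ ^ (p - 1) * partialDeriv i χ x| ≤ (if |‖x‖ - R| < δ then 0 else M) := by
  set K := tsupport χ ∩ {x : Plane | δ ≤ |‖x‖ - R|} with hK
  have hKc : IsCompact K := hχ.compact.inter_right
    (isClosed_le continuous_const (continuous_norm.sub continuous_const).abs)
  have hKne : ∀ x ∈ K, x ≠ 0 ∧ ‖x‖ ≠ R := fun x hx => by
    refine ⟨fun h0 => ?_, fun h => ?_⟩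
    · have : χ =ᶠ[𝓝 x] 0 := hχ.eventually_zero (by rw [h0]; simp [hR])
      exact notMem_tsupport_iff_eventuallyEq.2 this hx.1
    · have : δ ≤ |‖x‖ - R| := hx.2
      rw [h, sub_self, abs_zero] at this
      linarith
  have hb : ∀ i, ∃ M, ∀ x ∈ K, |commutatorCoeff n p χ i x| ≤ M ∧
      |2 * n ‖x‖ ^ (p - 1) * partialDeriv i χ x| ≤ M := fun i => by
    have hsm : ∀ x ∈ K, ContDiffAt ℝ ∞ (fun y : Plane => n ‖y‖ ^ (p - 1)) x := fun x hx =>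
      hn.contDiffAt_zpow_norm _ (hKne x hx).1 (hKne x hx).2
    have hd := contDiff_partialDeriv hχ.smooth i
    obtain ⟨M₁, hM₁⟩ := hKc.exists_bound_of_continuousOn (f := commutatorCoeff n p χ i)
      fun x hx => by
        have := ((hsm x hx).mul hd.contDiffAt).fderiv_right (m := ∞) (by simp)
        exact (this.continuousAt.clm_apply continuousAt_const).continuousWithinAt
    obtain ⟨M₂, hM₂⟩ := hKc.exists_bound_of_continuousOn
      (f := fun x : Plane => 2 * n ‖x‖ ^ (p - 1) * partialDeriv i χ x) fun x hx =>
        ((continuousAt_const.mul (hsm x hx).continuousAt).mul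
          hd.continuous.continuousAt).continuousWithinAt
    exact ⟨max M₁ M₂, fun x hx => ⟨(hM₁ x hx).trans (le_max_left _ _),
      (hM₂ x hx).trans (le_max_right _ _)⟩⟩
  choose M hM using hb
  refine ⟨∑ i, |M i|, Finset.sum_nonneg fun i _ => abs_nonneg _, fun x i => ?_⟩
  by_cases hx : |‖x‖ - R| < δ
  · rw [if_pos hx, commutatorCoeff_eq_zero (h1 x hx), (partialDeriv_eq_zero (h1 x hx) i).self_of_nhds]
    simp
  · rw [if_neg hx]
    have hle : M i ≤ ∑ i, |M i| := (le_abs_self _).trans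
      (Finset.single_le_sum (f := fun i => |M i|) (fun i _ => abs_nonneg _) (Finset.mem_univ i))
    by_cases hxs : x ∈ tsupport χ
    · obtain ⟨a, b⟩ := hM i x ⟨hxs, not_lt.1 hx⟩
      exact ⟨a.trans hle, b.trans hle⟩
    · have h0 : ∀ᶠ y in 𝓝 x, χ y = 0 := notMem_tsupport_iff_eventuallyEq.1 hxs
      rw [commutatorCoeff_eq_zero h0, (partialDeriv_eq_zero h0 i).self_of_nhds]
      rw [mul_zero, abs_zero]
      have h2 : 0 ≤ ∑ i, |M i| := Finset.sum_nonneg fun i _ => abs_nonneg (M i)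
      exact ⟨h2, h2⟩

/-- Localization of approximate solutions. -/
theorem IsGalleryCutoff.exists_helmholtz_bound (hR : 0 < R) (hn : IsOpticalIndex n R)
    (hχ : IsGalleryCutoff R χ) (p : ℤ) : ∃ δ M, 0 < δ ∧ 0 ≤ M ∧ ∀ (F : Plane → ℂ) (k : ℝ),
    ContDiffOn ℝ ∞ F {0}ᶜ → ∀ x, x ≠ 0 → ‖x‖ ≠ R →
      ‖helmholtz n p k (fun y => χ y • F y) x‖ ≤ ‖helmholtz n p k F x‖
        + (if |‖x‖ - R| < δ then 0 else M) * (‖F x‖ + ∑ i, ‖pderiv i F x‖) := by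
  obtain ⟨δ, hδ, h1⟩ := exists_one_near_interface hR hχ.one
  obtain ⟨M, hM0, hM⟩ := hχ.exists_coeff_bound hR hn p hδ h1
  refine ⟨δ, 2 * M, hδ, by positivity, fun F k hF x hx hxR => ?_⟩
  rw [helmholtz_smul hn hχ.smooth hF hx hxR]
  set m := if |‖x‖ - R| < δ then (0 : ℝ) else M with hm
  have hm0 : 0 ≤ m := by rw [hm]; split_ifs <;> [exact le_rfl; exact hM0]
  have e : (if |‖x‖ - R| < δ then (0 : ℝ) else 2 * M) = 2 * m := by
    rw [hm]; split_ifs <;> simp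
  rw [e]
  refine (norm_sub_le _ _).trans (add_le_add ?_ ?_)
  · rw [norm_smul, Real.norm_eq_abs, abs_of_nonneg (hχ.mem_Icc x).1]
    exact mul_le_of_le_one_left (norm_nonneg _) (hχ.mem_Icc x).2
  · refine (norm_sum_le _ _).trans ?_
    have hi : ∀ i, ‖commutatorCoeff n p χ i x • F x
        + (2 * n ‖x‖ ^ (p - 1) * partialDeriv i χ x) • pderiv i F x‖
          ≤ m * ‖F x‖ + m * ‖pderiv i F x‖ := fun i => by
      refine (norm_add_le _ _).trans ?_
      rw [norm_smul, norm_smul, Real.norm_eq_abs, Real.norm_eq_abs]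
      have := hM x i
      gcongr
      · exact this.1
      · exact this.2
    refine (Finset.sum_le_sum fun i _ => hi i).trans ?_
    simp only [Fin.sum_univ_two]
    have h2 := mul_nonneg hm0 (norm_nonneg (pderiv 0 F x))
    have h3 := mul_nonneg hm0 (norm_nonneg (pderiv 1 F x))
    linarith

end

/-! ### The quasi-modes -/

/-- The function `r ↦ a f(c₀ + c₁ r)`. -/
def affineProfile (f : ℝ → ℝ) (a c₀ c₁ r : ℝ) : ℝ := a * f (c₀ + c₁ * r)

theorem hasDerivAt_affineProfile {f : ℝ → ℝ} (hf : ContDiff ℝ ∞ f) (a c₀ c₁ r : ℝ) :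
    HasDerivAt (affineProfile f a c₀ c₁) (affineProfile (deriv f) (a * c₁) c₀ c₁ r) r := by
  have h1 : HasDerivAt (fun r : ℝ => c₀ + c₁ * r) c₁ r := by
    simpa using ((hasDerivAt_id r).const_mul c₁).const_add c₀
  have h2 := ((hf.differentiable (by simp)).differentiableAt.hasDerivAt.comp r h1).const_mul a
  refine h2.congr_deriv ?_
  simp only [affineProfile]
  ring

theorem contDiff_affineProfile {f : ℝ → ℝ} (hf : ContDiff ℝ ∞ f) (a c₀ c₁ : ℝ) :
    ContDiff ℝ ∞ (affineProfile f a c₀ c₁) :=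
  contDiff_const.mul (hf.comp (contDiff_const.add (contDiff_const.mul contDiff_id)))

theorem deriv_affineProfile {f : ℝ → ℝ} (hf : ContDiff ℝ ∞ f) (a c₀ c₁ : ℝ) :
    deriv (affineProfile f a c₀ c₁) = affineProfile (deriv f) (a * c₁) c₀ c₁ :=
  funext fun r => (hasDerivAt_affineProfile hf a c₀ c₁ r).deriv

theorem iteratedDeriv_two_affineProfile {f : ℝ → ℝ} (hf : ContDiff ℝ ∞ f) (a c₀ c₁ r : ℝ) :
    iteratedDeriv 2 (affineProfile f a c₀ c₁) r
      = a * c₁ ^ 2 * iteratedDeriv 2 f (c₀ + c₁ * r) := by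
  have hf' : ContDiff ℝ ∞ (deriv f) := (contDiff_infty_iff_deriv.1 hf).2
  rw [iteratedDeriv_succ, iteratedDeriv_one, deriv_affineProfile hf, deriv_affineProfile hf',
    iteratedDeriv_succ, iteratedDeriv_one, affineProfile]
  ring

/-- The interior radial factor of the quasi-modes. -/
noncomputable def interiorRadial (G : ℝ × ℝ → ℝ) (R a t : ℝ) : ℝ → ℝ :=
  affineProfile (fun x => G (t, x)) a (1 / t) (-(1 / (R * t)))

/-- The exterior radial factor of the quasi-modes. -/
noncomputable def exteriorRadial (Ψ : ℝ × ℝ → ℝ) (R a t : ℝ) : ℝ → ℝ :=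
  affineProfile (fun x => Ψ (t, x)) a (-(1 / t ^ 2)) (1 / (R * t ^ 2))

section

variable {n : ℝ → ℝ} {R : ℝ} {p : ℤ} {G Ψ : ℝ × ℝ → ℝ} {e : ℝ → ℝ}

theorem deriv_zpow_comp {f : ℝ → ℝ} {f' r : ℝ} (hf : HasDerivAt f f' r) (h0 : f r ≠ 0) (q : ℤ) :
    deriv (fun s => f s ^ q) r = q * f r ^ (q - 1) * f' :=
  ((hasDerivAt_zpow q (f r) (Or.inl h0)).comp r hf).deriv

/-- With m = t⁻², r = R(1 - tx) and the chosen k², the Helmholtz expression is exactly a multiple of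
the profile residual; writing n^{p-1} = n^{p+1}/n² produces `coefM`. -/
theorem norm_helmholtz_interior (hR : 0 < R) (hn : IsOpticalIndex n R) (hG : ContDiff ℝ ∞ G)
    {x : Plane} (hx : x ≠ 0) (hxR : ‖x‖ < R) {m : ℕ} {t a k : ℝ} (ht : 0 < t)
    (hm : (m : ℝ) * t ^ 2 = 1)
    (hk : k ^ 2 = m ^ 2 * (1 + t ^ 2 * e t) / (R ^ 2 * n R ^ 2)) :
    ‖helmholtz n p k (mode (interiorRadial G R a t) m) x‖
      = |a| * (n ‖x‖ ^ (p + 1) / (R ^ 2 * n R ^ 2 * t ^ 2))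
        * |interiorResidual n p R G e t (1 / t + -(1 / (R * t)) * ‖x‖)| := by
  have hr : 0 < ‖x‖ := norm_pos_iff.2 hx
  have hs := contDiff_slice hG t
  set r := ‖x‖ with hrdef
  have hN : 0 < n r := hn.index_pos hr.le
  have hN0 : 0 < n R := hn.index_pos hR.le
  have hcd := hn.contDiffAt hr hxR.ne
  have hdn : derivWithin n (Icc 0 R) r = deriv n r :=
    derivWithin_of_mem_nhds (Icc_mem_nhds hr hxR)
  have hdc := deriv_zpow_comp (hcd.differentiableAt (by simp)).hasDerivAt hN.ne' (p - 1)
  rw [interiorRadial, helmholtz_mode hn hx hxR.ne (contDiff_affineProfile hs _ _ _), norm_mul, norm_angular m hx,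
    mul_one, norm_neg, Complex.norm_real, Real.norm_eq_abs, ← hrdef, hdc, hk,
    iteratedDeriv_two_affineProfile hs, deriv_affineProfile hs]
  have e1 : t * (1 / t + -(1 / (R * t)) * r) = 1 - r / R := by field_simp; ring
  have e2 : 1 - (1 - r / R) = r / R := by ring
  have e2' : R * (r / R) = r := by field_simp
  have e3 : n r ^ (p - 1) = n r ^ (p + 1) / n r ^ 2 := by
    rw [show p - 1 = p + 1 - 2 by ring, zpow_sub₀ hN.ne']; norm_cast
  have e4 : n r ^ (p - 1 - 1) = n r ^ (p + 1) / n r ^ 3 := by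
    rw [show p - 1 - 1 = p + 1 - 3 by ring, zpow_sub₀ hN.ne']; norm_cast
  have hP : 0 < n r ^ (p + 1) := zpow_pos hN _
  have e5 : |a| * (n r ^ (p + 1) / (R ^ 2 * n R ^ 2 * t ^ 2))
      = |a * (n r ^ (p + 1) / (R ^ 2 * n R ^ 2 * t ^ 2))| := by
    rw [abs_mul, abs_of_pos (show 0 < n r ^ (p + 1) / (R ^ 2 * n R ^ 2 * t ^ 2) by positivity)]
  rw [e5, ← abs_mul, ← abs_neg]
  congr 1
  simp only [interiorResidual, coefB, coefT, coefM, e1, e2, e2', hdn, affineProfile, e3, e4,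
    iteratedDeriv_one]
  rw [show (m : ℝ) = 1 / t ^ 2 by field_simp; exact hm]
  generalize 1 / t + -(1 / (R * t)) * r = X
  push_cast
  field_simp
  ring

theorem norm_helmholtz_exterior (hR : 0 < R) (hn : IsOpticalIndex n R) (hΨ : ContDiff ℝ ∞ Ψ)
    {x : Plane} (hxR : R < ‖x‖) {m : ℕ} {t a k : ℝ} (ht : 0 < t)
    (hm : (m : ℝ) * t ^ 2 = 1)
    (hk : k ^ 2 = m ^ 2 * (1 + t ^ 2 * e t) / (R ^ 2 * n R ^ 2)) :
    ‖helmholtz n p k (mode (exteriorRadial Ψ R a t) m) x‖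
      = |a| * (1 / (R ^ 2 * t ^ 4))
        * |exteriorResidual n R Ψ e t (-(1 / t ^ 2) + 1 / (R * t ^ 2) * ‖x‖)| := by
  have hr : 0 < ‖x‖ := hR.trans hxR
  have hx : x ≠ 0 := norm_pos_iff.1 hr
  have hs := contDiff_slice hΨ t
  set r := ‖x‖ with hrdef
  have hN0 : 0 < n R := hn.index_pos hR.le
  have hdc : deriv (fun s => n s ^ (p - 1)) r = 0 := by
    have : (fun s => n s ^ (p - 1)) =ᶠ[𝓝 r] fun _ => 1 := by
      filter_upwards [lt_mem_nhds hxR] with s hs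
      rw [hn.eq_one s hs, one_zpow]
    rw [this.deriv_eq, deriv_const]
  rw [exteriorRadial, helmholtz_mode hn hx hxR.ne' (contDiff_affineProfile hs _ _ _), norm_mul, norm_angular m hx,
    mul_one, norm_neg, Complex.norm_real, Real.norm_eq_abs, ← hrdef, hdc, hk,
    iteratedDeriv_two_affineProfile hs, deriv_affineProfile hs, hn.eq_one r hxR,
    one_zpow, one_zpow]
  have e1 : 1 + t ^ 2 * (-(1 / t ^ 2) + 1 / (R * t ^ 2) * r) = r / R := by field_simp; ring
  have e5 : |a| * (1 / (R ^ 2 * t ^ 4)) = |a * (1 / (R ^ 2 * t ^ 4))| := by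
    rw [abs_mul, abs_of_pos (show 0 < 1 / (R ^ 2 * t ^ 4) by positivity)]
  rw [e5, ← abs_mul, ← abs_neg]
  congr 1
  simp only [exteriorResidual, e1, affineProfile, iteratedDeriv_one, nCoeff_zero]
  rw [show (m : ℝ) = 1 / t ^ 2 by field_simp; exact hm]
  generalize -(1 / t ^ 2) + 1 / (R * t ^ 2) * r = X
  field_simp
  ring

theorem abs_coord_le (x : Plane) (i : Fin 2) : |x i| ≤ ‖x‖ := by
  simpa using PiLp.norm_apply_le x i

theorem abs_rot_le (x : Plane) (i : Fin 2) : |rot x i| ≤ ‖x‖ := by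
  fin_cases i
  · simpa [rot] using abs_coord_le x 1
  · simpa [rot] using abs_coord_le x 0

/-- A gradient costs at most t⁻²: the angular frequency is m = t⁻² and the finest radial scale is
Rt². -/
theorem norm_mode_le (hR : 0 < R) {f : ℝ → ℝ} (hf : ContDiff ℝ ∞ f) {x : Plane}
    (hx : R / 2 ≤ ‖x‖) {m : ℕ} {t a c₀ c₁ B : ℝ} (ht : 0 < t) (ht1 : t ≤ 1)
    (hm : (m : ℝ) * t ^ 2 = 1) (hc : |c₁| ≤ 1 / (R * t ^ 2)) (h0 : |f (c₀ + c₁ * ‖x‖)| ≤ B)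
    (h1 : |deriv f (c₀ + c₁ * ‖x‖)| ≤ B) :
    ‖mode (affineProfile f a c₀ c₁) m x‖ + ∑ i, ‖pderiv i (mode (affineProfile f a c₀ c₁) m) x‖
      ≤ |a| * B * (1 + 6 / R) / t ^ 2 := by
  have hr : 0 < ‖x‖ := by linarith
  have hx0 : x ≠ 0 := norm_pos_iff.1 hr
  have hB : 0 ≤ B := (abs_nonneg _).trans h0
  have hm' : (m : ℝ) = 1 / t ^ 2 := by field_simp; exact hm
  have ha0 : |affineProfile f a c₀ c₁ ‖x‖| ≤ |a| * B := by
    rw [affineProfile, abs_mul]; gcongr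
  have ha1 : |deriv (affineProfile f a c₀ c₁) ‖x‖| ≤ |a| * B * (1 / (R * t ^ 2)) := by
    rw [deriv_affineProfile hf, affineProfile, abs_mul, abs_mul]
    calc |a| * |c₁| * _ ≤ |a| * (1 / (R * t ^ 2)) * B := by gcongr
      _ = _ := by ring
  have hn0 : ‖mode (affineProfile f a c₀ c₁) m x‖ ≤ |a| * B := by
    rw [mode, norm_mul, norm_angular m hx0, mul_one, Complex.norm_real]
    exact ha0
  have hn1 : ∀ i, ‖pderiv i (mode (affineProfile f a c₀ c₁) m) x‖
      ≤ |a| * B * (3 / (R * t ^ 2)) := fun i => by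
    rw [pderiv_mode hx0 (contDiff_affineProfile hf _ _ _).contDiffAt, norm_mul,
      norm_angular m hx0, mul_one]
    refine (norm_add_le _ _).trans ?_
    rw [norm_mul, norm_mul, Complex.norm_I, one_mul, Complex.norm_real, Complex.norm_real,
      Complex.norm_natCast, hm', Real.norm_eq_abs, Real.norm_eq_abs, abs_mul, abs_mul, abs_div,
      abs_div, abs_of_pos hr, abs_of_pos (pow_pos hr 2)]
    have b1 : |deriv (affineProfile f a c₀ c₁) ‖x‖| / ‖x‖ * |x i|
        ≤ |deriv (affineProfile f a c₀ c₁) ‖x‖| := by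
      rw [div_mul_eq_mul_div, div_le_iff₀ hr]
      exact mul_le_mul_of_nonneg_left (abs_coord_le x i) (abs_nonneg _)
    have b2 : |affineProfile f a c₀ c₁ ‖x‖| / ‖x‖ ^ 2 * |rot x i| ≤ |a| * B * (2 / R) := by
      calc _ ≤ |affineProfile f a c₀ c₁ ‖x‖| / ‖x‖ ^ 2 * ‖x‖ := by
            gcongr; exact abs_rot_le x i
        _ = |affineProfile f a c₀ c₁ ‖x‖| * (1 / ‖x‖) := by field_simp
        _ ≤ |a| * B * (1 / (R / 2)) := by gcongr
        _ = _ := by field_simp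
    calc _ ≤ |a| * B * (1 / (R * t ^ 2)) + 1 / t ^ 2 * (|a| * B * (2 / R)) := by
          refine add_le_add (b1.trans ha1) ?_
          gcongr
      _ = _ := by field_simp; ring
  refine (add_le_add hn0 (Finset.sum_le_sum fun i _ => hn1 i)).trans ?_
  have h2 : |a| * B ≤ |a| * B / t ^ 2 := by
    rw [le_div_iff₀ (by positivity)]
    exact mul_le_of_le_one_right (by positivity) (pow_le_one₀ ht.le ht1)
  simp only [Fin.sum_univ_two]
  calc _ ≤ |a| * B / t ^ 2 + (|a| * B * (3 / (R * t ^ 2)) + |a| * B * (3 / (R * t ^ 2))) := by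
        gcongr
    _ = _ := by field_simp; ring

end

/-! ### The quasi-pair estimate -/

/-- The small parameter `m^{-1/2}`. -/
noncomputable def smallParam (m : ℕ) : ℝ := (m : ℝ) ^ (-(1 / 2) : ℝ)

theorem smallParam_pos {m : ℕ} (hm : 1 ≤ m) : 0 < smallParam m :=
  Real.rpow_pos_of_pos (by exact_mod_cast hm) _

theorem smallParam_le_one {m : ℕ} (hm : 1 ≤ m) : smallParam m ≤ 1 :=
  Real.rpow_le_one_of_one_le_of_nonpos (by exact_mod_cast hm) (by norm_num)

theorem mul_smallParam_sq {m : ℕ} (hm : 1 ≤ m) : (m : ℝ) * smallParam m ^ 2 = 1 := by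
  have h0 : (0 : ℝ) < m := by exact_mod_cast hm
  rw [smallParam, ← Real.rpow_natCast, ← Real.rpow_mul h0.le]
  norm_num
  rw [Real.rpow_neg_one]
  field_simp

theorem smallParam_mem {m : ℕ} (hm : 1 ≤ m) : smallParam m ∈ Icc (0 : ℝ) 1 :=
  ⟨(smallParam_pos hm).le, smallParam_le_one hm⟩

/-- The wave numbers of the quasi-modes. -/
noncomputable def waveNumber (n : ℝ → ℝ) (R : ℝ) (e : ℝ → ℝ) (m : ℕ) : ℝ :=
  m * (Real.sqrt (1 + smallParam m ^ 2 * e (smallParam m)) / (R * n R))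

/-- The quasi-modes with amplitude `a` and cut-off function `χ`. -/
noncomputable def quasiMode (R : ℝ) (G Ψ : ℝ × ℝ → ℝ) (χ : Plane → ℝ) (a : ℝ) (m : ℕ) :
    Plane → ℂ :=
  glue R (fun x => χ x • mode (interiorRadial G R a (smallParam m)) m x)
    (fun x => χ x • mode (exteriorRadial Ψ R a (smallParam m)) m x)

theorem pderiv_congr_nhds {F F' : Plane → ℂ} {x : Plane} (h : F =ᶠ[𝓝 x] F') (i : Fin 2) :
    pderiv i F =ᶠ[𝓝 x] pderiv i F' := by
  filter_upwards [h.eventuallyEq_nhds] with y hy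
  rw [pderiv, pderiv, hy.fderiv_eq]

theorem helmholtz_congr {n : ℝ → ℝ} {p : ℤ} {k : ℝ} {F F' : Plane → ℂ} {x : Plane}
    (h : F =ᶠ[𝓝 x] F') : helmholtz n p k F x = helmholtz n p k F' x := by
  have h1 : ∀ i, flux n p i F =ᶠ[𝓝 x] flux n p i F' := fun i => by
    filter_upwards [pderiv_congr_nhds h i] with y hy
    rw [flux, flux, hy]
  rw [helmholtz, helmholtz, h.self_of_nhds]
  simp only [fun i => (pderiv_congr_nhds (h1 i) i).self_of_nhds]

theorem helmholtz_eq_zero {n : ℝ → ℝ} {p : ℤ} {k : ℝ} {F : Plane → ℂ} {x : Plane}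
    (h : F =ᶠ[𝓝 x] fun _ => 0) : helmholtz n p k F x = 0 := by
  have h1 : ∀ i, flux n p i (fun _ => (0 : ℂ)) = fun _ => 0 := fun i => by
    ext y; simp [flux, pderiv]
  rw [helmholtz_congr h]
  simp [helmholtz, h1, pderiv]

theorem contDiffOn_mode {w : ℝ → ℝ} (hw : ContDiff ℝ ∞ w) (m : ℕ) :
    ContDiffOn ℝ ∞ (mode w m) {0}ᶜ :=
  fun _ hy => (contDiffAt_mode hy hw.contDiffAt m).contDiffWithinAt

section

variable {n : ℝ → ℝ} {R : ℝ} {p : ℤ} {χ : Plane → ℝ} {G Ψ : ℝ × ℝ → ℝ} {e : ℝ → ℝ}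

theorem waveNumber_sq {m : ℕ} (hm : 1 ≤ m) (he : ∀ t ∈ Icc (0 : ℝ) 1, 0 < e t) :
    waveNumber n R e m ^ 2
      = m ^ 2 * (1 + smallParam m ^ 2 * e (smallParam m)) / (R ^ 2 * n R ^ 2) := by
  have := he _ (smallParam_mem hm)
  rw [waveNumber, mul_pow, div_pow, Real.sq_sqrt (by positivity)]
  ring

theorem quasiMode_eventually_zero (a : ℝ) (m : ℕ) {x : Plane} (h : ∀ᶠ y in 𝓝 x, χ y = 0) :
    quasiMode R G Ψ χ a m =ᶠ[𝓝 x] fun _ => 0 := by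
  filter_upwards [h] with y hy
  simp [quasiMode, glue, hy]

theorem IsGalleryCutoff.contDiff_smul_mode (hR : 0 < R) (hχ : IsGalleryCutoff R χ) {w : ℝ → ℝ}
    (hw : ContDiff ℝ ∞ w) (m : ℕ) : ContDiff ℝ ∞ fun x => χ x • mode w m x := by
  refine contDiff_iff_contDiffAt.2 fun x => ?_
  by_cases hx : x = 0
  · refine (contDiffAt_const (c := (0 : ℂ))).congr_of_eventuallyEq ?_
    filter_upwards [hχ.eventually_zero (x := x) (by rw [hx]; simp [hR])] with y hy
    simp [hy]
  · exact hχ.smooth.contDiffAt.smul (contDiffAt_mode hx hw.contDiffAt m)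

theorem radialDeriv_mode {w : ℝ → ℝ} {x : Plane} (hx : x ≠ 0) (hw : ContDiff ℝ ∞ w) (m : ℕ) :
    radialDeriv (mode w m) x = (deriv w ‖x‖ : ℝ) * angular m x := by
  have h0 : ((‖x‖ : ℝ) : ℂ) ≠ 0 := by exact_mod_cast norm_ne_zero_iff.2 hx
  have hs : ((‖x‖ : ℝ) : ℂ) ^ 2 = (x 0 : ℂ) ^ 2 + (x 1 : ℂ) ^ 2 := by exact_mod_cast norm_sq_eq x
  simp only [radialDeriv, fun i => pderiv_mode hx hw.contDiffAt m i, Complex.real_smul,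
    Fin.sum_univ_two, rot, Matrix.cons_val_zero, Matrix.cons_val_one]
  push_cast
  field_simp
  linear_combination (-((deriv w ‖x‖ : ℝ) : ℂ) * ‖x‖ * angular m x) * hs

theorem memDomain_quasiMode (hR : 0 < R) (hn : IsOpticalIndex n R) (hχ : IsGalleryCutoff R χ)
    (hG : ContDiff ℝ ∞ G) (hΨ : ContDiff ℝ ∞ Ψ) (hd : ∀ t, G (t, 0) = Ψ (t, 0))
    (hν : ∀ t, deriv (fun x => Ψ (t, x)) 0
      = -(n R ^ (p - 1)) * (t * deriv (fun x => G (t, x)) 0))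
    (a : ℝ) {m : ℕ} (hm : 1 ≤ m) : MemDomain n p R (quasiMode R G Ψ χ a m) := by
  set t := smallParam m with ht
  have ht0 : 0 < t := smallParam_pos hm
  have hw₁ : ContDiff ℝ ∞ (interiorRadial G R a t) :=
    contDiff_affineProfile (contDiff_slice hG t) _ _ _
  have hw₂ : ContDiff ℝ ∞ (exteriorRadial Ψ R a t) :=
    contDiff_affineProfile (contDiff_slice hΨ t) _ _ _
  have hz₁ : 1 / t + -(1 / (R * t)) * R = 0 := by field_simp; ring
  have hz₂ : -(1 / t ^ 2) + 1 / (R * t ^ 2) * R = 0 := by field_simp; ring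
  refine memDomain_glue hR hn (hχ.contDiff_smul_mode hR hw₁ m) (hχ.contDiff_smul_mode hR hw₂ m)
    hχ.compact.smul_right hχ.compact.smul_right (fun x hx => ?_) (fun x hx => ?_)
  · have hx' : ‖x‖ = R := hx
    rw [mode, mode, hx', interiorRadial, exteriorRadial, affineProfile, affineProfile, hz₁, hz₂, hd]
  · have hx' : ‖x‖ = R := hx
    have hx0 : x ≠ 0 := norm_pos_iff.1 (by rw [hx']; exact hR)
    have h1 : ∀ᶠ y in 𝓝 x, χ y = 1 := eventually_nhdsSet_iff_forall.1 hχ.one x hx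
    have hloc : ∀ w : ℝ → ℝ, ContDiff ℝ ∞ w → radialDeriv (fun x => χ x • mode w m x) x
        = (deriv w R : ℝ) * angular m x := fun w hw => by
      rw [← hx', ← radialDeriv_mode hx0 hw m, radialDeriv, radialDeriv]
      have : (fun x => χ x • mode w m x) =ᶠ[𝓝 x] mode w m := by
        filter_upwards [h1] with y hy
        rw [hy, one_smul]
      simp only [fun i => (pderiv_congr_nhds this i).self_of_nhds]
    rw [hloc _ hw₁, hloc _ hw₂, interiorRadial, exteriorRadial,
      deriv_affineProfile (contDiff_slice hG t), deriv_affineProfile (contDiff_slice hΨ t),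
      affineProfile, affineProfile, hz₁, hz₂, hν, Complex.real_smul, ← mul_assoc,
      ← Complex.ofReal_mul]
    -- The chain-rule factors -1/(Rt) and 1/(Rt²) account for the factor -t in the Neumann relation.
    congr 2
    field_simp

/-- The residual contributes through χ and the commutator only at distance at least δ from the
circle, where the tails are small. The estimate is linear in the amplitude, which is fixed later by
normalization. -/
theorem quasiMode_helmholtz_bound (hR : 0 < R) (hn : IsOpticalIndex n R)
    (hχ : IsGalleryCutoff R χ) {g ψ : ℕ → 𝓢(ℝ, ℝ)} (hG : IsProfile G g) (hΨ : IsProfile Ψ ψ)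
    (he : ∀ t ∈ Icc (0 : ℝ) 1, 0 < e t)
    (hin : ∀ N : ℕ, ∃ C, ∀ t x, 0 < t → t ≤ 1 → 0 ≤ x → t * x ≤ 1 / 2 →
      |interiorResidual n p R G e t x| ≤ C * t ^ N)
    (hex : ∀ N : ℕ, ∃ C, ∀ t x, 0 < t → t ≤ 1 → 0 ≤ x →
      |exteriorResidual n R Ψ e t x| ≤ C * t ^ N) (N : ℕ) :
    ∃ C, ∀ (a : ℝ) (m : ℕ), 1 ≤ m → ∀ x ∈ (interface R)ᶜ,
      ‖helmholtz n p (waveNumber n R e m) (quasiMode R G Ψ χ a m) x‖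
        ≤ C * |a| * smallParam m ^ N := by
  obtain ⟨δ, M, hδ, hM, hloc⟩ := hχ.exists_helmholtz_bound hR hn p
  -- The surplus powers, N + 2 here and N + 4 outside, pay for the rescaling factors t⁻² and t⁻⁴;
  -- the tails below need N + 2 because of the gradient.
  obtain ⟨C₁, hC₁⟩ := hin (N + 2)
  obtain ⟨C₂, hC₂⟩ := hex (N + 4)
  have hδR : 0 < δ / R := by positivity
  obtain ⟨G₀, hG₀p, hG₀⟩ := hG.exists_tail_bound 0 (N + 2) hδR
  obtain ⟨G₁, hG₁p, hG₁⟩ := hG.exists_tail_bound 1 (N + 2) hδR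
  obtain ⟨Ψ₀, hΨ₀p, hΨ₀⟩ := hΨ.exists_tail_bound 0 (N + 2) hδR
  obtain ⟨Ψ₁, hΨ₁p, hΨ₁⟩ := hΨ.exists_tail_bound 1 (N + 2) hδR
  simp only [iteratedDeriv_zero, iteratedDeriv_one] at hG₀ hG₁ hΨ₀ hΨ₁
  have hnR : 0 < n R := hn.index_pos hR.le
  obtain ⟨P, hP⟩ := isCompact_Icc.exists_bound_of_continuousOn (s := Icc 0 R)
    (f := fun r => n r ^ (p + 1))
    (hn.smooth.continuousOn.zpow₀ _ fun r hr => Or.inl (hn.pos hr).ne')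
  have hP0 : 0 ≤ P := (norm_nonneg _).trans (hP 0 ⟨le_rfl, hR.le⟩)
  set D₁ := P / (R ^ 2 * n R ^ 2) * |C₁| with hD₁
  set D₂ := 1 / R ^ 2 * |C₂| with hD₂
  set L := M * (G₀ + G₁ + Ψ₀ + Ψ₁) * (1 + 6 / R) with hL
  have hL0 : 0 ≤ L := by positivity
  refine ⟨D₁ + D₂ + L, fun a m hm x hx => ?_⟩
  set t := smallParam m with ht
  have ht0 : 0 < t := smallParam_pos hm
  have ht1 : t ≤ 1 := smallParam_le_one hm
  have hmt : (m : ℝ) * t ^ 2 = 1 := mul_smallParam_sq hm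
  have hk := waveNumber_sq (n := n) (R := R) hm he
  rw [← ht] at hk
  by_cases hx2 : ‖x‖ < R / 2
  · rw [helmholtz_eq_zero (quasiMode_eventually_zero a m (hχ.eventually_zero hx2)), norm_zero]
    positivity
  rw [not_lt] at hx2
  have hx0 : x ≠ 0 := norm_pos_iff.1 (by linarith)
  set B := (G₀ + G₁ + Ψ₀ + Ψ₁) * t ^ (N + 2) with hB
  have hB0 : 0 ≤ B := by positivity
  have htN : 0 ≤ t ^ (N + 2) := by positivity
  have htail : ∀ (f : ℝ → ℝ) (c₀ c₁ : ℝ), ContDiff ℝ ∞ f → |c₁| ≤ 1 / (R * t ^ 2) →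
      (δ ≤ |‖x‖ - R| → |f (c₀ + c₁ * ‖x‖)| ≤ B ∧ |deriv f (c₀ + c₁ * ‖x‖)| ≤ B) →
      (if |‖x‖ - R| < δ then 0 else M) * (‖mode (affineProfile f a c₀ c₁) m x‖
        + ∑ i, ‖pderiv i (mode (affineProfile f a c₀ c₁) m) x‖) ≤ L * |a| * t ^ N := by
    intro f c₀ c₁ hf hc hb
    split_ifs with h
    · rw [zero_mul]; positivity
    · obtain ⟨h1, h2⟩ := hb (not_lt.1 h)
      calc _ ≤ M * (|a| * B * (1 + 6 / R) / t ^ 2) := by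
            gcongr
            exact norm_mode_le hR hf hx2 ht0 ht1 hmt hc h1 h2
        _ = _ := by rw [hB, hL, pow_add]; field_simp
  rw [compl_interface] at hx
  rcases hx with hx | hx
  · have hxR : ‖x‖ < R := hx
    have hX0 : 0 ≤ 1 / t + -(1 / (R * t)) * ‖x‖ := by
      have : 1 / t + -(1 / (R * t)) * ‖x‖ = (R - ‖x‖) / (R * t) := by field_simp; ring
      rw [this]
      exact div_nonneg (by linarith) (by positivity)
    have htX : t * (1 / t + -(1 / (R * t)) * ‖x‖) = (R - ‖x‖) / R := by field_simp; ring
    have hsm : ContDiff ℝ ∞ (interiorRadial G R a t) :=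
      contDiff_affineProfile (contDiff_slice hG.smooth t) _ _ _
    rw [quasiMode, helmholtz_congr ((eqOn_glue_cavity R _ _).eventuallyEq_of_mem
      ((isOpen_cavity R).mem_nhds hx))]
    refine (hloc _ _ (contDiffOn_mode hsm m) x hx0 hxR.ne).trans ?_
    have h1 : ‖helmholtz n p (waveNumber n R e m) (mode (interiorRadial G R a t) m) x‖
        ≤ D₁ * |a| * t ^ N := by
      rw [norm_helmholtz_interior hR hn hG.smooth hx0 hxR ht0 hmt hk]
      have h2 := hC₁ t _ ht0 ht1 hX0 (by
        rw [htX, div_le_iff₀ hR]; linarith)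
      have h3 : n ‖x‖ ^ (p + 1) ≤ P := (le_abs_self _).trans (hP _ ⟨norm_nonneg x, hxR.le⟩)
      calc _ ≤ |a| * (P / (R ^ 2 * n R ^ 2 * t ^ 2)) * (|C₁| * t ^ (N + 2)) := by
            gcongr
            exact h2.trans (mul_le_mul_of_nonneg_right (le_abs_self _) htN)
        _ = _ := by rw [hD₁, pow_add]; field_simp
    have h2 := htail (fun x => G (t, x)) (1 / t) (-(1 / (R * t))) (contDiff_slice hG.smooth t)
      (by
        rw [abs_neg, abs_of_pos (by positivity)]
        gcongr
        rw [pow_two]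
        exact mul_le_of_le_one_left ht0.le ht1) (fun hd => by
        have hd' : δ / R ≤ t * (1 / t + -(1 / (R * t)) * ‖x‖) := by
          rw [htX]
          rw [abs_of_neg (by linarith)] at hd
          gcongr
          linarith
        have b0 := hG₀ t ht0 ht1 _ hd'
        have b1 := hG₁ t ht0 ht1 _ hd'
        constructor
        · refine b0.trans (mul_le_mul_of_nonneg_right ?_ htN)
          linarith
        · refine b1.trans (mul_le_mul_of_nonneg_right ?_ htN)
          linarith)
    have h3 : 0 ≤ D₂ * |a| * t ^ N := by positivity
    calc _ ≤ D₁ * |a| * t ^ N + L * |a| * t ^ N := add_le_add h1 h2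
      _ ≤ _ := by linarith
  · have hxR : R < ‖x‖ := hx
    have hX0 : 0 ≤ -(1 / t ^ 2) + 1 / (R * t ^ 2) * ‖x‖ := by
      have : -(1 / t ^ 2) + 1 / (R * t ^ 2) * ‖x‖ = (‖x‖ - R) / (R * t ^ 2) := by
        field_simp; ring
      rw [this]
      exact div_nonneg (by linarith) (by positivity)
    have htX : t * (t * (-(1 / t ^ 2) + 1 / (R * t ^ 2) * ‖x‖)) = (‖x‖ - R) / R := by
      field_simp; ring
    have hsm : ContDiff ℝ ∞ (exteriorRadial Ψ R a t) :=
      contDiff_affineProfile (contDiff_slice hΨ.smooth t) _ _ _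
    rw [quasiMode, helmholtz_congr ((eqOn_glue_exterior R _ _).eventuallyEq_of_mem
      ((isOpen_exterior R).mem_nhds hx))]
    refine (hloc _ _ (contDiffOn_mode hsm m) x hx0 hxR.ne').trans ?_
    have h1 : ‖helmholtz n p (waveNumber n R e m) (mode (exteriorRadial Ψ R a t) m) x‖
        ≤ D₂ * |a| * t ^ N := by
      rw [norm_helmholtz_exterior hR hn hΨ.smooth hxR ht0 hmt hk]
      have h2 := hC₂ t _ ht0 ht1 hX0
      calc _ ≤ |a| * (1 / (R ^ 2 * t ^ 4)) * (|C₂| * t ^ (N + 4)) := by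
            gcongr
            exact h2.trans (mul_le_mul_of_nonneg_right (le_abs_self _) (by positivity))
        _ = _ := by rw [hD₂, pow_add]; field_simp
    have h2 := htail (fun x => Ψ (t, x)) (-(1 / t ^ 2)) (1 / (R * t ^ 2))
      (contDiff_slice hΨ.smooth t) (by rw [abs_of_pos (by positivity)]) (fun hd => by
        -- The natural bound is t²ρ ≥ δ/R; since t ≤ 1 it implies the condition tρ ≥ δ/R of the tail
        -- estimate.
        have hd' : δ / R ≤ t * (-(1 / t ^ 2) + 1 / (R * t ^ 2) * ‖x‖) := by
          rw [abs_of_pos (by linarith)] at hd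
          have h4 : δ / R ≤ t * (t * (-(1 / t ^ 2) + 1 / (R * t ^ 2) * ‖x‖)) := by
            rw [htX]; gcongr
          exact h4.trans (mul_le_of_le_one_left (mul_nonneg ht0.le hX0) ht1)
        have b0 := hΨ₀ t ht0 ht1 _ hd'
        have b1 := hΨ₁ t ht0 ht1 _ hd'
        constructor
        · refine b0.trans (mul_le_mul_of_nonneg_right ?_ htN)
          linarith
        · refine b1.trans (mul_le_mul_of_nonneg_right ?_ htN)
          linarith)
    have h3 : 0 ≤ D₁ * |a| * t ^ N := by positivity
    calc _ ≤ D₂ * |a| * t ^ N + L * |a| * t ^ N := add_le_add h1 h2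
      _ ≤ _ := by linarith

end

/-! ### Norms of the quasi-modes -/

theorem tendsto_smallParam : Tendsto smallParam atTop (𝓝 0) :=
  (tendsto_rpow_neg_atTop (by norm_num : (0 : ℝ) < 1 / 2)).comp tendsto_natCast_atTop_atTop

theorem zpow_neg_eq_smallParam {m : ℕ} (hm : 1 ≤ m) (N : ℕ) :
    (m : ℝ) ^ (-(N : ℤ)) = smallParam m ^ (2 * N) := by
  have h0 : (0 : ℝ) < m := by exact_mod_cast hm
  have h1 : smallParam m ^ 2 = (m : ℝ)⁻¹ :=
    eq_inv_of_mul_eq_one_right (mul_smallParam_sq hm)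
  rw [pow_mul, h1, zpow_neg, zpow_natCast, inv_pow]

section

variable {n : ℝ → ℝ} {R : ℝ} {p : ℤ} {χ : Plane → ℝ} {G Ψ : ℝ × ℝ → ℝ} {e : ℝ → ℝ}

theorem quasiMode_contDiffOn (hR : 0 < R) (hχ : IsGalleryCutoff R χ) (hG : ContDiff ℝ ∞ G)
    (hΨ : ContDiff ℝ ∞ Ψ) (a : ℝ) (m : ℕ) :
    ContDiffOn ℝ ∞ (quasiMode R G Ψ χ a m) (interface R)ᶜ :=
  contDiffOn_glue
    (hχ.contDiff_smul_mode hR (contDiff_affineProfile (contDiff_slice hG _) _ _ _) m)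
    (hχ.contDiff_smul_mode hR (contDiff_affineProfile (contDiff_slice hΨ _) _ _ _) m)

theorem IsGalleryCutoff.exists_radius (hχ : IsGalleryCutoff R χ) :
    ∃ ρ, ∀ x, ρ < ‖x‖ → ∀ᶠ y in 𝓝 x, χ y = 0 := by
  obtain ⟨ρ, hρ⟩ := hχ.compact.isBounded.subset_closedBall 0
  refine ⟨ρ, fun x hx => notMem_tsupport_iff_eventuallyEq.1 fun h => ?_⟩
  have := hρ h
  rw [mem_closedBall_zero_iff] at this
  linarith

theorem quasiPairEstimate_quasiMode (hR : 0 < R) (hn : IsOpticalIndex n R)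
    (hχ : IsGalleryCutoff R χ) {g ψ : ℕ → 𝓢(ℝ, ℝ)} {E : ℕ → ℝ}
    (hX : ExactProfiles n p R g ψ E G Ψ e)
    (hin : ∀ N : ℕ, ∃ C, ∀ t x, 0 < t → t ≤ 1 → 0 ≤ x → t * x ≤ 1 / 2 →
      |interiorResidual n p R G e t x| ≤ C * t ^ N)
    (hex : ∀ N : ℕ, ∃ C, ∀ t x, 0 < t → t ≤ 1 → 0 ≤ x →
      |exteriorResidual n R Ψ e t x| ≤ C * t ^ N) {a : ℕ → ℝ} {A : ℝ}
    (ha : ∀ m, 1 ≤ m → |a m| ≤ A * m) :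
    QuasiPairEstimate n p R (waveNumber n R e) fun m => quasiMode R G Ψ χ (a m) m := by
  have hGs := hX.interior.smooth
  have hΨs := hX.exterior.smooth
  have hu := fun m => quasiMode_contDiffOn hR hχ hGs hΨs (a m) m
  have h0 : ∀ m, ∀ᶠ x in 𝓝 0, quasiMode R G Ψ χ (a m) m x = 0 := fun m =>
    quasiMode_eventually_zero (a m) m (hχ.eventually_zero (by simp [hR]))
  obtain ⟨ρ, hρ⟩ := hχ.exists_radius
  have hfin : ∀ m, ∀ x ∈ (interface R)ᶜ, ρ < ‖x‖ →
      helmholtz n p (waveNumber n R e m) (quasiMode R G Ψ χ (a m) m) x = 0 := fun m x _ hx =>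
    helmholtz_eq_zero (quasiMode_eventually_zero (a m) m (hρ x hx))
  have hb := quasiMode_helmholtz_bound hR hn hχ hX.interior hX.exterior hX.energy_pos hin hex
  refine ⟨fun m hm => memDomain_quasiMode hR hn hχ hGs hΨs hX.dirichlet
    (fun t => by rw [hX.neumann, nCoeff_zero]) (a m) hm,
    fun m => helmholtz n p (waveNumber n R e m) (quasiMode R G Ψ χ (a m) m), fun m hm => ⟨?_, ?_⟩,
    fun N => ?_⟩
  · obtain ⟨C, hC⟩ := hb 0
    exact (memLp_of_bound hR (continuousOn_helmholtz hR hn (hu m) (h0 m) _) (hC (a m) m hm)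
      (hfin m)).1
  · exact isHelmholtzResidual_helmholtz hR hn (hu m) (h0 m) _
  -- The power t^{2N} is m^{-N}, and the remaining t² compensates |a m| ≤ A m.
  · obtain ⟨C, hC⟩ := hb (2 * N + 2)
    set V := (volume (Metric.closedBall (0 : Plane) ρ) ^ (2 : ℝ≥0∞).toReal⁻¹).toReal with hV
    have hV0 : 0 ≤ V := ENNReal.toReal_nonneg
    refine ⟨V * (|C| * |A|), fun m hm => ?_⟩
    have h1 := (memLp_of_bound hR (continuousOn_helmholtz (p := p) hR hn (hu m) (h0 m)
      (waveNumber n R e m)) (hC (a m) m hm) (hfin m)).2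
    rw [← hV] at h1
    have ht := (smallParam_pos hm).le
    rw [abs_of_nonneg ENNReal.toReal_nonneg, zpow_neg_eq_smallParam hm]
    have h2 : |C * |a m| * smallParam m ^ (2 * N + 2)| ≤ |C| * |A| * smallParam m ^ (2 * N) := by
      rw [abs_mul, abs_mul, abs_abs, abs_of_nonneg (pow_nonneg ht _)]
      have h3 : |a m| ≤ |A| * m := (ha m hm).trans
        (mul_le_mul_of_nonneg_right (le_abs_self A) (Nat.cast_nonneg m))
      calc _ ≤ |C| * (|A| * m) * smallParam m ^ (2 * N + 2) := by gcongr
        _ = |C| * |A| * smallParam m ^ (2 * N) * (m * smallParam m ^ 2) := by rw [pow_add]; ring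
        _ = _ := by rw [mul_smallParam_sq hm, mul_one]
    calc _ ≤ V * |C * |a m| * smallParam m ^ (2 * N + 2)| := h1
      _ ≤ V * (|C| * |A| * smallParam m ^ (2 * N)) := by gcongr
      _ = _ := by ring

theorem quasiMode_tail (hR : 0 < R) (hχ : IsGalleryCutoff R χ) {g ψ : ℕ → 𝓢(ℝ, ℝ)}
    (hG : IsProfile G g) (hΨ : IsProfile Ψ ψ) {δ : ℝ} (hδ : 0 < δ) (N : ℕ) :
    ∃ C, ∀ (a : ℝ) (m : ℕ), 1 ≤ m → ∀ x, δ ≤ |‖x‖ - R| →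
      ‖quasiMode R G Ψ χ a m x‖ ≤ C * |a| * smallParam m ^ N := by
  have hδR : 0 < δ / R := by positivity
  obtain ⟨G₀, hG₀p, hG₀⟩ := hG.exists_tail_bound 0 N hδR
  obtain ⟨Ψ₀, hΨ₀p, hΨ₀⟩ := hΨ.exists_tail_bound 0 N hδR
  simp only [iteratedDeriv_zero] at hG₀ hΨ₀
  refine ⟨G₀ + Ψ₀, fun a m hm x hx => ?_⟩
  set t := smallParam m with ht
  have ht0 : 0 < t := smallParam_pos hm
  have ht1 : t ≤ 1 := smallParam_le_one hm
  have hang : ‖angular m x‖ ≤ 1 := by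
    by_cases hx0 : x = 0
    · rcases m with _ | m
      · simp [angular]
      · simp [angular, hx0]
    · exact (norm_angular m hx0).le
  have key : ∀ w : ℝ → ℝ, |w ‖x‖| ≤ (G₀ + Ψ₀) * |a| * t ^ N →
      ‖χ x • mode w m x‖ ≤ (G₀ + Ψ₀) * |a| * t ^ N := fun w hw => by
    rw [norm_smul, Real.norm_eq_abs, abs_of_nonneg (hχ.mem_Icc x).1, mode, norm_mul,
      Complex.norm_real, Real.norm_eq_abs]
    calc _ ≤ 1 * (|w ‖x‖| * 1) := by
          gcongr
          exact (hχ.mem_Icc x).2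
      _ ≤ _ := by rw [one_mul, mul_one]; exact hw
  rw [quasiMode, glue]
  split_ifs with h
  · refine key _ ?_
    have hX : δ / R ≤ t * (1 / t + -(1 / (R * t)) * ‖x‖) := by
      have : t * (1 / t + -(1 / (R * t)) * ‖x‖) = (R - ‖x‖) / R := by field_simp; ring
      rw [this]
      rw [abs_of_neg (by linarith)] at hx
      gcongr
      linarith
    rw [interiorRadial, affineProfile, abs_mul]
    calc _ ≤ |a| * (G₀ * t ^ N) := by gcongr; exact hG₀ t ht0 ht1 _ hX
      _ ≤ |a| * ((G₀ + Ψ₀) * t ^ N) := by gcongr; linarith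
      _ = _ := by ring
  · refine key _ ?_
    have hX : δ / R ≤ t * (-(1 / t ^ 2) + 1 / (R * t ^ 2) * ‖x‖) := by
      have h2 : t * (t * (-(1 / t ^ 2) + 1 / (R * t ^ 2) * ‖x‖)) = (‖x‖ - R) / R := by
        field_simp; ring
      have h3 : 0 ≤ -(1 / t ^ 2) + 1 / (R * t ^ 2) * ‖x‖ := by
        have : -(1 / t ^ 2) + 1 / (R * t ^ 2) * ‖x‖ = (‖x‖ - R) / (R * t ^ 2) := by
          field_simp; ring
        rw [this]
        exact div_nonneg (by linarith) (by positivity)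
      rw [abs_of_nonneg (by linarith)] at hx
      have h4 : δ / R ≤ t * (t * (-(1 / t ^ 2) + 1 / (R * t ^ 2) * ‖x‖)) := by
        rw [h2]; gcongr
      exact h4.trans (mul_le_of_le_one_left (mul_nonneg ht0.le h3) ht1)
    rw [exteriorRadial, affineProfile, abs_mul]
    calc _ ≤ |a| * (Ψ₀ * t ^ N) := by gcongr; exact hΨ₀ t ht0 ht1 _ hX
      _ ≤ |a| * ((G₀ + Ψ₀) * t ^ N) := by gcongr; linarith
      _ = _ := by ring

theorem quasiMode_smul (a : ℝ) (m : ℕ) :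
    quasiMode R G Ψ χ a m = a • quasiMode R G Ψ χ 1 m := by
  ext x
  simp only [quasiMode, glue, Pi.smul_apply, mode, interiorRadial, exteriorRadial, affineProfile,
    Complex.real_smul]
  split_ifs <;> push_cast <;> ring

/-- A second cut-off only replaces χ by Xχ, so the estimates apply again with the same amplitudes.
-/
theorem quasiMode_mul (X : Plane → ℝ) (a : ℝ) (m : ℕ) :
    (fun x => X x • quasiMode R G Ψ χ a m x) = quasiMode R G Ψ (fun x => X x * χ x) a m := by
  ext x
  simp only [quasiMode, glue]
  split_ifs <;> rw [mul_smul]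

/-- The profile is at least δ in modulus on an annulus of width of order t. A disc of radius of
order t inside it already gives a lower bound polynomial in t, which is enough against residuals of
order t^∞. -/
theorem eLpNorm_quasiMode_lower (hR : 0 < R)
    (hχ1 : ∀ x, |‖x‖ - R| ≤ R / 4 → χ x = 1)
    (hlow : ∃ x₁ x₂ δ : ℝ, 0 < x₁ ∧ x₁ < x₂ ∧ x₂ < 1 / 4 ∧ 0 < δ ∧ ∀ t ∈ Icc (0 : ℝ) 1,
      ∀ x ∈ Icc x₁ x₂, δ ≤ |G (t, x)|) :
    ∃ c : ℝ, 0 < c ∧ ∀ m, 1 ≤ m →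
      ENNReal.ofReal (c * smallParam m) ≤ eLpNorm (quasiMode R G Ψ χ 1 m) 2 volume := by
  obtain ⟨x₁, x₂, δ, hx₁, h12, hx₂, hδ, hG⟩ := hlow
  set V := (volume (Metric.ball (0 : Plane) 1)).toReal with hV
  have hVtop : volume (Metric.ball (0 : Plane) 1) ≠ ⊤ := measure_ball_lt_top.ne
  have hV0 : 0 < V :=
    ENNReal.toReal_pos (Metric.measure_ball_pos volume (0 : Plane) one_pos).ne' hVtop
  refine ⟨δ * (R * ((x₂ - x₁) / 2)) * Real.sqrt V, by
    have : 0 < x₂ - x₁ := by linarith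
    positivity, fun m hm => ?_⟩
  set t := smallParam m with ht
  have ht0 : 0 < t := smallParam_pos hm
  have ht1 : t ≤ 1 := smallParam_le_one hm
  set ρ := R * t * ((x₂ - x₁) / 2) with hρ
  have hρ0 : 0 < ρ := by
    have : 0 < x₂ - x₁ := by linarith
    positivity
  set c := polarPoint (R * (1 - t * ((x₁ + x₂) / 2))) 0 with hc
  have hcn : ‖c‖ = R * (1 - t * ((x₁ + x₂) / 2)) := by
    refine norm_polarPoint (mul_nonneg hR.le ?_) 0
    nlinarith
  have hball : ∀ x ∈ Metric.ball c ρ, δ ≤ ‖quasiMode R G Ψ χ 1 m x‖ := fun x hx => by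
    have h1 : |‖x‖ - ‖c‖| < ρ :=
      (abs_norm_sub_norm_le x c).trans_lt (by rwa [mem_ball_iff_norm] at hx)
    rw [hcn, abs_lt, hρ] at h1
    have hp1 : 0 < R * t * x₁ := by positivity
    have hp2 : R * t * x₂ ≤ R * (1 / 4) := by
      have : t * x₂ ≤ 1 * (1 / 4) := mul_le_mul ht1 hx₂.le (by linarith) zero_le_one
      nlinarith
    have hr1 : ‖x‖ < R := by nlinarith
    have hr2 : R - ‖x‖ ≤ R / 4 := by nlinarith
    have hx0 : x ≠ 0 := norm_pos_iff.1 (by linarith)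
    have hX : 1 / t + -(1 / (R * t)) * ‖x‖ ∈ Icc x₁ x₂ := by
      have : 1 / t + -(1 / (R * t)) * ‖x‖ = (R - ‖x‖) / (R * t) := by field_simp; ring
      rw [this]
      constructor
      · rw [le_div_iff₀ (by positivity)]; nlinarith
      · rw [div_le_iff₀ (by positivity)]; nlinarith
    have h2 := hG t ⟨ht0.le, ht1⟩ _ hX
    rw [quasiMode, glue, if_pos hr1, hχ1 x (by rw [abs_of_neg (by linarith)]; linarith), one_smul,
      mode, norm_mul, norm_angular m hx0, mul_one, Complex.norm_real, interiorRadial,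
      affineProfile, one_mul]
    exact h2
  have h1 : eLpNorm ((Metric.ball c ρ).indicator fun _ => δ) 2 volume
      ≤ eLpNorm (quasiMode R G Ψ χ 1 m) 2 volume := by
    refine eLpNorm_mono fun x => ?_
    by_cases hx : x ∈ Metric.ball c ρ
    · rw [indicator_of_mem hx, Real.norm_eq_abs, abs_of_pos hδ]
      exact hball x hx
    · rw [indicator_of_notMem hx, norm_zero]; exact norm_nonneg _
  refine le_trans (le_of_eq ?_) h1
  rw [eLpNorm_indicator_const Metric.isOpen_ball.measurableSet (by norm_num) (by norm_num),
    Measure.addHaar_ball_of_pos _ _ hρ0, ← ENNReal.ofReal_toReal hVtop, ← hV,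
    ← ENNReal.ofReal_mul (by positivity), ENNReal.ofReal_rpow_of_nonneg (by positivity) (by norm_num),
    Real.enorm_eq_ofReal hδ.le, ← ENNReal.ofReal_mul hδ.le]
  congr 1
  have hfr : Module.finrank ℝ Plane = 2 := by simp
  rw [hfr, show (1 / (2 : ℝ≥0∞).toReal) = 1 / 2 by norm_num, ← Real.sqrt_eq_rpow,
    Real.sqrt_mul (by positivity), Real.sqrt_sq hρ0.le, hρ]
  ring

end

/-! ### Radial cut-off functions -/

theorem exists_radial_cutoff {R : ℝ} (hR : 0 < R) : ∃ X : ℝ → ℝ, ContDiff ℝ ∞ X ∧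
    HasCompactSupport X ∧ tsupport X ⊆ Ioi 0 ∧ (∀ᶠ r in 𝓝 R, X r = 1) ∧
    (∀ r, |r - R| ≤ R / 4 → X r = 1) ∧ (∀ r, 2 * R ≤ r → X r = 0) ∧
    IsGalleryCutoff R fun x => X ‖x‖ := by
  let b : ContDiffBump R := ⟨R / 4, R / 2, by positivity, by linarith⟩
  have hz : ∀ r, R / 2 ≤ |r - R| → b r = 0 := fun r hr =>
    b.zero_of_le_dist (by rw [Real.dist_eq]; exact hr)
  have h1 : ∀ r, |r - R| ≤ R / 4 → b r = 1 := fun r hr =>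
    b.one_of_mem_closedBall (by rw [Metric.mem_closedBall, Real.dist_eq]; exact hr)
  have hlow : ∀ r, r ≤ R / 2 → b r = 0 := fun r hr => hz r (by
    rw [abs_of_neg (by linarith)]; linarith)
  have hup : ∀ r, 2 * R ≤ r → b r = 0 := fun r hr => hz r (by
    rw [abs_of_nonneg (by linarith)]; linarith)
  refine ⟨b, b.contDiff, b.hasCompactSupport, ?_, b.eventuallyEq_one, h1, hup, ?_⟩
  · rw [b.tsupport_eq]
    intro r hr
    have : |r - R| ≤ R / 2 := by rwa [Metric.mem_closedBall, Real.dist_eq] at hr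
    rw [mem_Ioi]
    linarith [(abs_le.1 this).1]
  · refine ⟨contDiff_iff_contDiffAt.2 fun x => ?_, ?_, fun x => ⟨b.nonneg, b.le_one⟩,
      fun x hx => hlow _ hx, ?_⟩
    · by_cases hx : x = 0
      · refine (contDiffAt_const (c := (0 : ℝ))).congr_of_eventuallyEq ?_
        have h0 : ‖x‖ < R / 2 := by rw [hx, norm_zero]; positivity
        filter_upwards [(isOpen_lt continuous_norm continuous_const).mem_nhds h0] with y hy
          using hlow _ (le_of_lt hy)
      · exact b.contDiff.contDiffAt.comp x (contDiffAt_norm ℝ hx)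
    · refine HasCompactSupport.intro (isCompact_closedBall (0 : Plane) (2 * R)) fun x hx => ?_
      rw [mem_closedBall_zero_iff, not_le] at hx
      exact hup _ hx.le
    · refine eventually_nhdsSet_iff_forall.2 fun x hx => ?_
      have hx' : ‖x‖ = R := hx
      have : ∀ᶠ r in 𝓝 ‖x‖, b r = 1 := by rw [hx']; exact b.eventuallyEq_one
      exact continuous_norm.continuousAt.eventually this

theorem exists_plane_cutoff {R : ℝ} (hR : 0 < R) :
    ∃ X : Plane → ℝ, IsCutoff X ∧ ∀ x, ‖x‖ ≤ 2 * R → X x = 1 := by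
  let b : ContDiffBump (0 : Plane) := ⟨2 * R, 3 * R, by positivity, by linarith⟩
  exact ⟨b, ⟨b.contDiff, b.hasCompactSupport, fun x => ⟨b.nonneg, b.le_one⟩⟩, fun x hx =>
    b.one_of_mem_closedBall (mem_closedBall_zero_iff.2 hx)⟩

theorem IsGalleryCutoff.mul {R : ℝ} {χ X : Plane → ℝ} (hχ : IsGalleryCutoff R χ)
    (hX : IsCutoff X) (h1 : ∀ᶠ x in 𝓝ˢ (interface R), X x = 1) :
    IsGalleryCutoff R fun x => X x * χ x where
  smooth := hX.1.mul hχ.smooth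
  compact := hX.2.1.mul_right
  mem_Icc x := ⟨mul_nonneg (hX.2.2 x).1 (hχ.mem_Icc x).1,
    mul_le_one₀ (hX.2.2 x).2 (hχ.mem_Icc x).1 (hχ.mem_Icc x).2⟩
  zero x hx := by rw [hχ.zero x hx, mul_zero]
  one := by
    filter_upwards [h1, hχ.one] with x h2 h3
    rw [h2, h3, one_mul]

/-! ### The whispering gallery family -/

section

variable {n : ℝ → ℝ} {R : ℝ} {p : ℤ} {χ : Plane → ℝ} {G Ψ : ℝ × ℝ → ℝ} {e : ℝ → ℝ}

/-- The factor that normalizes the quasi-modes. -/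
noncomputable def normalizer (R : ℝ) (G Ψ : ℝ × ℝ → ℝ) (χ : Plane → ℝ) (m : ℕ) : ℝ :=
  (eLpNorm (quasiMode R G Ψ χ 1 m) 2 volume).toReal⁻¹

theorem normalizer_spec {m : ℕ} {s : ℝ} (hs : 0 < s)
    (hlow : ENNReal.ofReal s ≤ eLpNorm (quasiMode R G Ψ χ 1 m) 2 volume)
    (htop : eLpNorm (quasiMode R G Ψ χ 1 m) 2 volume ≠ ⊤) :
    0 < normalizer R G Ψ χ m ∧ normalizer R G Ψ χ m ≤ s⁻¹ ∧
      eLpNorm (quasiMode R G Ψ χ (normalizer R G Ψ χ m) m) 2 volume = 1 := by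
  set L := eLpNorm (quasiMode R G Ψ χ 1 m) 2 volume with hL
  have h1 : s ≤ L.toReal := (ENNReal.ofReal_le_iff_le_toReal htop).1 hlow
  have h0 : 0 < L.toReal := hs.trans_le h1
  refine ⟨inv_pos.2 h0, inv_anti₀ hs h1, ?_⟩
  rw [quasiMode_smul, eLpNorm_const_smul, normalizer, ← hL,
    Real.enorm_eq_ofReal (inv_nonneg.2 h0.le), ENNReal.ofReal_inv_of_pos h0,
    ENNReal.ofReal_toReal htop]
  exact ENNReal.inv_mul_cancel (fun h => by rw [h] at h0; simp at h0) htop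

/-- By the triangle inequality 1 ≤ ‖Xu‖ + ‖(1 - X)u‖, and 1 - X vanishes near the circle, where the
mass concentrates. -/
theorem exists_half_le_eLpNorm_cutoff (hR : 0 < R) (hχ : IsGalleryCutoff R χ)
    {g ψ : ℕ → 𝓢(ℝ, ℝ)} (hG : IsProfile G g) (hΨ : IsProfile Ψ ψ) {a : ℕ → ℝ} {A : ℝ}
    (ha : ∀ m, 1 ≤ m → |a m| ≤ A * m)
    (hnorm : ∀ m, 1 ≤ m → eLpNorm (quasiMode R G Ψ χ (a m) m) 2 volume = 1)
    {X : Plane → ℝ} (hX : IsCutoff X) (h1 : ∀ᶠ x in 𝓝ˢ (interface R), X x = 1) :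
    ∃ M : ℕ, ∀ m, M ≤ m →
      1 / 2 ≤ eLpNorm (fun x => X x • quasiMode R G Ψ χ (a m) m x) 2 volume := by
  obtain ⟨δ, hδ, hδ1⟩ := exists_one_near_interface hR h1
  -- Two of the three powers compensate |a m| ≤ A m; the last one makes the tail tend to 0.
  obtain ⟨C, hC⟩ := quasiMode_tail hR hχ hG hΨ hδ 3
  obtain ⟨ρ, hρ⟩ := hχ.exists_radius
  set V := (volume (Metric.closedBall (0 : Plane) ρ) ^ (2 : ℝ≥0∞).toReal⁻¹).toReal with hV
  have hlim : Tendsto (fun m : ℕ => V * (|C| * |A| * smallParam m)) atTop (𝓝 0) := by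
    simpa using (tendsto_smallParam.const_mul (|C| * |A|)).const_mul V
  obtain ⟨M, hM⟩ := eventually_atTop.1 (hlim.eventually (gt_mem_nhds (by norm_num : (0 : ℝ) < 1 / 2)))
  refine ⟨max M 1, fun m hm => ?_⟩
  have hm1 : 1 ≤ m := (le_max_right _ _).trans hm
  set u := quasiMode R G Ψ χ (a m) m with hu
  have hus : ContDiffOn ℝ ∞ u (interface R)ᶜ := quasiMode_contDiffOn hR hχ hG.smooth hΨ.smooth _ _
  have ht := (smallParam_pos hm1).le
  have hb : ∀ x ∈ (interface R)ᶜ, ‖(1 - X x) • u x‖ ≤ |C| * |A| * smallParam m := fun x _ => by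
    rw [norm_smul, Real.norm_eq_abs, abs_of_nonneg (by linarith [(hX.2.2 x).2])]
    by_cases hx : |‖x‖ - R| < δ
    · rw [(hδ1 x hx).self_of_nhds, sub_self, zero_mul]
      positivity
    · have h2 := hC (a m) m hm1 x (not_lt.1 hx)
      have h3 : |a m| ≤ |A| * m := (ha m hm1).trans
        (mul_le_mul_of_nonneg_right (le_abs_self A) (Nat.cast_nonneg m))
      calc _ ≤ 1 * ‖u x‖ := by
            gcongr
            linarith [(hX.2.2 x).1]
        _ ≤ |C| * |a m| * smallParam m ^ 3 := by
            rw [one_mul]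
            refine h2.trans ?_
            gcongr
            exact le_abs_self C
        _ ≤ |C| * (|A| * m) * smallParam m ^ 3 := by gcongr
        _ = |C| * |A| * smallParam m * (m * smallParam m ^ 2) := by ring
        _ = _ := by rw [mul_smallParam_sq hm1, mul_one]
  have hc : ContinuousOn (fun x => (1 - X x) • u x) (interface R)ᶜ :=
    ((continuous_const.sub hX.1.continuous).continuousOn).smul hus.continuousOn
  have hz : ∀ x ∈ (interface R)ᶜ, ρ < ‖x‖ → u x = 0 := fun x _ hx =>
    (quasiMode_eventually_zero (a m) m (hρ x hx)).self_of_nhds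
  obtain ⟨hL, hL'⟩ := memLp_of_bound hR hc hb fun x h hx => by rw [hz x h hx, smul_zero]
  have hXc : ContinuousOn (fun x => X x • u x) (interface R)ᶜ :=
    hX.1.continuous.continuousOn.smul hus.continuousOn
  have hXm : AEStronglyMeasurable (fun x => X x • u x) volume := by
    have h3 := hXc.aestronglyMeasurable (μ := volume) (isOpen_compl_interface R).measurableSet
    rwa [Measure.restrict_eq_self_of_ae_mem (ae_mem_compl_interface hR)] at h3
  have hsmall : eLpNorm (fun x => (1 - X x) • u x) 2 volume ≤ 1 / 2 := by
    have h3 : (eLpNorm (fun x => (1 - X x) • u x) 2 volume).toReal ≤ 1 / 2 := by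
      refine hL'.trans ?_
      rw [abs_of_nonneg (by positivity)]
      exact (hM m ((le_max_left _ _).trans hm)).le
    rw [← ENNReal.ofReal_toReal hL.2.ne]
    refine (ENNReal.ofReal_le_ofReal h3).trans (le_of_eq ?_)
    rw [ENNReal.ofReal_div_of_pos (by norm_num)]
    simp
  have htri : (1 : ℝ≥0∞) ≤ eLpNorm (fun x => X x • u x) 2 volume
      + eLpNorm (fun x => (1 - X x) • u x) 2 volume := by
    rw [← hnorm m hm1]
    have : quasiMode R G Ψ χ (a m) m = (fun x => X x • u x) + fun x => (1 - X x) • u x := by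
      ext x
      rw [Pi.add_apply, ← add_smul, add_sub_cancel, one_smul, hu]
    rw [this]
    exact eLpNorm_add_le hXm hL.1 (by norm_num)
  have hadd := htri.trans (add_le_add_right hsmall _)
  have hhalf : (1 : ℝ≥0∞) / 2 + 1 / 2 = 1 := ENNReal.add_halves 1
  have hsum := hhalf.trans_le hadd
  exact (ENNReal.add_le_add_iff_right (by simp)).1 hsum

end

/-! ### Expansion of the wave numbers -/

/-- The function `K` such that `k m / m = K (m^{-1/2})`. -/
noncomputable def dispersion (n : ℝ → ℝ) (R : ℝ) (e : ℝ → ℝ) (t : ℝ) : ℝ :=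
  Real.sqrt (1 + t ^ 2 * e t) / (R * n R)

theorem abs_sqrt_one_add_sub_le {s : ℝ} (hs : 0 ≤ s) :
    |Real.sqrt (1 + s) - (1 + s / 2)| ≤ s ^ 2 := by
  have h1 : 1 ≤ Real.sqrt (1 + s) := Real.one_le_sqrt.2 (by linarith)
  have h2 : Real.sqrt (1 + s) ^ 2 = 1 + s := Real.sq_sqrt (by linarith)
  set w := Real.sqrt (1 + s)
  have h3 : w - (1 + s / 2) = -((w - 1) ^ 2 / 2) := by linear_combination h2 / 2
  have h4 : w - 1 ≤ s := by nlinarith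
  rw [h3, abs_neg, abs_of_nonneg (by positivity)]
  nlinarith [pow_le_pow_left₀ (sub_nonneg.2 h1) h4 2]

section

variable {n : ℝ → ℝ} {R : ℝ} {p : ℤ} {j : ℕ} {g ψ : ℕ → 𝓢(ℝ, ℝ)} {E : ℕ → ℝ}
  {G Ψ : ℝ × ℝ → ℝ} {e : ℝ → ℝ}

theorem waveNumber_div {m : ℕ} (hm : 1 ≤ m) :
    waveNumber n R e m / m = dispersion n R e (smallParam m) := by
  have h0 : (m : ℝ) ≠ 0 := by positivity
  rw [waveNumber, dispersion, mul_div_cancel_left₀ _ h0]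

theorem ExactProfiles.contDiffOn_dispersion (hX : ExactProfiles n p R g ψ E G Ψ e) :
    ContDiffOn ℝ ∞ (dispersion n R e) (Icc 0 1) := by
  refine (ContDiffOn.sqrt (contDiffOn_const.add ((contDiffOn_id.pow 2).mul
    hX.energy_smooth.contDiffOn)) fun t ht => ?_).div_const _
  have := hX.energy_pos t ht
  simp only [id]
  positivity

theorem smallParam_pow_eq_rpow (m l : ℕ) : smallParam m ^ l = (m : ℝ) ^ (-(l : ℝ) / 2) := by
  rw [smallParam, ← Real.rpow_natCast, ← Real.rpow_mul (Nat.cast_nonneg m)]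
  congr 1
  ring

theorem ExactProfiles.dispersion_expansion (hX : ExactProfiles n p R g ψ E G Ψ e) :
    ∃ K : ℕ → ℝ, HasTaylor (dispersion n R e) K 1 ∧ K 0 = 1 / (R * n R) ∧ K 1 = 0 ∧
      K 2 = 1 / (R * n R) * (E 0 / 2) ∧ K 3 = 1 / (R * n R) * (E 1 / 2) := by
  have hT := hasTaylor_of_contDiffOn zero_le_one hX.contDiffOn_dispersion
  refine ⟨_, hT, ?_⟩
  obtain ⟨C, hC⟩ := hX.energy 2
  obtain ⟨B, hB⟩ := isCompact_Icc.exists_bound_of_continuousOn (s := Icc (0 : ℝ) 1)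
    (f := e) hX.energy_smooth.continuous.continuousOn
  set c := 1 / (R * n R) with hc
  -- These come from √(1 + t²e) = 1 + t²e/2 + O(t⁴) and e = E 0 + tE 1 + O(t²).
  set d : ℕ → ℝ := fun k => if k = 0 then c else if k = 2 then c * (E 0 / 2)
    else if k = 3 then c * (E 1 / 2) else 0 with hd
  have key : ∀ y ∈ Icc (0 : ℝ) 1, |dispersion n R e y - ∑ k ∈ Finset.range 4, d k * y ^ k|
      ≤ |c| * (B ^ 2 + C / 2) * y ^ 4 := fun y hy => by
    have he := hX.energy_pos y hy
    have h1 := abs_sqrt_one_add_sub_le (s := y ^ 2 * e y) (by positivity)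
    have h2 := hC y hy
    have h3 : e y ≤ B := (le_abs_self _).trans (hB y hy)
    simp only [Finset.sum_range_succ, Finset.sum_range_zero, zero_add, pow_zero, one_mul,
      pow_one] at h2
    have h4 : dispersion n R e y - ∑ k ∈ Finset.range 4, d k * y ^ k
        = c * ((Real.sqrt (1 + y ^ 2 * e y) - (1 + y ^ 2 * e y / 2))
          + y ^ 2 / 2 * (e y - (E 0 + y * E 1))) := by
      simp [hd, Finset.sum_range_succ, dispersion, hc]
      ring
    rw [h4, abs_mul, mul_assoc]
    refine mul_le_mul_of_nonneg_left ((abs_add_le _ _).trans ?_) (abs_nonneg c)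
    rw [abs_mul, abs_of_nonneg (by positivity : 0 ≤ y ^ 2 / 2)]
    calc _ ≤ (y ^ 2 * e y) ^ 2 + y ^ 2 / 2 * (C * y ^ 2) := by gcongr
      _ ≤ (y ^ 2 * B) ^ 2 + y ^ 2 / 2 * (C * y ^ 2) := by gcongr
      _ = _ := by ring
  have hu := HasTaylor.unique one_pos one_pos hT 4 key
  refine ⟨(hu 0 (by norm_num)).trans ?_, (hu 1 (by norm_num)).trans ?_,
    (hu 2 (by norm_num)).trans ?_, (hu 3 (by norm_num)).trans ?_⟩ <;> simp [hd]

/-! ### The profiles as families of Schwartz functions -/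

theorem IsProfile.isSchwartzFamily {F : ℝ × ℝ → ℝ} {φ : ℕ → 𝓢(ℝ, ℝ)} (hF : IsProfile F φ)
    {I : Set ℝ} (hI : UniqueDiffOn ℝ I) : IsSchwartzFamily I F := by
  refine ⟨hF.smooth.contDiffOn, fun a d => ?_⟩
  obtain ⟨C, hC⟩ := hF.decay a d
  refine ⟨C, fun z hz => ?_⟩
  rw [iteratedFDerivWithin_eq_iteratedFDeriv ((uniqueDiffOn_Icc one_pos).prod hI)
    ((hF.smooth.of_le (by exact_mod_cast le_top)).contDiffAt) hz]
  exact hC z.1 hz.1 z.2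

/-- The reflection `(t, x) ↦ (t, -x)`. -/
noncomputable def reflectSnd : (ℝ × ℝ) ≃ₗᵢ[ℝ] (ℝ × ℝ) :=
  { LinearEquiv.prodCongr (LinearEquiv.refl ℝ ℝ) (LinearEquiv.neg ℝ) with
    norm_map' := fun z => by simp [Prod.norm_def] }

theorem IsProfile.isSchwartzFamily_reflect {F : ℝ × ℝ → ℝ} {φ : ℕ → 𝓢(ℝ, ℝ)}
    (hF : IsProfile F φ) {I : Set ℝ} (hI : UniqueDiffOn ℝ I) :
    IsSchwartzFamily I fun z => F (z.1, -z.2) := by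
  have hs : ContDiff ℝ ∞ fun z : ℝ × ℝ => F (z.1, -z.2) :=
    hF.smooth.comp (contDiff_fst.prodMk contDiff_snd.neg)
  refine ⟨hs.contDiffOn, fun a d => ?_⟩
  obtain ⟨C, hC⟩ := hF.decay a d
  refine ⟨C, fun z hz => ?_⟩
  rw [iteratedFDerivWithin_eq_iteratedFDeriv ((uniqueDiffOn_Icc one_pos).prod hI)
    ((hs.of_le (by exact_mod_cast le_top)).contDiffAt) hz]
  have h1 := hC z.1 hz.1 (-z.2)
  have h2 := reflectSnd.norm_iteratedFDeriv_comp_right F z d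
  rw [abs_neg] at h1
  exact (congrArg (fun s => |z.2| ^ a * s) h2).le.trans h1

theorem IsProfile.apply_zero {F : ℝ × ℝ → ℝ} {φ : ℕ → 𝓢(ℝ, ℝ)} (hF : IsProfile F φ) (x : ℝ) :
    F (0, x) = φ 0 x := by
  obtain ⟨C, hC⟩ := hF.expansion 0 1 0
  have := hC 0 ⟨le_rfl, zero_le_one⟩ x
  simp only [pow_zero, one_mul, iteratedDeriv_zero, Finset.sum_range_one, pow_one, mul_zero] at this
  exact sub_eq_zero.1 (abs_nonpos_iff.1 this)

theorem IsProfile.hasDerivWithinAt {F : ℝ × ℝ → ℝ} {φ : ℕ → 𝓢(ℝ, ℝ)} (hF : IsProfile F φ)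
    (x : ℝ) : HasDerivWithinAt (fun t => F (t, x)) (φ 1 x) (Icc 0 1) 0 := by
  obtain ⟨C, hC⟩ := hF.expansion 0 2 0
  rw [hasDerivWithinAt_iff_isLittleO]
  have hb : (fun t => F (t, x) - F (0, x) - (t - 0) • φ 1 x)
      =O[𝓝[Icc 0 1] 0] fun t : ℝ => t ^ 2 := by
    refine Asymptotics.IsBigO.of_bound C ?_
    filter_upwards [self_mem_nhdsWithin] with t ht
    have := hC t ht x
    simp only [pow_zero, one_mul, iteratedDeriv_zero, Finset.sum_range_succ,
      Finset.sum_range_zero, zero_add, pow_one] at this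
    rw [hF.apply_zero, Real.norm_eq_abs, Real.norm_eq_abs, abs_of_nonneg (sq_nonneg t), sub_zero,
      smul_eq_mul, sub_sub]
    exact this
  simp only [sub_zero] at hb ⊢
  exact hb.trans_isLittleO ((Asymptotics.isLittleO_pow_id one_lt_two).mono nhdsWithin_le_nhds)

/-! ### The first two interior profiles -/

theorem hasDerivAt_comp_neg {f : 𝓢(ℝ, ℝ)} (σ : ℝ) :
    HasDerivAt (fun σ => f (-σ)) (-(sD f (-σ))) σ := by
  have h := (hasDerivAt_sD f (-σ)).comp σ (hasDerivAt_neg σ)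
  rwa [mul_neg_one] at h

theorem deriv_comp_neg_eq (f : 𝓢(ℝ, ℝ)) : deriv (fun σ => f (-σ)) = fun σ => -(sD f (-σ)) :=
  funext fun σ => (hasDerivAt_comp_neg σ).deriv

theorem iteratedDeriv_two_comp_neg (f : 𝓢(ℝ, ℝ)) :
    iteratedDeriv 2 (fun σ => f (-σ)) = fun σ => sD (sD f) (-σ) := by
  rw [iteratedDeriv_succ, iteratedDeriv_one, deriv_comp_neg_eq]
  ext σ
  simpa using (hasDerivAt_comp_neg (f := sD f) σ).neg.deriv

theorem FormalSolution.leadingProfile_eq {m b θ : ℕ → ℝ}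
    (hS : FormalSolution n p R j m b θ g ψ E) {σ : ℝ} (hσ : σ < 1) :
    leadingProfile n R j σ = g 0 (-σ) := by
  rw [hS.leading_interior (-σ) (by linarith), leadingProfile]
  congr 1
  ring

/-- Under σ = -x the terms 2xg'', g' and x³g change sign, which accounts for the signs in the two
forms of the equation. -/
theorem FormalSolution.isSecondProfile {m b θ : ℕ → ℝ}
    (hS : FormalSolution n p R j m b θ g ψ E) :
    IsSecondProfile n p R j fun σ => g 1 (-σ) where
  boundary := by rw [neg_zero]; exact hS.second_boundary
  equation σ hσ := by
    have hloc : leadingProfile n R j =ᶠ[𝓝 σ] fun σ => g 0 (-σ) := by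
      filter_upwards [gt_mem_nhds (show σ < 1 by linarith)] with s hs
        using hS.leadingProfile_eq hs
    have h := hS.second_interior (-σ) (by linarith)
    rw [hS.second_energy] at h
    rw [hloc.deriv_eq, hloc.iteratedDeriv_eq 2, hloc.self_of_nhds, iteratedDeriv_two_comp_neg,
      iteratedDeriv_two_comp_neg, deriv_comp_neg_eq]
    linear_combination h
  orthogonal := by
    rw [← integral_Iic_eq_integral_Iio]
    have h := integral_comp_neg_Ioi 0 fun σ => (g 1 (-σ) - exteriorAmplitude n p R j
      / gaussHermite 0 0 * gaussHermite 0 (effHessian n R ^ (1 / 4 : ℝ) * σ))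
        * leadingProfile n R j σ
    rw [neg_zero] at h
    refine h.symm.trans (Eq.trans ?_ hS.second_orthogonal)
    refine setIntegral_congr_Ioi fun x hx => ?_
    rw [hS.leadingProfile_eq (by linarith), neg_neg]
    congr 4
    ring

/-! ### The quasi-modes in polar coordinates -/

theorem angular_polarPoint {r : ℝ} (hr : 0 < r) (θ : ℝ) (m : ℕ) :
    angular m (polarPoint r θ) = Complex.exp (Complex.I * m * θ) := by
  have h0 : (r : ℂ) ≠ 0 := by exact_mod_cast hr.ne'
  have h1 : Complex.I * m * θ = m * (θ * Complex.I) := by ring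
  rw [angular, norm_polarPoint hr.le, h1, Complex.exp_nat_mul, Complex.exp_mul_I]
  congr 1
  simp only [polarPoint, PiLp.toLp_apply, Matrix.cons_val_zero, Matrix.cons_val_one]
  push_cast
  field_simp

theorem quasiMode_polarPoint (hR : 0 < R) (X : ℝ → ℝ) (a : ℝ) {m : ℕ} (hm : 1 ≤ m) {r : ℝ}
    (hr : 0 < r) (θ : ℝ) :
    quasiMode R G Ψ (fun x => X ‖x‖) a m (polarPoint r θ) =
      ((a * (X r * if r < R
        then G ((m : ℝ) ^ (-(1 / 2) : ℝ), -((m : ℝ) ^ (1 / 2 : ℝ) * (r / R - 1)))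
        else Ψ ((m : ℝ) ^ (-(1 / 2) : ℝ), m * (r / R - 1))) : ℝ) : ℂ)
          * Complex.exp (Complex.I * m * θ) := by
  have ht : 0 < smallParam m := smallParam_pos hm
  have h1 : (m : ℝ) ^ (1 / 2 : ℝ) = 1 / smallParam m := by
    rw [smallParam, Real.rpow_neg (Nat.cast_nonneg m), div_inv_eq_mul, one_mul]
  have h2 : (m : ℝ) = 1 / smallParam m ^ 2 :=
    eq_div_of_mul_eq (by positivity) (mul_smallParam_sq hm)
  have e1 : 1 / smallParam m + -(1 / (R * smallParam m)) * r
      = -(1 / smallParam m * (r / R - 1)) := by field_simp; ring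
  have e2 : -(1 / smallParam m ^ 2) + 1 / (R * smallParam m ^ 2) * r
      = 1 / smallParam m ^ 2 * (r / R - 1) := by field_simp; ring
  rw [quasiMode, glue, norm_polarPoint hr.le, h1]
  split_ifs with h
  · rw [mode, norm_polarPoint hr.le, angular_polarPoint hr, interiorRadial, affineProfile, e1,
      ← smallParam, Complex.real_smul]
    push_cast
    ring
  · rw [mode, norm_polarPoint hr.le, angular_polarPoint hr, exteriorRadial, affineProfile, e2,
      ← h2, ← smallParam, Complex.real_smul]
    push_cast
    ring

end

end WGM

/-! ### Assembly of the whispering gallery family. -/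

theorem theorem5p1 (R : ℝ) (hR : 0 < R) (n : ℝ → ℝ) (hn : IsOpticalIndex n R)
    (hκ : effCurvature n R = 0) (hμ : 0 < effHessian n R)
    (p : ℤ) (hp : p = 1 ∨ p = -1) (j : ℕ) :
    ∃ (k : ℕ → ℝ) (u : ℕ → Plane → ℂ),
      IsWhisperingGalleryFamily n p R k u ∧
      -- (i) regularity with exponent 1/2, and the expansion in powers of m^{-1/2}
      IsRegularInM k (1 / 2) ∧
      (∃ K : ℕ → ℝ,
        (∀ N : ℕ, ∃ C : ℝ, ∀ m : ℕ, 1 ≤ m →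
          |k m / m - ∑ l ∈ Finset.range N, K l * (m : ℝ) ^ (-(l : ℝ) / 2)|
            ≤ C * (m : ℝ) ^ (-(N : ℝ) / 2)) ∧
        K 0 = 1 / (R * nCoeff n R 0) ∧
        K 1 = 0 ∧
        K 2 = 1 / (R * nCoeff n R 0) * ((2 * j + 3 / 2) * Real.sqrt (effHessian n R)) ∧
        K 3 = 1 / (R * nCoeff n R 0)
          * (thirdCoeff n p R j * effHessian n R ^ (3 / 4 : ℝ))) ∧
      -- (ii) structure of the quasi-modes, up to the normalization factor a m
      (∃ (X : ℝ → ℝ) (Φ Ψ : ℝ × ℝ → ℝ) (a : ℕ → ℝ),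
        ContDiff ℝ ∞ X ∧ HasCompactSupport X ∧ tsupport X ⊆ Ioi 0 ∧ (∀ᶠ r in 𝓝 R, X r = 1) ∧
        IsSchwartzFamily (Iic 0) Φ ∧ IsSchwartzFamily (Ici 0) Ψ ∧
        (∀ m : ℕ, 1 ≤ m → 0 < a m ∧
          ∀ r : ℝ, 0 < r → r ≠ R → ∀ θ : ℝ,
            u m (polarPoint r θ) =
              ((a m * (X r * if r < R
                  then Φ ((m : ℝ) ^ (-(1 / 2) : ℝ), (m : ℝ) ^ (1 / 2 : ℝ) * (r / R - 1))
                  else Ψ ((m : ℝ) ^ (-(1 / 2) : ℝ), m * (r / R - 1))) : ℝ) : ℂ)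
                * Complex.exp (Complex.I * m * θ)) ∧
        -- the first two terms of the profiles at t = 0
        (∀ σ : ℝ, σ ≤ 0 → Φ (0, σ) = leadingProfile n R j σ) ∧
        (∀ ρ : ℝ, 0 ≤ ρ → Ψ (0, ρ) = 0) ∧
        (∃ φ₁ : ℝ → ℝ, IsSecondProfile n p R j φ₁ ∧
          ∀ σ : ℝ, σ ≤ 0 → HasDerivWithinAt (fun t => Φ (t, σ)) (φ₁ σ) (Icc 0 1) 0) ∧
        (∀ ρ : ℝ, 0 ≤ ρ → HasDerivWithinAt (fun t => Ψ (t, ρ))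
          (exteriorAmplitude n p R j
            * Real.exp (-(Real.sqrt (nCoeff n R 0 ^ 2 - 1) / nCoeff n R 0) * ρ)) (Icc 0 1) 0)) := by
  obtain ⟨m, b, θ, hm, hb, hθ, m0, m1, b0, θ0, θ1, θ2, θ3⟩ := exists_coefficients p hR hn hκ
  obtain ⟨g, ψ, E, hS⟩ := exists_formalSolution hR hn hμ p j m0 m1 b0 θ2 θ3
  obtain ⟨G, Ψ, e, hX⟩ := hS.exists_exactProfiles hμ
  have hin := fun N => interiorResidual_rapid hS hX hm hb hθ θ0 θ1 N
  have hex := fun N => exteriorResidual_rapid hS hX N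
  obtain ⟨X, hXs, hXc, hXt, hX1, hXone, hXz, hχ⟩ := exists_radial_cutoff hR
  obtain ⟨c, hc, hlow⟩ := eLpNorm_quasiMode_lower (Ψ := Ψ) hR (fun x => hXone ‖x‖) hX.lower_bound
  set χ : Plane → ℝ := fun x => X ‖x‖
  have hdom : ∀ (a : ℝ) (m : ℕ), 1 ≤ m → MemDomain n p R (quasiMode R G Ψ χ a m) := fun a _ hm =>
    memDomain_quasiMode hR hn hχ hX.interior.smooth hX.exterior.smooth hX.dirichlet
      (fun t => by rw [hX.neumann, nCoeff_zero]) a hm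
  set a := normalizer R G Ψ χ
  have ha : ∀ m : ℕ, 1 ≤ m → 0 < a m ∧ a m ≤ (c * smallParam m)⁻¹ ∧
      eLpNorm (quasiMode R G Ψ χ (a m) m) 2 volume = 1 := fun m hm =>
    normalizer_spec (mul_pos hc (smallParam_pos hm)) (hlow m hm) (hdom 1 m hm).1.2.ne
  -- The lower bound ct of the norm gives a m ≤ 1/(ct), and t⁻¹ ≤ t⁻² = m.
  have haA : ∀ m : ℕ, 1 ≤ m → |a m| ≤ c⁻¹ * m := fun m hm => by
    have ht := smallParam_pos hm
    rw [abs_of_pos (ha m hm).1]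
    refine (ha m hm).2.1.trans ?_
    rw [mul_inv]
    refine mul_le_mul_of_nonneg_left ?_ (inv_pos.2 hc).le
    rw [inv_le_iff_one_le_mul₀ ht, ← mul_smallParam_sq hm]
    exact mul_le_mul_of_nonneg_left
      (pow_le_of_le_one ht.le (smallParam_le_one hm) two_ne_zero) (Nat.cast_nonneg m)
  have hquasi : ∀ χ', IsGalleryCutoff R χ' → QuasiPairEstimate n p R (waveNumber n R e)
      fun m => quasiMode R G Ψ χ' (a m) m := fun χ' hχ' =>
    quasiPairEstimate_quasiMode hR hn hχ' hX hin hex haA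
  have hreg : IsRegularInM (waveNumber n R e) (1 / 2) :=
    ⟨dispersion n R e, hX.contDiffOn_dispersion, fun m hm => waveNumber_div hm⟩
  obtain ⟨K, hK, K0, K1, K2, K3⟩ := hX.dispersion_expansion
  refine ⟨waveNumber n R e, fun m => quasiMode R G Ψ χ (a m) m,
    ⟨⟨fun m hm => (ha m hm).2.2, hquasi χ hχ, ?_, ⟨1 / 2, by norm_num, hreg⟩⟩,
      fun Y hY hY1 => ⟨?_, ?_⟩⟩, hreg, ⟨K, fun N => ?_, ?_, K1, ?_, ?_⟩,
    X, fun z => G (z.1, -z.2), Ψ, a, hXs, hXc, hXt, hX1,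
    hX.interior.isSchwartzFamily_reflect (uniqueDiffOn_Iic 0),
    hX.exterior.isSchwartzFamily (uniqueDiffOn_Ici 0), fun m hm => ⟨(ha m hm).1, ?_⟩,
    fun σ hσ => ?_, fun ρ _ => ?_, ⟨fun σ => g 1 (-σ), hS.isSecondProfile, fun σ _ => ?_⟩,
    fun ρ hρ => ?_⟩
  -- The modes vanish for ‖x‖ ≥ 2R, so a cut-off equal to 1 on that disc leaves them unchanged; the
  -- localization property then holds for every m ≥ 1.
  · obtain ⟨Y, hY, hY1⟩ := exists_plane_cutoff hR
    have hYu : ∀ m, (fun x => Y x • quasiMode R G Ψ χ (a m) m x)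
        = quasiMode R G Ψ χ (a m) m := fun m => by
      rw [quasiMode_mul]
      congr 1
      ext x
      rcases le_total ‖x‖ (2 * R) with h | h
      · rw [hY1 x h, one_mul]
      · simp only [χ, hXz _ h, mul_zero]
    refine ⟨Y, hY, fun m hm => ?_, ?_⟩
    · rw [hYu, (ha m hm).2.2]
      simp
    · exact (congrArg (QuasiPairEstimate n p R (waveNumber n R e)) (funext hYu)).mpr (hquasi χ hχ)
  · exact exists_half_le_eLpNorm_cutoff hR hχ hX.interior hX.exterior haA
      (fun m hm => (ha m hm).2.2) hY hY1
  · exact (congrArg (QuasiPairEstimate n p R (waveNumber n R e))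
      (funext fun m => quasiMode_mul Y (a m) m)).mpr (hquasi _ (hχ.mul hY hY1))
  · obtain ⟨C, hC⟩ := hK N
    refine ⟨C, fun m hm => ?_⟩
    rw [waveNumber_div hm]
    simp only [← smallParam_pow_eq_rpow]
    exact hC _ (smallParam_mem hm)
  · rw [K0, nCoeff_zero]
  · rw [K2, hS.leading_energy, nCoeff_zero]
    ring
  · rw [K3, hS.second_energy, nCoeff_zero]
    ring
  · intro r hr _ θ
    exact quasiMode_polarPoint hR X (a m) hm hr θ
  · exact (hX.interior.apply_zero _).trans (hS.leadingProfile_eq (by linarith)).symm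
  · rw [hX.exterior.apply_zero, hS.leading_exterior]
    rfl
  · exact hX.interior.hasDerivWithinAt (-σ)
  · rw [← hS.second_exterior ρ hρ]
    exact hX.exterior.hasDerivWithinAt ρ
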